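/- **Theorem 5.3 (Jet Isomorphism Theorem).** Let $n\ge 1$. On $\mathbb{C}^{n+1}$ with coordinates $\xi=(\xi_0,\dots,\xi_n)$ put $L(\xi)=\sum\widetilde g_{I\overline J}\,\xi_I\overline{\xi_J}=\tfrac12\bigl(\xi_0\overline{\xi_n}+\xi_n\overline{\xi_0}-\sum_{j=1}^{n-1}|\xi_j|^2\bigr)$, let $(\widetilde g^{I\overline J})$ be the inverse matrix of $(\widetilde g_{I\overline J})$, $\Delta=\sum\widetilde g^{I\overline J}\partial_I\partial_{\overline J}$, $\widetilde e_0=(1,0,\dots,0)$, and let $P$ be the group of complex matrices $h$ with $\det h=1$ that preserve $L$ and satisfy $h\widetilde e_0=\lambda\widetilde e_0$ for some $\lambda\in\mathbb{C}$. *Jets.* The sphere is $\{L=0\}/\mathbb{C}^*$; near $e_0=[\widetilde e_0]$ it is parametrized by $(w',v)\in\mathbb{C}^{n-1}\times\mathbb{R}$ through the points $[1:w':\tfrac12|w'|^2+iv]$. Let $J\mathcal{E}$ be the space of real formal power series $f=\sum A^l_{\alpha\overline\beta}\,w'^\alpha\overline{w}'^\beta v^l$ (the jets of real functions at $e_0$),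 on which $h\in P$ acts by $h\cdot f=f\circ h^{-1}$, and let $J\mathcal{P}\subset J\mathcal{E}$ be the space of series $\operatorname{Re}\sum A^l_\alpha w'^\alpha(|w'|^2+2iv)^l$ with $A^l_\alpha\in\mathbb{C}$ (the jets of CR pluriharmonic functions). Write $A_{p,q}$ for the part of $f$ of bidegree $(p,q)$ in $(w',\overline w')$, and let $\mathcal{N}_0$ be the space of $f\in J\mathcal{E}$ with $A_{p,q}=0$ whenever $\min(p,q)=0$ and $\sum_{j=1}^{n-1}\partial_{w_j}\partial_{\overline w_j}A_{1,1}=0$. Let $\mathcal{N}_0^{[2n]}$ be the space of the truncations $(A^l_{\alpha\overline\beta})_{|\alpha|+|\beta|+2l<2n}$ of the elements of $\mathcal{N}_0$. *Tensors.* Let $\mathbb{T}_0=\prod_{p,q\ge1}\bigodot^pV^*\otimes\bigodot^q\overline V^*\otimes\sigma_{-p,-q}$, where $V=\mathbb{C}^{n+1}$ is the standard representation of $P$ and $\sigma_{-p,-q}$ is the one-dimensional representation $h\mapsto\lambda^p\overline\lambda{}^q$. Let $\mathcal{H}_0\subset\mathbb{T}_0$ be the real subspace of all $(T_{\mathcal{I}\overline{\mathcal{J}}})$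 with $$\overline{T_{\mathcal{I}\overline{\mathcal{J}}}}=T_{\mathcal{J}\overline{\mathcal{I}}},\qquad \sum_{K,L}\widetilde g^{K\overline L}T_{\mathcal{I}K\overline L\,\overline{\mathcal{J}}}=0,\qquad T_{\mathcal{I}0\overline{\mathcal{J}}}=-|\mathcal{I}|\,T_{\mathcal{I}\overline{\mathcal{J}}},$$ where $|\mathcal{I}|$ is the length of $\mathcal{I}$, empty $\mathcal{I}$ is allowed in the last two equations and empty $\mathcal{J}$ in the second, and the last equation reads $T_{0\overline{\mathcal{J}}}=0$ for empty $\mathcal{I}$. The weight $\|\mathcal{I}\overline{\mathcal{J}}\|$ is the sum of the weights of the indices, where $\|0\|=0$, $\|j\|=1$ for $1\le j\le n-1$, $\|n\|=2$. Let $\mathcal{H}_0^{[2n]}$ be the projection of $\mathcal{H}_0$ to the components with $\|\mathcal{I}\overline{\mathcal{J}}\|<2n$. *The map.* For $f\in J\mathcal{E}$, an ambient extension of $f$ is (the jet at $\widetilde e_0$ of) a real function $\widetilde f$, homogeneous of degree $(0,0)$, whose restriction to $\{L=0\}$ is $f$ and which satisfies $\Delta\widetilde f=O(L^{n-1})$.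 Put $T_{\mathcal{I}\overline{\mathcal{J}}}(\widetilde f)=\partial_{I_1}\cdots\partial_{I_p}\partial_{\overline J_1}\cdots\partial_{\overline J_q}\widetilde f(\widetilde e_0)$ for $p,q\ge1$. Then: 1. $J\mathcal{E}=\mathcal{N}_0\oplus J\mathcal{P}$ and $J\mathcal{P}$ is $P$-invariant, so $P$ acts on $\mathcal{N}_0\cong J\mathcal{E}/J\mathcal{P}$; this action descends to a representation of $P$ on $\mathcal{N}_0^{[2n]}$. Likewise $\mathcal{H}_0$ is $P$-invariant and the action descends to a representation of $P$ on $\mathcal{H}_0^{[2n]}$. 2. Every $f\in J\mathcal{E}$ has an ambient extension $\widetilde f$, and the components $T_{\mathcal{I}\overline{\mathcal{J}}}(\widetilde f)$ with $\|\mathcal{I}\overline{\mathcal{J}}\|<2n$ depend only on the image in $\mathcal{N}_0^{[2n]}$ of the class of $f$ modulo $J\mathcal{P}$. They form an element of $\mathcal{H}_0^{[2n]}$, which defines a map $T\colon\mathcal{N}_0^{[2n]}\to\mathcal{H}_0^{[2n]}$. 3. $T$ is an isomorphism of $P$-modules, i.e. an $\mathbb{R}$-linear $P$-equivariant bijection.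 -/

import Mathlib

namespace JetIso

/-! ### The ambient space and the parabolic subgroup

All objects on `ℂ^{n+1}` are written in the linear coordinates `ξ_0, ξ_1, …, ξ_{n-1}, ξ_n` in which
`2 L(ξ) = ξ_0 conj ξ_n + ξ_n conj ξ_0 - ∑_{1 ≤ j ≤ n-1} |ξ_j|²` and `ẽ_0 = (1, 0, …, 0)`. -/

/-- The ambient indices `0`, `1, …, n-1`, `n` (for `n ≥ 1`). -/
inductive Idx (n : ℕ) : Type
  | zero : Idx n
  | mid (j : Fin (n - 1)) : Idx n
  | last : Idx n
  deriving DecidableEq, Fintype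

/-- The weight of an index: `‖0‖ = 0`, `‖j‖ = 1` for `1 ≤ j ≤ n-1`, `‖n‖ = 2`. -/
def Idx.wt {n : ℕ} : Idx n → ℕ
  | .zero => 0
  | .mid _ => 1
  | .last => 2

/-- The matrix `g̃_{I J̄}` of the Lorentz-hermitian form, `L(ξ) = ∑ g̃_{I J̄} ξ_I conj ξ_J`. -/
noncomputable def gLow (n : ℕ) : Matrix (Idx n) (Idx n) ℂ := fun I J =>
  match I, J with
  | .zero, .last => 1 / 2
  | .last, .zero => 1 / 2
  | .mid i, .mid j => if i = j then -(1 / 2) else 0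
  | _, _ => 0

/-- The inverse matrix `g̃^{I J̄}`. -/
noncomputable def gUp (n : ℕ) : Matrix (Idx n) (Idx n) ℂ := fun I J =>
  match I, J with
  | .zero, .last => 2
  | .last, .zero => 2
  | .mid i, .mid j => if i = j then -2 else 0
  | _, _ => 0

/-- The vector `ẽ_0 = (1, 0, …, 0)`. -/
def e0 (n : ℕ) : Idx n → ℂ := Pi.single Idx.zero 1

/-- `G = SU(1, n)`: the matrices of determinant one that preserve the hermitian form `L`. -/
def G (n : ℕ) : Subgroup (Matrix.SpecialLinearGroup (Idx n) ℂ) where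
  carrier := {h | h.1.conjTranspose * gLow n * h.1 = gLow n}
  one_mem' := by simp
  mul_mem' := by
    intro a b ha hb
    simp only [Set.mem_ofPred_eq] at ha hb ⊢
    calc (a * b).1.conjTranspose * gLow n * (a * b).1
        = b.1.conjTranspose * (a.1.conjTranspose * gLow n * a.1) * b.1 := by
          simp only [Matrix.SpecialLinearGroup.coe_mul, Matrix.conjTranspose_mul, Matrix.mul_assoc]
      _ = gLow n := by rw [ha, hb]
  inv_mem' := by
    intro a ha
    simp only [Set.mem_ofPred_eq] at ha ⊢
    have h1 : a.1 * (a⁻¹).1 = 1 := by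
      rw [← Matrix.SpecialLinearGroup.coe_mul, mul_inv_cancel, Matrix.SpecialLinearGroup.coe_one]
    have h2 : (a⁻¹).1.conjTranspose * a.1.conjTranspose = 1 := by
      rw [← Matrix.conjTranspose_mul, h1, Matrix.conjTranspose_one]
    calc (a⁻¹).1.conjTranspose * gLow n * (a⁻¹).1
        = (a⁻¹).1.conjTranspose * (a.1.conjTranspose * gLow n * a.1) * (a⁻¹).1 := by rw [ha]
      _ = ((a⁻¹).1.conjTranspose * a.1.conjTranspose) * gLow n * (a.1 * (a⁻¹).1) := by
          simp only [Matrix.mul_assoc]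
      _ = gLow n := by rw [h1, h2, Matrix.one_mul, Matrix.mul_one]

/-- The matrices that preserve the complex line through `ẽ_0`. -/
def lineStab (n : ℕ) : Subgroup (Matrix.SpecialLinearGroup (Idx n) ℂ) where
  carrier := {h | ∃ c : ℂ, h.1.mulVec (e0 n) = c • e0 n}
  one_mem' := ⟨1, by simp⟩
  mul_mem' := by
    rintro a b ⟨c, hc⟩ ⟨d, hd⟩
    refine ⟨d * c, ?_⟩
    rw [Matrix.SpecialLinearGroup.coe_mul, ← Matrix.mulVec_mulVec, hd, Matrix.mulVec_smul, hc,
      smul_smul]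
  inv_mem' := by
    rintro a ⟨c, hc⟩
    have h1 : (a⁻¹).1 * a.1 = 1 := by
      rw [← Matrix.SpecialLinearGroup.coe_mul, inv_mul_cancel, Matrix.SpecialLinearGroup.coe_one]
    have h2 : c • (a⁻¹).1.mulVec (e0 n) = e0 n := by
      rw [← Matrix.mulVec_smul, ← hc, Matrix.mulVec_mulVec, h1, Matrix.one_mulVec]
    have hc0 : c ≠ 0 := by
      rintro rfl
      have := congrFun h2 Idx.zero
      simp [e0] at this
    refine ⟨c⁻¹, ?_⟩
    have h3 := congrArg (fun x => c⁻¹ • x) h2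
    simpa [smul_smul, inv_mul_cancel₀ hc0] using h3

/-- The parabolic subgroup `P = {h ∈ G : h ẽ_0 = λ ẽ_0}`. -/
def P (n : ℕ) : Subgroup (Matrix.SpecialLinearGroup (Idx n) ℂ) := G n ⊓ lineStab n

/-- The matrix of an element of `P`. -/
def P.mat {n : ℕ} (h : P n) : Matrix (Idx n) (Idx n) ℂ := h.1.1

/-- The eigenvalue `λ` in `h ẽ_0 = λ ẽ_0`. -/
def P.eig {n : ℕ} (h : P n) : ℂ := P.mat h Idx.zero Idx.zero

/-! ### Formal power series with conjugation -/

/-- Complex conjugation of a formal power series whose variables are exchanged by conjugation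
according to `s`: conjugate the coefficients and rename the variables by `s`. -/
noncomputable def bar {τ : Type} (s : τ ≃ τ) :
    MvPowerSeries τ ℂ →ₗ[ℝ] MvPowerSeries τ ℂ where
  toFun f := fun m => star (MvPowerSeries.coeff (m.mapDomain s) f)
  map_add' f g := by
    funext m
    show star (MvPowerSeries.coeff (m.mapDomain s) (f + g)) =
      star (MvPowerSeries.coeff (m.mapDomain s) f) + star (MvPowerSeries.coeff (m.mapDomain s) g)
    rw [map_add, star_add]
  map_smul' r f := by
    funext m
    show star (r • MvPowerSeries.coeff (m.mapDomain s) f) =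
      r • star (MvPowerSeries.coeff (m.mapDomain s) f)
    simp

/-! ### Jets at `e_0`, pluriharmonic jets and the slice -/

/-- The variables `w_j`, `conj w_j` (`1 ≤ j ≤ n-1`) and `v` of the jets of functions on the sphere
at `e_0`, where the sphere is `w_n = |w'|² / 2 + i v`. -/
inductive BVar (n : ℕ) : Type
  | w (j : Fin (n - 1)) : BVar n
  | wb (j : Fin (n - 1)) : BVar n
  | v : BVar n
  deriving DecidableEq, Fintype

/-- Conjugation exchanges `w_j` and `conj w_j` and fixes `v`. -/
def BVar.conj (n : ℕ) : BVar n ≃ BVar n where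
  toFun | .w j => .wb j | .wb j => .w j | .v => .v
  invFun | .w j => .wb j | .wb j => .w j | .v => .v
  left_inv x := by cases x <;> rfl
  right_inv x := by cases x <;> rfl

/-- Formal power series in `(w', conj w', v)` with complex coefficients. -/
abbrev BSeries (n : ℕ) : Type := MvPowerSeries (BVar n) ℂ

/-- The jet space `J𝓔`: real formal power series in `(w', conj w', v)`. -/
noncomputable def JE (n : ℕ) : Submodule ℝ (BSeries n) :=
  LinearMap.ker (bar (BVar.conj n) - LinearMap.id)

/-- The series `|w'|²`. -/
noncomputable def wSq (n : ℕ) : BSeries n :=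
  ∑ j : Fin (n - 1), MvPowerSeries.X (BVar.w j) * MvPowerSeries.X (BVar.wb j)

/-- The holomorphic variables: `some j` is `w_j` and `none` stands for the variable that is replaced
by `|w'|² + 2 i v`. -/
abbrev HVar (n : ℕ) : Type := Option (Fin (n - 1))

/-- The substitution `w_j ↦ w_j`, `none ↦ |w'|² + 2 i v`. -/
noncomputable def holSub (n : ℕ) : HVar n → BSeries n
  | some j => MvPowerSeries.X (BVar.w j)
  | none => wSq n + MvPowerSeries.C (2 * Complex.I) * MvPowerSeries.X BVar.v

lemma hasSubst_holSub (n : ℕ) : MvPowerSeries.HasSubst (holSub n) := by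
  apply MvPowerSeries.hasSubst_of_constantCoeff_zero
  rintro (_ | j) <;> simp [holSub, wSq]

/-- The series `∑ A_α^l w'^α (|w'|² + 2 i v)^l` with coefficients `φ = (A_α^l)`. -/
noncomputable def holRestrict (n : ℕ) (φ : MvPowerSeries (HVar n) ℂ) : BSeries n :=
  MvPowerSeries.subst (holSub n) φ

/-- `J𝓟`: the real parts of the series `∑ A_α^l w'^α (|w'|² + 2 i v)^l`, `A_α^l ∈ ℂ`. -/
noncomputable def JP (n : ℕ) : Submodule ℝ (BSeries n) where
  carrier := {f | ∃ φ : MvPowerSeries (HVar n) ℂ,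
    f = (1 / 2 : ℝ) • (holRestrict n φ + bar (BVar.conj n) (holRestrict n φ))}
  zero_mem' := ⟨0, by
    have : holRestrict n 0 = 0 := by
      rw [holRestrict, ← MvPowerSeries.coe_substAlgHom (hasSubst_holSub n), map_zero]
    simp [this]⟩
  add_mem' := by
    rintro _ _ ⟨φ, rfl⟩ ⟨ψ, rfl⟩
    refine ⟨φ + ψ, ?_⟩
    have : holRestrict n (φ + ψ) = holRestrict n φ + holRestrict n ψ :=
      MvPowerSeries.subst_add (hasSubst_holSub n) φ ψ
    rw [this, map_add, ← smul_add]
    congr 1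
    abel
  smul_mem' := by
    rintro r _ ⟨φ, rfl⟩
    refine ⟨r • φ, ?_⟩
    have : holRestrict n (r • φ) = r • holRestrict n φ :=
      MvPowerSeries.subst_smul (hasSubst_holSub n) r φ
    rw [this, map_smul, ← smul_add, smul_comm]

/-- The degree `|α|` in `w'` of the monomial `w'^α conj w'^β v^l`. -/
def degW {n : ℕ} (m : BVar n →₀ ℕ) : ℕ := ∑ j, m (BVar.w j)

/-- The degree `|β|` in `conj w'` of the monomial `w'^α conj w'^β v^l`. -/
def degWb {n : ℕ} (m : BVar n →₀ ℕ) : ℕ := ∑ j, m (BVar.wb j)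

/-- The weight `|α| + |β| + 2 l` of the monomial `w'^α conj w'^β v^l`. -/
def bwt {n : ℕ} (m : BVar n →₀ ℕ) : ℕ := degW m + degWb m + 2 * m BVar.v

/-- The part `A_{p,q}` of bidegree `(p, q)` in `(w', conj w')` of a series. -/
noncomputable def bidegPart (n p q : ℕ) : BSeries n →ₗ[ℝ] BSeries n where
  toFun f := fun m => if degW m = p ∧ degWb m = q then MvPowerSeries.coeff m f else 0
  map_add' f g := by
    funext m
    show (if degW m = p ∧ degWb m = q then MvPowerSeries.coeff m (f + g) else 0) =
      (if degW m = p ∧ degWb m = q then MvPowerSeries.coeff m f else 0) +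
        (if degW m = p ∧ degWb m = q then MvPowerSeries.coeff m g else 0)
    split_ifs <;> simp
  map_smul' r f := by
    funext m
    show (if degW m = p ∧ degWb m = q then r • MvPowerSeries.coeff m f else 0) =
      r • (if degW m = p ∧ degWb m = q then MvPowerSeries.coeff m f else 0)
    split_ifs <;> simp

/-- The operator `Δ' = ∑ ∂_{w_j} ∂_{conj w_j}`. -/
noncomputable def lapB (n : ℕ) : BSeries n →ₗ[ℝ] BSeries n :=
  ∑ j : Fin (n - 1), ((MvPowerSeries.pderiv ℂ (BVar.w j)).toLinearMap.restrictScalars ℝ) ∘ₗ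
    ((MvPowerSeries.pderiv ℂ (BVar.wb j)).toLinearMap.restrictScalars ℝ)

/-- The slice `𝓝_0`: the `f ∈ J𝓔` with `A_{p,q} = 0` if `min(p,q) = 0`, and `Δ' A_{1,1} = 0`. -/
noncomputable def N0 (n : ℕ) : Submodule ℝ (BSeries n) :=
  JE n ⊓ (⨅ (p : ℕ) (q : ℕ) (_ : min p q = 0), LinearMap.ker (bidegPart n p q)) ⊓
    LinearMap.ker (lapB n ∘ₗ bidegPart n 1 1)

/-- The coordinates `ξ_I` of the point `(1, w', |w'|² / 2 + i v)` of the cone `L = 0`. -/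
noncomputable def conePt (n : ℕ) : Idx n → BSeries n
  | .zero => 1
  | .mid j => MvPowerSeries.X (BVar.w j)
  | .last => MvPowerSeries.C (1 / 2) * wSq n + MvPowerSeries.C Complex.I * MvPowerSeries.X BVar.v

/-- The linear transform `k ξ` of the point `ξ = (1, w', |w'|² / 2 + i v)`. -/
noncomputable def linPt {n : ℕ} (k : Matrix (Idx n) (Idx n) ℂ) (I : Idx n) : BSeries n :=
  ∑ K, MvPowerSeries.C (k I K) * conePt n K

/-- The affine coordinate `(k ξ)_I / (k ξ)_0` of the image of a point of the sphere under `k`. -/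
noncomputable def projPt {n : ℕ} (k : Matrix (Idx n) (Idx n) ℂ) (I : Idx n) : BSeries n :=
  linPt k I * (linPt k Idx.zero)⁻¹

/-- The map of the sphere that `k` induces, in the coordinates `(w', conj w', v)`, `v = Im w_n`. -/
noncomputable def sphereMap {n : ℕ} (k : Matrix (Idx n) (Idx n) ℂ) : BVar n → BSeries n
  | .w j => projPt k (Idx.mid j)
  | .wb j => bar (BVar.conj n) (projPt k (Idx.mid j))
  | .v => MvPowerSeries.C (1 / (2 * Complex.I)) *
      (projPt k Idx.last - bar (BVar.conj n) (projPt k Idx.last))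

/-- The action of `P` on jets of functions at `e_0`: `h · f = f ∘ h⁻¹`. -/
noncomputable def actJ {n : ℕ} (h : P n) (f : BSeries n) : BSeries n :=
  MvPowerSeries.subst (sphereMap (P.mat h⁻¹)) f

/-- The truncation of a series to its coefficients `A_{αβ̄}^l` of weight `< N`. -/
noncomputable def truncB (n N : ℕ) :
    BSeries n →ₗ[ℝ] ({m : BVar n →₀ ℕ // bwt m < N} → ℂ) where
  toFun f := fun m => MvPowerSeries.coeff m.1 f
  map_add' _ _ := rfl
  map_smul' _ _ := rfl

/-- `𝓝_0^{[N]}`: the truncations of the elements of `𝓝_0` to weight `< N`. -/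
noncomputable def N0Trunc (n N : ℕ) : Submodule ℝ ({m : BVar n →₀ ℕ // bwt m < N} → ℂ) :=
  (N0 n).map (truncB n N)

/-- The class in `𝓝_0^{[N]}` of an element of `𝓝_0`. -/
noncomputable def N0Trunc.mk {n : ℕ} (N : ℕ) {f : BSeries n} (hf : f ∈ N0 n) : N0Trunc n N :=
  ⟨truncB n N f, Submodule.mem_map_of_mem hf⟩

/-! ### Ambient jets at `ẽ_0` -/

/-- The variables of ambient jets at `ẽ_0`: `η_I = ξ_I - (ẽ_0)_I` and their conjugates. -/
inductive AVar (n : ℕ) : Type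
  | eta (I : Idx n) : AVar n
  | etab (I : Idx n) : AVar n
  deriving DecidableEq, Fintype

/-- Conjugation exchanges `η_I` and `conj η_I`. -/
def AVar.conj (n : ℕ) : AVar n ≃ AVar n where
  toFun | .eta I => .etab I | .etab I => .eta I
  invFun | .eta I => .etab I | .etab I => .eta I
  left_inv x := by cases x <;> rfl
  right_inv x := by cases x <;> rfl

/-- Formal power series on the ambient space, centred at `ẽ_0`. -/
abbrev ASeries (n : ℕ) : Type := MvPowerSeries (AVar n) ℂ

/-- The coordinate function `ξ_I = (ẽ_0)_I + η_I`. -/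
noncomputable def xi {n : ℕ} (I : Idx n) : ASeries n :=
  MvPowerSeries.C (e0 n I) + MvPowerSeries.X (AVar.eta I)

/-- The coordinate function `conj ξ_I`. -/
noncomputable def xib {n : ℕ} (I : Idx n) : ASeries n :=
  MvPowerSeries.C (e0 n I) + MvPowerSeries.X (AVar.etab I)

/-- The function `L = ∑ g̃_{I J̄} ξ_I conj ξ_J`. -/
noncomputable def Lser (n : ℕ) : ASeries n :=
  ∑ I, ∑ J, MvPowerSeries.C (gLow n I J) * (xi I * xib J)

/-- The ambient Laplacian `Δ = ∑ g̃^{I J̄} ∂_I ∂_{J̄}`. -/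
noncomputable def lapA {n : ℕ} (F : ASeries n) : ASeries n :=
  ∑ I, ∑ J, MvPowerSeries.C (gUp n I J) *
    MvPowerSeries.pderiv ℂ (AVar.eta I) (MvPowerSeries.pderiv ℂ (AVar.etab J) F)

/-- The Euler field `Z = ∑ ξ_I ∂_I`. -/
noncomputable def euler {n : ℕ} (F : ASeries n) : ASeries n :=
  ∑ I, xi I * MvPowerSeries.pderiv ℂ (AVar.eta I) F

/-- The conjugate Euler field. -/
noncomputable def eulerBar {n : ℕ} (F : ASeries n) : ASeries n :=
  ∑ I, xib I * MvPowerSeries.pderiv ℂ (AVar.etab I) F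

/-- The substitution of the point `ξ = (1, w', |w'|² / 2 + i v)` of the cone into an ambient jet. -/
noncomputable def coneSub (n : ℕ) : AVar n → BSeries n
  | .eta I => conePt n I - MvPowerSeries.C (e0 n I)
  | .etab I => bar (BVar.conj n) (conePt n I - MvPowerSeries.C (e0 n I))

/-- The restriction of an ambient jet to the cone `L = 0`, in the coordinates of the sphere. -/
noncomputable def coneRestrict {n : ℕ} (F : ASeries n) : BSeries n :=
  MvPowerSeries.subst (coneSub n) F

/-- `F` is the jet at `ẽ_0` of an ambient extension `f̃` of `f`: it is real, homogeneous of degree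
`(0,0)`, restricts to `f` on the cone `L = 0`, and satisfies `Δ f̃ = O(L^{n-1})`. -/
structure IsAmbientExtension {n : ℕ} (f : BSeries n) (F : ASeries n) : Prop where
  real : bar (AVar.conj n) F = F
  homog : euler F = 0
  homogBar : eulerBar F = 0
  restrict : coneRestrict F = f
  harmonic : Lser n ^ (n - 1) ∣ lapA F

/-! ### Tensors at `ẽ_0` -/

/-- Families `(T_{I_1 ⋯ I_p J̄_1 ⋯ J̄_q})` of components, for all `p, q ≥ 0`. -/
abbrev TFam (n : ℕ) : Type := (p q : ℕ) → (Fin p → Idx n) → (Fin q → Idx n) → ℂ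

/-- `𝕋_0 = ∏_{p,q ≥ 1} ⊙^p V^* ⊗ ⊙^q V̄^*`: the families of components that are symmetric in the
holomorphic and in the antiholomorphic indices. The components with `p = 0` or `q = 0`, which are
not part of the product, are set to zero. -/
noncomputable def T0 (n : ℕ) : Submodule ℝ (TFam n) where
  carrier := {T | (∀ p q I J, p = 0 ∨ q = 0 → T p q I J = 0) ∧
    ∀ p q I J (σ : Equiv.Perm (Fin p)) (τ : Equiv.Perm (Fin q)),
      T p q (I ∘ σ) (J ∘ τ) = T p q I J}
  zero_mem' := ⟨fun _ _ _ _ _ => rfl, fun _ _ _ _ _ _ => rfl⟩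
  add_mem' := by
    rintro S T ⟨hS, hS'⟩ ⟨hT, hT'⟩
    refine ⟨fun p q I J h => ?_, fun p q I J σ τ => ?_⟩
    · simp [hS p q I J h, hT p q I J h]
    · simp [hS' p q I J σ τ, hT' p q I J σ τ]
  smul_mem' := by
    rintro r T ⟨hT, hT'⟩
    refine ⟨fun p q I J h => ?_, fun p q I J σ τ => ?_⟩
    · simp [hT p q I J h]
    · simp [hT' p q I J σ τ]

/-- The action of `P` on `𝕋_0^{p,q} = ⊙^p V^* ⊗ ⊙^q V̄^* ⊗ σ_{-p,-q}`, in components; the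
representation `σ_{-p,-q}` is `h ↦ λ^p conj(λ)^q`. -/
noncomputable def actT {n : ℕ} (h : P n) (T : TFam n) : TFam n := fun p q I J =>
  P.eig h ^ p * star (P.eig h) ^ q *
    ∑ K : Fin p → Idx n, ∑ M : Fin q → Idx n,
      (∏ a, P.mat h⁻¹ (K a) (I a)) * (∏ b, star (P.mat h⁻¹ (M b) (J b))) * T p q K M

/-- `𝓗_0`: the elements of `𝕋_0` that satisfy
`conj T_{𝓘 𝓙̄} = T_{𝓙 𝓘̄}`, `g̃^{K L̄} T_{𝓘 K L̄ 𝓙̄} = 0` and `T_{𝓘 0 𝓙̄} = -|𝓘| T_{𝓘 𝓙̄}`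
(for `|𝓘| = 0` the last equation says `T_{0 𝓙̄} = 0`). -/
noncomputable def H0 (n : ℕ) : Submodule ℝ (TFam n) where
  carrier := {T | T ∈ T0 n ∧
    (∀ p q I J, star (T p q I J) = T q p J I) ∧
    (∀ p q (I : Fin p → Idx n) (J : Fin q → Idx n),
      ∑ K, ∑ M, gUp n K M *
        T (p + 1) (q + 1) (Fin.snoc (α := fun _ => Idx n) I K)
          (Fin.cons (α := fun _ => Idx n) M J) = 0) ∧
    (∀ p q (I : Fin p → Idx n) (J : Fin q → Idx n),
      T (p + 1) q (Fin.snoc (α := fun _ => Idx n) I Idx.zero) J = -(p : ℂ) * T p q I J)}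
  zero_mem' := ⟨Submodule.zero_mem _, by simp, by simp, by simp⟩
  add_mem' := by
    rintro S T ⟨hS, hS1, hS2, hS3⟩ ⟨hT, hT1, hT2, hT3⟩
    refine ⟨Submodule.add_mem _ hS hT, fun p q I J => ?_, fun p q I J => ?_, fun p q I J => ?_⟩
    · simp only [Pi.add_apply, star_add, hS1, hT1]
    · simp only [Pi.add_apply, mul_add, Finset.sum_add_distrib, hS2, hT2, add_zero]
    · simp only [Pi.add_apply, mul_add, hS3, hT3]
  smul_mem' := by
    rintro r T ⟨hT, hT1, hT2, hT3⟩
    refine ⟨Submodule.smul_mem _ r hT, fun p q I J => ?_, fun p q I J => ?_, fun p q I J => ?_⟩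
    · simp only [Pi.smul_apply, star_smul, hT1, star_trivial]
    · simp only [Pi.smul_apply, mul_smul_comm, ← Finset.smul_sum, hT2, smul_zero]
    · simp only [Pi.smul_apply, mul_smul_comm, hT3]

/-- The weight `‖I_1 ⋯ I_p J̄_1 ⋯ J̄_q‖`. -/
def listWt {n p q : ℕ} (I : Fin p → Idx n) (J : Fin q → Idx n) : ℕ :=
  ∑ a, (I a).wt + ∑ b, (J b).wt

/-- The index lists `𝓘 𝓙̄` with `‖𝓘 𝓙̄‖ < N`. -/
abbrev TIdx (n N : ℕ) : Type :=
  {x : Σ (p : ℕ) (q : ℕ), (Fin p → Idx n) × (Fin q → Idx n) // listWt x.2.2.1 x.2.2.2 < N}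

/-- The truncation of a family of components to weight `< N`. -/
noncomputable def truncT (n N : ℕ) : TFam n →ₗ[ℝ] (TIdx n N → ℂ) where
  toFun T := fun x => T x.1.1 x.1.2.1 x.1.2.2.1 x.1.2.2.2
  map_add' _ _ := rfl
  map_smul' _ _ := rfl

/-- `𝓗_0^{[N]}`: the projection of `𝓗_0` to the components of weight `< N`. -/
noncomputable def H0Trunc (n N : ℕ) : Submodule ℝ (TIdx n N → ℂ) := (H0 n).map (truncT n N)

/-- The class in `𝓗_0^{[N]}` of an element of `𝓗_0`. -/
noncomputable def H0Trunc.mk {n : ℕ} (N : ℕ) {T : TFam n} (hT : T ∈ H0 n) : H0Trunc n N :=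
  ⟨truncT n N T, Submodule.mem_map_of_mem hT⟩

/-- The iterated partial derivatives of a series with respect to a list of variables. -/
noncomputable def diffs {τ : Type} (l : List τ) (F : MvPowerSeries τ ℂ) : MvPowerSeries τ ℂ :=
  l.foldr (fun s H => MvPowerSeries.pderiv ℂ s H) F

/-- The components `T_{𝓘 𝓙̄} = ∂_{I_1} ⋯ ∂_{I_p} ∂_{J̄_1} ⋯ ∂_{J̄_q} f̃ (ẽ_0)`, `p, q ≥ 1`, of the
tensors `∇̃^{p,q} f̃` at `ẽ_0`. -/
noncomputable def tensorOf {n : ℕ} (F : ASeries n) : TFam n := fun p q I J =>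
  if p = 0 ∨ q = 0 then 0 else
    MvPowerSeries.constantCoeff
      (diffs (List.ofFn (fun a => AVar.eta (I a)) ++ List.ofFn (fun b => AVar.etab (J b))) F)

end JetIso

/-! Everything is read off from the ambient extension. For H homogeneous of degree (a, a) one has
Δ(L^{k+1} H) = L^{k+1} ΔH + (k+1)(n+k+1+2a) L^k H (`lapA_Lser_pow_mul`). If L^{k+1} H has degree (0,
0), then a = -1-k and the constant is (k+1)(n-1-k), which is nonzero for k < n-1 and zero for k =
n-1. Hence a homogeneous extension of f can be corrected one power of L at a time until its
Laplacian is O(L^{n-1}) (`exists_ambientExtension_vanish`), and the result is unique modulo L^n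
(`Lser_pow_dvd_of_coneRestrict_eq_zero`). Since L has weight 2, a multiple of L^n is invisible to
derivatives of weight < 2n; this is the origin of the truncation.

The equations of 𝓗_0 express that a formal series is real, homogeneous and exactly harmonic, so 𝓗_0
consists of the tensors of such series (`exists_tensorOf_eq`). Each equation relates components of
compatible weights, so the components of weight < 2n of an ambient extension, continued by zero,
also lie in 𝓗_0 (`cutTensor_mem_H0`). A pluriharmonic jet extends to the real part of a holomorphic
function, whose mixed derivatives vanish; together with uniqueness this defines T on classes modulo
J𝓟 (`truncT_tensorOf_eq`). The corrections in the construction do not lower the weight, so T sees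
only the coefficients of f of weight < 2n (`truncT_tensorOf_eq_zero`).

Injectivity: if the mixed derivatives of weight < 2n vanish, the extension is pluriharmonic up to
weight 2n (`vanish_sub_realPart`), hence so is its restriction, and the slice meets J𝓟 trivially
weight by weight (`vanish_of_mem_N0_of_sub_mem_JP`). Surjectivity: an exactly harmonic series is an
ambient extension of its own restriction to the cone, and that restriction is moved into the slice
by subtracting a pluriharmonic jet (`sub_reHol_holPart_mem`).

Equivariance comes from pulling back by λh⁻¹, which fixes ẽ_0 and rescales L and Δ (`actT_tensorOf`,
`coneRestrict_pull`, `IsAmbientExtension.pull`). The elements of P are triangular for the weights,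
so the action on tensors descends to the truncation (`truncT_actT_eq_zero`); on the slice the
descent is obtained by transport through T. -/

namespace JetIso

open MvPowerSeries

section Series

variable {σ τ : Type}

/-! ### Vanishing orders, substitution and derivations -/

/-- All coefficients of weight `< N` vanish. -/
def Vanish (w : τ → ℕ) (N : ℕ) (F : MvPowerSeries τ ℂ) : Prop :=
  ∀ d, Finsupp.weight w d < N → coeff d F = 0

lemma vanish_iff {w : τ → ℕ} {N : ℕ} {F : MvPowerSeries τ ℂ} :
    Vanish w N F ↔ (N : ℕ∞) ≤ F.weightedOrder w := by
  constructor
  · exact fun h => nat_le_weightedOrder w h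
  · intro h d hd
    exact coeff_eq_zero_of_lt_weightedOrder w (lt_of_lt_of_le (by exact_mod_cast hd) h)

lemma vanish_zero_order (w : τ → ℕ) (F : MvPowerSeries τ ℂ) : Vanish w 0 F :=
  fun _ h => absurd h (Nat.not_lt_zero _)

lemma Vanish.mono {w : τ → ℕ} {N M : ℕ} {F : MvPowerSeries τ ℂ} (h : Vanish w N F) (hM : M ≤ N) :
    Vanish w M F := fun d hd => h d (hd.trans_le hM)

lemma Vanish.add {w : τ → ℕ} {N : ℕ} {F G : MvPowerSeries τ ℂ} (hF : Vanish w N F)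
    (hG : Vanish w N G) : Vanish w N (F + G) := fun d hd => by
  rw [map_add, hF d hd, hG d hd, add_zero]

lemma Vanish.sub {w : τ → ℕ} {N : ℕ} {F G : MvPowerSeries τ ℂ} (hF : Vanish w N F)
    (hG : Vanish w N G) : Vanish w N (F - G) := fun d hd => by
  rw [map_sub, hF d hd, hG d hd, sub_zero]

lemma vanish_sum {ι : Type*} {w : τ → ℕ} {N : ℕ} (s : Finset ι) {F : ι → MvPowerSeries τ ℂ}
    (hF : ∀ i ∈ s, Vanish w N (F i)) : Vanish w N (∑ i ∈ s, F i) := fun d hd => by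
  rw [map_sum]
  exact Finset.sum_eq_zero fun i hi => hF i hi d hd

lemma Vanish.mul {w : τ → ℕ} {N M : ℕ} {F G : MvPowerSeries τ ℂ} (hF : Vanish w N F)
    (hG : Vanish w M G) : Vanish w (N + M) (F * G) := by
  rw [vanish_iff] at *
  push_cast
  exact (add_le_add hF hG).trans (le_weightedOrder_mul w)

lemma Vanish.mul_right {w : τ → ℕ} {N : ℕ} {F : MvPowerSeries τ ℂ} (hF : Vanish w N F)
    (G : MvPowerSeries τ ℂ) : Vanish w N (F * G) := hF.mul (vanish_zero_order w G)

lemma Vanish.mul_left {w : τ → ℕ} {N : ℕ} {F : MvPowerSeries τ ℂ} (hF : Vanish w N F)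
    (G : MvPowerSeries τ ℂ) : Vanish w N (G * F) := by
  rw [mul_comm]; exact hF.mul_right G

lemma Vanish.pow {w : τ → ℕ} {N : ℕ} {F : MvPowerSeries τ ℂ} (hF : Vanish w N F) (k : ℕ) :
    Vanish w (k * N) (F ^ k) := by
  induction k with
  | zero => simpa using vanish_zero_order w _
  | succ k ih => rw [pow_succ, add_mul, one_mul]; exact ih.mul hF

lemma vanish_X (w : τ → ℕ) (s : τ) : Vanish w (w s) (X s : MvPowerSeries τ ℂ) := by
  classical
  intro d hd
  rw [coeff_X, if_neg]
  rintro rfl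
  simp [Finsupp.weight_single] at hd

lemma Vanish.pderiv {w : τ → ℕ} {N : ℕ} {s : τ} {F : MvPowerSeries τ ℂ}
    (hF : Vanish w (N + w s) F) : Vanish w N (pderiv ℂ s F) := by
  intro d hd
  rw [coeff_pderiv, hF, zero_mul]
  rw [map_add, Finsupp.weight_single]
  simpa using hd

/-- If every variable goes to a series of order at least its own weight, a monomial goes to a
product of order at least its weight. This carries weights between the ambient space and the sphere.
-/
lemma Vanish.subst {w : σ → ℕ} {w' : τ → ℕ} {a : σ → MvPowerSeries τ ℂ} (ha : HasSubst a)
    (haw : ∀ s, Vanish w' (w s) (a s)) {N : ℕ} {f : MvPowerSeries σ ℂ} (hf : Vanish w N f) :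
    Vanish w' N (subst a f) := by
  rw [vanish_iff]
  refine le_trans ?_ (le_weightedOrder_subst w' ha f)
  refine le_iInf₂ fun d hd => ?_
  have h1 : N ≤ Finsupp.weight w d := by
    by_contra h
    exact hd (hf d (not_le.mp h))
  refine le_trans (by exact_mod_cast h1 : (N : ℕ∞) ≤ (Finsupp.weight w d : ℕ)) ?_
  rw [Finsupp.weight_apply, Finsupp.weight_apply, Finsupp.sum, Finsupp.sum]
  push_cast
  refine Finset.sum_le_sum fun s _ => ?_
  have := (vanish_iff.mp (haw s))
  simp only [nsmul_eq_mul, Function.comp_apply, smul_eq_mul, Nat.cast_mul]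
  gcongr

lemma weight_one_eq_degree (d : τ →₀ ℕ) : Finsupp.weight (1 : τ → ℕ) d = d.degree := by
  rw [Finsupp.weight_apply, Finsupp.degree_apply]
  simp [Finsupp.sum]

lemma vanish_one_iff {F : MvPowerSeries τ ℂ} : Vanish 1 1 F ↔ constantCoeff F = 0 := by
  constructor
  · intro h
    rw [← coeff_zero_eq_constantCoeff_apply]
    exact h 0 (by simp)
  · intro h d hd
    rw [weight_one_eq_degree, Nat.lt_one_iff, Finsupp.degree_eq_zero_iff] at hd
    rw [hd, coeff_zero_eq_constantCoeff_apply, h]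

/-- An additive map that lowers orders by at most one vanishes if it vanishes on polynomials. -/
lemma eq_zero_of_forall_polynomial [Finite σ] (Φ : MvPowerSeries σ ℂ →+ MvPowerSeries τ ℂ)
    (hΦ : ∀ N f, Vanish 1 (N + 1) f → Vanish 1 N (Φ f))
    (hp : ∀ p : MvPolynomial σ ℂ, Φ (p : MvPowerSeries σ ℂ) = 0) (f : MvPowerSeries σ ℂ) :
    Φ f = 0 := by
  ext d
  -- The coefficient at `d` of the image requires vanishing to order `d.degree + 1` there, and the
  -- map may lose one order; hence the truncation two above the degree.
  have h1 : Vanish 1 (d.degree + 1 + 1) (f -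
    ((truncTotal (d.degree + 1 + 1) f : MvPolynomial σ ℂ) : MvPowerSeries σ ℂ)) := by
    intro e he
    rw [weight_one_eq_degree] at he
    rw [map_sub, MvPolynomial.coeff_coe, coeff_truncTotal _ he, sub_self]
  have h2 := hΦ _ _ h1 d (by rw [weight_one_eq_degree]; omega)
  rw [map_sub, hp, sub_zero] at h2
  rw [h2, map_zero]

lemma subst_map_sub {a : σ → MvPowerSeries τ ℂ} (ha : HasSubst a) (f g : MvPowerSeries σ ℂ) :
    subst a (f - g) = subst a f - subst a g := by
  rw [← coe_substAlgHom ha, map_sub]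

lemma subst_const {a : σ → MvPowerSeries τ ℂ} (ha : HasSubst a) (c : ℂ) :
    subst a (C c : MvPowerSeries σ ℂ) = C c := by
  rw [← coe_substAlgHom ha]
  exact (substAlgHom ha).commutes c

lemma subst_const_one {a : σ → MvPowerSeries τ ℂ} (ha : HasSubst a) :
    subst a (1 : MvPowerSeries σ ℂ) = 1 := by
  rw [← coe_substAlgHom ha, map_one]

lemma subst_zero_right {a : σ → MvPowerSeries τ ℂ} (ha : HasSubst a) :
    subst a (0 : MvPowerSeries σ ℂ) = 0 := by
  rw [← coe_substAlgHom ha, map_zero]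

lemma subst_sum {ι : Type*} {a : σ → MvPowerSeries τ ℂ} (ha : HasSubst a) (s : Finset ι)
    (f : ι → MvPowerSeries σ ℂ) : subst a (∑ i ∈ s, f i) = ∑ i ∈ s, subst a (f i) := by
  rw [← coe_substAlgHom ha, map_sum]

lemma constantCoeff_subst_of_zero [Finite σ] {a : σ → MvPowerSeries τ ℂ}
    (ha : ∀ s, constantCoeff (a s) = 0) (f : MvPowerSeries σ ℂ) :
    constantCoeff (subst a f) = constantCoeff f := by
  have hs := hasSubst_of_constantCoeff_zero ha
  have h1 : f = (f - C (constantCoeff f)) + C (constantCoeff f) := by ring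
  have h2 : constantCoeff (subst a (f - C (constantCoeff f))) = 0 :=
    constantCoeff_subst_eq_zero hs ha (by simp)
  rw [h1, subst_add hs, map_add, h2, subst_const hs]
  simp

lemma pderiv_comm (i j : τ) (f : MvPowerSeries τ ℂ) :
    pderiv ℂ i (pderiv ℂ j f) = pderiv ℂ j (pderiv ℂ i f) := by
  classical
  ext d
  simp only [coeff_pderiv, Finsupp.add_apply, Finsupp.single_apply]
  rw [add_right_comm]
  rcases eq_or_ne i j with rfl | h
  · rfl
  · simp [h, h.symm]
    ring

/-- The chain rule for a derivation that lowers orders by at most one. -/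
lemma derivation_subst [Fintype σ] {a : σ → MvPowerSeries τ ℂ}
    (ha : ∀ s, constantCoeff (a s) = 0)
    (D : Derivation ℂ (MvPowerSeries τ ℂ) (MvPowerSeries τ ℂ))
    (hD : ∀ N f, Vanish 1 (N + 1) f → Vanish 1 N (D f)) (f : MvPowerSeries σ ℂ) :
    D (subst a f) = ∑ s, subst a (pderiv ℂ s f) * D (a s) := by
  have hs := hasSubst_of_constantCoeff_zero ha
  have ha1 : ∀ s, Vanish (1 : τ → ℕ) ((1 : σ → ℕ) s) (a s) := fun s => vanish_one_iff.mpr (ha s)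
  -- The difference of the two sides is one additive map, so it is enough to check polynomials,
  -- where Leibniz and induction apply.
  let Φ : MvPowerSeries σ ℂ →+ MvPowerSeries τ ℂ :=
    { toFun := fun f => D (subst a f) - ∑ s, subst a (pderiv ℂ s f) * D (a s)
      map_zero' := by simp [subst_zero_right hs]
      map_add' := fun f g => by
        simp only [subst_add hs, map_add, add_mul, Finset.sum_add_distrib]
        ring }
  refine sub_eq_zero.mp (eq_zero_of_forall_polynomial Φ ?_ ?_ f)
  · intro N g hg
    refine (hD _ _ (hg.subst hs ha1)).sub (vanish_sum _ fun s _ => ?_)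
    exact (Vanish.subst hs ha1 (Vanish.pderiv (s := s) hg)).mul_right _
  · intro p
    show D (subst a (p : MvPowerSeries σ ℂ)) -
      ∑ s, subst a (pderiv ℂ s (p : MvPowerSeries σ ℂ)) * D (a s) = 0
    induction p using MvPolynomial.induction_on with
    | C c =>
      rw [MvPolynomial.coe_C, subst_const hs]
      have : D (C c) = 0 := D.map_algebraMap c
      simp [this, subst_zero_right hs]
    | add p q hp hq =>
      rw [sub_eq_zero] at hp hq ⊢
      simp only [MvPolynomial.coe_add, subst_add hs, map_add, hp, hq, add_mul,
        Finset.sum_add_distrib]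
    | mul_X p i hp =>
      classical
      rw [sub_eq_zero] at hp ⊢
      rw [MvPolynomial.coe_mul, MvPolynomial.coe_X, subst_mul hs, subst_X hs]
      simp only [Derivation.leibniz, smul_eq_mul, subst_add hs, subst_mul hs, subst_X hs, hp,
        pderiv_X, add_mul, Finset.sum_add_distrib]
      congr 1
      · rw [Finset.sum_eq_single i]
        · simp [subst_const_one hs]
        · intro s _ h
          simp [h.symm, subst_zero_right hs]
        · simp
      · rw [Finset.mul_sum]
        exact Finset.sum_congr rfl fun s _ => by ring

lemma pderiv_subst [Fintype σ] {a : σ → MvPowerSeries τ ℂ}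
    (ha : ∀ s, constantCoeff (a s) = 0) (i : τ) (f : MvPowerSeries σ ℂ) :
    pderiv ℂ i (subst a f) = ∑ s, subst a (pderiv ℂ s f) * pderiv ℂ i (a s) :=
  derivation_subst ha _ (fun _ _ h => Vanish.pderiv (w := 1) h) f

/-! ### Conjugation of series -/

lemma coeff_bar (s : τ ≃ τ) (f : MvPowerSeries τ ℂ) (m : τ →₀ ℕ) :
    coeff m (bar s f) = star (coeff (m.mapDomain s) f) := rfl

/-- Conjugating coefficients and renaming variables are both ring homomorphisms; this is what makes
conjugation compatible with products, powers and inverses. -/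
lemma bar_eq_rename (s : τ ≃ τ) (f : MvPowerSeries τ ℂ) :
    bar s f = rename s.symm (map (starRingEnd ℂ) f) := by
  ext m
  have h1 : m = Finsupp.embDomain s.symm.toEmbedding (m.mapDomain s) := by
    rw [Finsupp.embDomain_eq_mapDomain, Equiv.coe_toEmbedding, ← Finsupp.mapDomain_comp]
    simp
  rw [coeff_bar]
  conv_rhs => rw [h1]
  have := coeff_embDomain_rename s.symm.toEmbedding (map (starRingEnd ℂ) f) (m.mapDomain s)
  rw [coeff_map] at this
  exact this.symm

/-- Conjugation of series as a ring homomorphism. -/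
noncomputable def barHom (s : τ ≃ τ) : MvPowerSeries τ ℂ →+* MvPowerSeries τ ℂ :=
  (rename s.symm).toRingHom.comp (map (starRingEnd ℂ))

lemma coe_barHom (s : τ ≃ τ) (f : MvPowerSeries τ ℂ) : barHom s f = bar s f :=
  (bar_eq_rename s f).symm

lemma bar_mul (s : τ ≃ τ) (f g : MvPowerSeries τ ℂ) : bar s (f * g) = bar s f * bar s g := by
  simp only [← coe_barHom, map_mul]

lemma bar_pow (s : τ ≃ τ) (f : MvPowerSeries τ ℂ) (k : ℕ) : bar s (f ^ k) = bar s f ^ k := by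
  simp only [← coe_barHom, map_pow]

lemma bar_C (s : τ ≃ τ) (c : ℂ) : bar s (C c) = C (star c) := by
  rw [bar_eq_rename, map_C, rename_C]; rfl

lemma bar_one (s : τ ≃ τ) : bar s 1 = 1 := by simp only [← coe_barHom, map_one]

lemma bar_X (s : τ ≃ τ) (i : τ) : bar s (X i) = X (s.symm i) := by
  rw [bar_eq_rename, map_X, rename_X]

lemma constantCoeff_bar (s : τ ≃ τ) (f : MvPowerSeries τ ℂ) :
    constantCoeff (bar s f) = star (constantCoeff f) := by
  rw [← coeff_zero_eq_constantCoeff_apply, coeff_bar, Finsupp.mapDomain_zero,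
    coeff_zero_eq_constantCoeff_apply]

lemma bar_inv (s : τ ≃ τ) (f : MvPowerSeries τ ℂ) (hf : constantCoeff f ≠ 0) :
    bar s f⁻¹ = (bar s f)⁻¹ := by
  rw [MvPowerSeries.eq_inv_iff_mul_eq_one (by rw [constantCoeff_bar]; simpa using hf), ← bar_mul,
    MvPowerSeries.inv_mul_cancel _ hf, bar_one]

lemma bar_bar (s : τ ≃ τ) (hs : ∀ i, s (s i) = i) (f : MvPowerSeries τ ℂ) :
    bar s (bar s f) = f := by
  ext m
  rw [coeff_bar, coeff_bar, star_star, ← Finsupp.mapDomain_comp]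
  have : (s ∘ s : τ → τ) = id := funext hs
  rw [this, Finsupp.mapDomain_id]

lemma Vanish.bar {w : τ → ℕ} {N : ℕ} {s : τ ≃ τ} (hw : ∀ i, w (s i) = w i)
    {F : MvPowerSeries τ ℂ} (hF : Vanish w N F) : Vanish w N (bar s F) := by
  intro d hd
  rw [coeff_bar, hF, star_zero]
  rw [Finsupp.weight_apply, Finsupp.sum_mapDomain_index (by simp) (by intros; simp [add_mul])]
  rw [Finsupp.weight_apply] at hd
  simpa [hw] using hd

lemma bar_pderiv (s : τ ≃ τ) (i : τ) (f : MvPowerSeries τ ℂ) :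
    bar s (pderiv ℂ (s i) f) = pderiv ℂ i (bar s f) := by
  ext m
  simp only [coeff_bar, coeff_pderiv, star_mul', star_add, star_natCast, star_one,
    Finsupp.mapDomain_add, Finsupp.mapDomain_single, Finsupp.mapDomain_apply s.injective]

/-- Both sides are additive and preserve orders, so they agree once they agree on polynomials, where
multiplicativity of conjugation suffices. -/
lemma bar_subst [Finite σ] (s : τ ≃ τ) (s' : σ ≃ σ) {a : σ → MvPowerSeries τ ℂ}
    (ha : ∀ i, constantCoeff (a i) = 0) (f : MvPowerSeries σ ℂ) :
    bar s (subst a f) = subst (fun i => bar s (a (s' i))) (bar s' f) := by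
  have hs := hasSubst_of_constantCoeff_zero ha
  have hb0 : ∀ i, constantCoeff (bar s (a (s' i))) = 0 := fun i => by
    rw [constantCoeff_bar, ha, star_zero]
  have hb := hasSubst_of_constantCoeff_zero hb0
  let Φ : MvPowerSeries σ ℂ →+ MvPowerSeries τ ℂ :=
    { toFun := fun f => bar s (subst a f) - subst (fun i => bar s (a (s' i))) (bar s' f)
      map_zero' := by simp [subst_zero_right hs, subst_zero_right hb]
      map_add' := fun f g => by
        simp only [subst_add hs, subst_add hb, map_add]
        ring }
  refine sub_eq_zero.mp (eq_zero_of_forall_polynomial Φ ?_ ?_ f)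
  · intro N g hg
    refine Vanish.mono (N := N + 1) (Vanish.sub ?_ ?_) (Nat.le_succ N)
    · exact (hg.subst hs fun i => vanish_one_iff.mpr (ha i)).bar (fun _ => rfl)
    · exact (hg.bar (fun _ => rfl)).subst hb fun i => vanish_one_iff.mpr (hb0 i)
  · intro p
    show bar s (subst a (p : MvPowerSeries σ ℂ)) - _ = 0
    induction p using MvPolynomial.induction_on with
    | C c => simp only [MvPolynomial.coe_C, subst_const hs, bar_C, subst_const hb, sub_self]
    | add p q hp hq =>
      rw [sub_eq_zero] at hp hq ⊢
      simp only [MvPolynomial.coe_add, subst_add hs, map_add, subst_add hb, hp, hq]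
    | mul_X p i hp =>
      rw [sub_eq_zero] at hp ⊢
      simp only [MvPolynomial.coe_mul, MvPolynomial.coe_X, subst_mul hs, subst_X hs, bar_mul,
        bar_X, subst_mul hb, subst_X hb, hp, Equiv.apply_symm_apply]

end Series

/-! ### Calculus of ambient jets -/

section Ambient

variable {n : ℕ}

/-- The indices as a sum type. -/
def Idx.equivSum (n : ℕ) : Idx n ≃ (Unit ⊕ Fin (n - 1)) ⊕ Unit where
  toFun | .zero => .inl (.inl ()) | .mid j => .inl (.inr j) | .last => .inr ()
  invFun | .inl (.inl _) => .zero | .inl (.inr j) => .mid j | .inr _ => .last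
  left_inv x := by cases x <;> rfl
  right_inv x := by rcases x with (_ | _) | _ <;> rfl

lemma Idx.sum_eq {M : Type*} [AddCommMonoid M] (f : Idx n → M) :
    ∑ I, f I = f .zero + ∑ j, f (.mid j) + f .last := by
  rw [← (Idx.equivSum n).symm.sum_comp, Fintype.sum_sum_type, Fintype.sum_sum_type]
  simp [Idx.equivSum]

/-- The ambient variables as a sum type. -/
def AVar.equivSum (n : ℕ) : AVar n ≃ Idx n ⊕ Idx n where
  toFun | .eta I => .inl I | .etab I => .inr I
  invFun | .inl I => .eta I | .inr I => .etab I
  left_inv x := by cases x <;> rfl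
  right_inv x := by rcases x with _ | _ <;> rfl

lemma AVar.sum_eq {M : Type*} [AddCommMonoid M] (f : AVar n → M) :
    ∑ s, f s = ∑ I, f (.eta I) + ∑ I, f (.etab I) := by
  rw [← (AVar.equivSum n).symm.sum_comp, Fintype.sum_sum_type]
  rfl

lemma gUp_symm (I J : Idx n) : gUp n I J = gUp n J I := by
  cases I <;> cases J <;> simp [gUp, eq_comm]

lemma gLow_symm (I J : Idx n) : gLow n I J = gLow n J I := by
  cases I <;> cases J <;> simp [gLow, eq_comm]

lemma star_gUp (I J : Idx n) : star (gUp n I J) = gUp n I J := by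
  cases I <;> cases J <;> simp [gUp, apply_ite]

lemma star_gLow (I J : Idx n) : star (gLow n I J) = gLow n I J := by
  cases I <;> cases J <;> simp [gLow, apply_ite]

lemma gUp_mul_gLow : gUp n * gLow n = 1 := by
  ext I J
  rw [Matrix.mul_apply, Idx.sum_eq]
  cases I <;> cases J <;> simp [gUp, gLow, Matrix.one_apply, apply_ite]

lemma gLow_mul_gUp : gLow n * gUp n = 1 := mul_eq_one_comm.mp gUp_mul_gLow

/-- The Euler field as a derivation. -/
noncomputable def eulerD (n : ℕ) : Derivation ℂ (ASeries n) (ASeries n) :=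
  ∑ I : Idx n, xi I • pderiv ℂ (AVar.eta I)

/-- The conjugate Euler field as a derivation. -/
noncomputable def eulerBarD (n : ℕ) : Derivation ℂ (ASeries n) (ASeries n) :=
  ∑ I : Idx n, xib I • pderiv ℂ (AVar.etab I)

lemma eulerD_apply (F : ASeries n) : eulerD n F = euler F := by
  rw [eulerD, euler, ← Derivation.coeFnAddMonoidHom_apply, map_sum, Finset.sum_apply]
  rfl

lemma eulerBarD_apply (F : ASeries n) : eulerBarD n F = eulerBar F := by
  rw [eulerBarD, eulerBar, ← Derivation.coeFnAddMonoidHom_apply, map_sum, Finset.sum_apply]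
  rfl

lemma pderiv_eta_xi (I J : Idx n) :
    pderiv ℂ (AVar.eta I) (xi J) = if I = J then 1 else 0 := by
  rw [xi, map_add, pderiv_C, zero_add]
  split_ifs with h
  · rw [h, pderiv_X_self]
  · exact pderiv_X_of_ne fun h' => h (AVar.eta.inj h').symm

lemma pderiv_etab_xi (I J : Idx n) : pderiv ℂ (AVar.etab I) (xi J) = 0 := by
  rw [xi, map_add, pderiv_C, zero_add, pderiv_X_of_ne (by simp)]

lemma pderiv_etab_xib (I J : Idx n) :
    pderiv ℂ (AVar.etab I) (xib J) = if I = J then 1 else 0 := by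
  rw [xib, map_add, pderiv_C, zero_add]
  split_ifs with h
  · rw [h, pderiv_X_self]
  · exact pderiv_X_of_ne fun h' => h (AVar.etab.inj h').symm

lemma pderiv_eta_xib (I J : Idx n) : pderiv ℂ (AVar.eta I) (xib J) = 0 := by
  rw [xib, map_add, pderiv_C, zero_add, pderiv_X_of_ne (by simp)]

lemma euler_xi (I : Idx n) : euler (xi I) = xi I := by
  simp [euler, pderiv_eta_xi]

lemma euler_xib (I : Idx n) : euler (xib I) = 0 := by
  simp [euler, pderiv_eta_xib]

lemma eulerBar_xi (I : Idx n) : eulerBar (xi I) = 0 := by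
  simp [eulerBar, pderiv_etab_xi]

lemma eulerBar_xib (I : Idx n) : eulerBar (xib I) = xib I := by
  simp [eulerBar, pderiv_etab_xib]

lemma euler_mul (F H : ASeries n) : euler (F * H) = F * euler H + H * euler F := by
  simp only [← eulerD_apply, Derivation.leibniz, smul_eq_mul]

lemma eulerBar_mul (F H : ASeries n) : eulerBar (F * H) = F * eulerBar H + H * eulerBar F := by
  simp only [← eulerBarD_apply, Derivation.leibniz, smul_eq_mul]

lemma euler_C (c : ℂ) : euler (C c : ASeries n) = 0 := by simp [euler]

lemma eulerBar_C (c : ℂ) : eulerBar (C c : ASeries n) = 0 := by simp [eulerBar]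

lemma euler_sub (F H : ASeries n) : euler (F - H) = euler F - euler H := by
  simp only [← eulerD_apply, map_sub]

lemma eulerBar_sub (F H : ASeries n) : eulerBar (F - H) = eulerBar F - eulerBar H := by
  simp only [← eulerBarD_apply, map_sub]

lemma euler_add (F H : ASeries n) : euler (F + H) = euler F + euler H := by
  simp only [← eulerD_apply, map_add]

lemma eulerBar_add (F H : ASeries n) : eulerBar (F + H) = eulerBar F + eulerBar H := by
  simp only [← eulerBarD_apply, map_add]

/-- A derivative in ξ_I lowers the holomorphic degree by one; the extra term is the derivative of
the coefficient ξ_I of the Euler field. -/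
lemma pderiv_eta_euler (I : Idx n) (F : ASeries n) :
    pderiv ℂ (AVar.eta I) (euler F) =
      euler (pderiv ℂ (AVar.eta I) F) + pderiv ℂ (AVar.eta I) F := by
  simp only [euler, map_sum, Derivation.leibniz, pderiv_eta_xi, smul_eq_mul,
    Finset.sum_add_distrib]
  congr 1
  · exact Finset.sum_congr rfl fun J _ => by rw [pderiv_comm]
  · simp

lemma pderiv_etab_euler (I : Idx n) (F : ASeries n) :
    pderiv ℂ (AVar.etab I) (euler F) = euler (pderiv ℂ (AVar.etab I) F) := by
  simp only [euler, map_sum, Derivation.leibniz, pderiv_etab_xi, smul_eq_mul, mul_zero, add_zero]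
  exact Finset.sum_congr rfl fun J _ => by rw [pderiv_comm]

lemma pderiv_etab_eulerBar (I : Idx n) (F : ASeries n) :
    pderiv ℂ (AVar.etab I) (eulerBar F) =
      eulerBar (pderiv ℂ (AVar.etab I) F) + pderiv ℂ (AVar.etab I) F := by
  simp only [eulerBar, map_sum, Derivation.leibniz, pderiv_etab_xib, smul_eq_mul,
    Finset.sum_add_distrib]
  congr 1
  · exact Finset.sum_congr rfl fun J _ => by rw [pderiv_comm]
  · simp

lemma pderiv_eta_eulerBar (I : Idx n) (F : ASeries n) :
    pderiv ℂ (AVar.eta I) (eulerBar F) = eulerBar (pderiv ℂ (AVar.eta I) F) := by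
  simp only [eulerBar, map_sum, Derivation.leibniz, pderiv_eta_xib, smul_eq_mul, mul_zero,
    add_zero]
  exact Finset.sum_congr rfl fun J _ => by rw [pderiv_comm]

lemma lapA_add (F H : ASeries n) : lapA (F + H) = lapA F + lapA H := by
  simp only [lapA, map_add, mul_add, Finset.sum_add_distrib]

lemma lapA_sub (F H : ASeries n) : lapA (F - H) = lapA F - lapA H := by
  simp only [lapA, map_sub, mul_sub, Finset.sum_sub_distrib]

lemma lapA_C_mul (c : ℂ) (F : ASeries n) : lapA (C c * F) = C c * lapA F := by
  simp only [lapA, Derivation.leibniz, pderiv_C, smul_eq_mul, mul_zero, add_zero, Finset.mul_sum]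
  exact Finset.sum_congr rfl fun I _ => Finset.sum_congr rfl fun J _ => by ring

/-- Δ contains exactly one holomorphic and one antiholomorphic derivative, so it lowers each degree
by one. -/
lemma euler_lapA (F : ASeries n) : euler (lapA F) = lapA (euler F) - lapA F := by
  have h : ∀ I J : Idx n, pderiv ℂ (AVar.eta I) (pderiv ℂ (AVar.etab J) (euler F)) =
      euler (pderiv ℂ (AVar.eta I) (pderiv ℂ (AVar.etab J) F)) +
        pderiv ℂ (AVar.eta I) (pderiv ℂ (AVar.etab J) F) := fun I J => by
    rw [pderiv_etab_euler, pderiv_eta_euler]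
  simp only [lapA, h, mul_add, Finset.sum_add_distrib, add_sub_cancel_right]
  simp only [← eulerD_apply, map_sum, Derivation.leibniz, smul_eq_mul]
  simp only [eulerD_apply, euler_C, mul_zero, add_zero]

lemma eulerBar_lapA (F : ASeries n) : eulerBar (lapA F) = lapA (eulerBar F) - lapA F := by
  have h : ∀ I J : Idx n, pderiv ℂ (AVar.eta I) (pderiv ℂ (AVar.etab J) (eulerBar F)) =
      eulerBar (pderiv ℂ (AVar.eta I) (pderiv ℂ (AVar.etab J) F)) +
        pderiv ℂ (AVar.eta I) (pderiv ℂ (AVar.etab J) F) := fun I J => by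
    rw [pderiv_etab_eulerBar, map_add, pderiv_eta_eulerBar]
  simp only [lapA, h, mul_add, Finset.sum_add_distrib, add_sub_cancel_right]
  simp only [← eulerBarD_apply, map_sum, Derivation.leibniz, smul_eq_mul]
  simp only [eulerBarD_apply, eulerBar_C, mul_zero, add_zero]

/-- `F` is homogeneous of degree `(a, a)`. -/
def Homog (a : ℂ) (F : ASeries n) : Prop := euler F = C a * F ∧ eulerBar F = C a * F

lemma homog_zero_iff {F : ASeries n} : Homog 0 F ↔ euler F = 0 ∧ eulerBar F = 0 := by
  simp [Homog]

lemma Homog.mul {a b : ℂ} {F H : ASeries n} (hF : Homog a F) (hH : Homog b H) :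
    Homog (a + b) (F * H) := by
  constructor
  · rw [euler_mul, hF.1, hH.1, map_add]; ring
  · rw [eulerBar_mul, hF.2, hH.2, map_add]; ring

lemma Homog.sub {a : ℂ} {F H : ASeries n} (hF : Homog a F) (hH : Homog a H) :
    Homog a (F - H) := by
  constructor
  · rw [euler_sub, hF.1, hH.1]; ring
  · rw [eulerBar_sub, hF.2, hH.2]; ring

lemma Homog.add {a : ℂ} {F H : ASeries n} (hF : Homog a F) (hH : Homog a H) :
    Homog a (F + H) := by
  constructor
  · rw [euler_add, hF.1, hH.1]; ring
  · rw [eulerBar_add, hF.2, hH.2]; ring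

lemma homog_C (c : ℂ) : Homog 0 (C c : ASeries n) := by
  rw [homog_zero_iff]; exact ⟨euler_C c, eulerBar_C c⟩

lemma Homog.C_mul {a : ℂ} {F : ASeries n} (hF : Homog a F) (c : ℂ) : Homog a (C c * F) := by
  simpa using (homog_C c).mul hF

/-- The ring is a domain, so the Euler equations for a product can be divided by the known factor.
This gives the degree of the quotient when ΔF is divided by a power of L. -/
lemma Homog.of_mul {a b : ℂ} {F H : ASeries n} (hF : Homog a F) (h0 : F ≠ 0)
    (h : Homog (a + b) (F * H)) : Homog b H := by
  obtain ⟨h1, h2⟩ := h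
  rw [euler_mul, hF.1, map_add] at h1
  rw [eulerBar_mul, hF.2, map_add] at h2
  constructor
  · apply mul_left_cancel₀ h0
    linear_combination h1
  · apply mul_left_cancel₀ h0
    linear_combination h2

lemma Homog.lapA {a : ℂ} {F : ASeries n} (hF : Homog a F) : Homog (a - 1) (lapA F) := by
  constructor
  · rw [euler_lapA, hF.1, lapA_C_mul, map_sub, map_one]; ring
  · rw [eulerBar_lapA, hF.2, lapA_C_mul, map_sub, map_one]; ring

lemma homog_Lser : Homog 1 (Lser n) := by
  constructor
  · rw [map_one, one_mul, Lser, ← eulerD_apply]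
    simp only [map_sum, Derivation.leibniz, smul_eq_mul]
    simp only [eulerD_apply, euler_C, euler_xi, euler_xib, mul_zero, zero_add, add_zero]
    exact Finset.sum_congr rfl fun I _ => Finset.sum_congr rfl fun J _ => by ring
  · rw [map_one, one_mul, Lser, ← eulerBarD_apply]
    simp only [map_sum, Derivation.leibniz, smul_eq_mul]
    simp only [eulerBarD_apply, eulerBar_C, eulerBar_xi, eulerBar_xib, mul_zero, add_zero]

lemma homog_Lser_pow (k : ℕ) : Homog (k : ℂ) (Lser n ^ k) := by
  induction k with
  | zero => simpa using homog_C (n := n) 1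
  | succ k ih => rw [pow_succ]; push_cast; exact ih.mul homog_Lser

lemma Lser_eq : Lser n = C (1 / 2) * (xi .zero * xib .last + xi .last * xib .zero -
    ∑ j : Fin (n - 1), xi (.mid j) * xib (.mid j)) := by
  simp only [Lser, Idx.sum_eq, gLow]
  simp [apply_ite, ← Finset.mul_sum]
  ring

/-- The derivative of L in ξ_n at ẽ_0 equals 1/2. -/
lemma Lser_ne_zero : Lser n ≠ 0 := by
  intro h
  have h1 := congrArg (fun F => constantCoeff (pderiv ℂ (AVar.eta .last) F)) h
  simp [Lser_eq, Derivation.leibniz, pderiv_eta_xi, xib, e0] at h1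

lemma Lser_pow_ne_zero (k : ℕ) : Lser n ^ k ≠ 0 := pow_ne_zero k Lser_ne_zero

lemma pderiv_etab_Lser (J : Idx n) :
    pderiv ℂ (AVar.etab J) (Lser n) = ∑ K, C (gLow n K J) * xi K := by
  simp [Lser, Derivation.leibniz, pderiv_etab_xi, pderiv_etab_xib]

lemma pderiv_eta_Lser (J : Idx n) :
    pderiv ℂ (AVar.eta J) (Lser n) = ∑ K, C (gLow n J K) * xib K := by
  simp only [Lser, Derivation.leibniz, pderiv_eta_xi, pderiv_eta_xib, map_sum, pderiv_C,
    smul_eq_mul, mul_zero, add_zero, zero_add]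
  rw [Finset.sum_comm]
  simp

lemma sum_gUp_gLow (I K : Idx n) : ∑ J, gUp n I J * gLow n J K = if I = K then 1 else 0 := by
  rw [← Matrix.mul_apply, gUp_mul_gLow, Matrix.one_apply]

lemma sum_gUp_gLow' (I K : Idx n) : ∑ J, gUp n I J * gLow n K J = if I = K then 1 else 0 := by
  rw [← sum_gUp_gLow]
  exact Finset.sum_congr rfl fun J _ => by rw [gLow_symm]

lemma sum_gUp_gLow'' (I K : Idx n) : ∑ J, gUp n J I * gLow n J K = if I = K then 1 else 0 := by
  rw [← sum_gUp_gLow]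
  exact Finset.sum_congr rfl fun J _ => by rw [gUp_symm]

/-- The commutator [Δ, L] is Z + Z̄ + (n+1): the cross terms of the Leibniz rule contract g̃ with
its inverse and leave the Euler fields, and the second derivatives of L leave the trace of the
identity. -/
lemma lapA_Lser_mul (H : ASeries n) (hn : 1 ≤ n) :
    lapA (Lser n * H) = Lser n * lapA H + C ((n : ℂ) + 1) * H + euler H + eulerBar H := by
  have e : ∀ I J : Idx n, pderiv ℂ (AVar.eta I) (pderiv ℂ (AVar.etab J) (Lser n * H)) =
      Lser n * pderiv ℂ (AVar.eta I) (pderiv ℂ (AVar.etab J) H) +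
      pderiv ℂ (AVar.etab J) H * (∑ K, C (gLow n I K) * xib K) +
      (∑ K, C (gLow n K J) * xi K) * pderiv ℂ (AVar.eta I) H +
      C (gLow n I J) * H := by
    intro I J
    rw [Derivation.leibniz, pderiv_etab_Lser, map_add]
    simp only [Derivation.leibniz, smul_eq_mul, pderiv_eta_Lser, map_sum, pderiv_eta_xi, pderiv_C,
      mul_zero, add_zero]
    simp
    ring
  have e1 : ∑ I, ∑ J, C (gUp n I J) * (pderiv ℂ (AVar.etab J) H *
      (∑ K, C (gLow n I K) * xib K)) = eulerBar H := by
    rw [Finset.sum_comm, eulerBar]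
    refine Finset.sum_congr rfl fun J _ => ?_
    have : ∑ I, C (gUp n I J) * (∑ K, C (gLow n I K) * xib K) = (xib J : ASeries n) := by
      simp only [Finset.mul_sum, ← mul_assoc, ← map_mul]
      rw [Finset.sum_comm]
      simp only [← Finset.sum_mul, ← map_sum]
      simp [sum_gUp_gLow'', apply_ite]
    rw [← this, Finset.sum_mul]
    exact Finset.sum_congr rfl fun I _ => by ring
  have e2 : ∑ I, ∑ J, C (gUp n I J) * ((∑ K, C (gLow n K J) * xi K) *
      pderiv ℂ (AVar.eta I) H) = euler H := by
    rw [euler]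
    refine Finset.sum_congr rfl fun I _ => ?_
    have : ∑ J, C (gUp n I J) * (∑ K, C (gLow n K J) * xi K) = (xi I : ASeries n) := by
      simp only [Finset.mul_sum, ← mul_assoc, ← map_mul]
      rw [Finset.sum_comm]
      simp only [← Finset.sum_mul, ← map_sum]
      simp [sum_gUp_gLow', apply_ite]
    rw [← this, Finset.sum_mul]
    exact Finset.sum_congr rfl fun J _ => by ring
  have e3 : ∑ I, ∑ J, C (gUp n I J) * (C (gLow n I J) * H) = C ((n : ℂ) + 1) * H := by
    simp only [← mul_assoc, ← map_mul, ← Finset.sum_mul, ← map_sum]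
    congr 2
    simp_rw [sum_gUp_gLow']
    rw [Idx.sum_eq]
    simp
    -- The middle indices number `n - 1` in truncated subtraction; the total n + 1 needs n ≥ 1.
    rw [Nat.cast_sub hn]
    push_cast; ring
  simp only [lapA, e, mul_add, Finset.sum_add_distrib, e1, e2, e3]
  have e4 : ∑ I, ∑ J, C (gUp n I J) * (Lser n *
      pderiv ℂ (AVar.eta I) (pderiv ℂ (AVar.etab J) H)) = Lser n * lapA H := by
    simp only [lapA, Finset.mul_sum]
    exact Finset.sum_congr rfl fun I _ => Finset.sum_congr rfl fun J _ => by ring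
  rw [e4, lapA]
  ring

/-- Apply the commutator [Δ, L] once per factor L. At the i-th step the function multiplied by L has
degree (a+i, a+i) and contributes n+1+2(a+i); summing over i from 0 to k gives the constant. -/
lemma lapA_Lser_pow_mul (hn : 1 ≤ n) {a : ℂ} {H : ASeries n} (hH : Homog a H) (k : ℕ) :
    lapA (Lser n ^ (k + 1) * H) = Lser n ^ (k + 1) * lapA H +
      C ((k + 1) * (n + k + 1 + 2 * a)) * (Lser n ^ k * H) := by
  induction k with
  | zero =>
    rw [zero_add, pow_one, lapA_Lser_mul H hn, hH.1, hH.2]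
    simp only [map_add, map_mul, map_one, pow_zero, one_mul, Nat.cast_zero, map_zero, map_ofNat]
    ring
  | succ k ih =>
    have h1 : Homog (((k + 1 : ℕ) : ℂ) + a) (Lser n ^ (k + 1) * H) := (homog_Lser_pow _).mul hH
    rw [pow_succ' _ (k + 1), mul_assoc, lapA_Lser_mul _ hn, ih, h1.1, h1.2]
    push_cast
    simp only [map_add, map_mul, map_one, map_ofNat, map_natCast]
    ring

/-! #### Conjugation -/

lemma AVar.conj_conj (s : AVar n) : AVar.conj n (AVar.conj n s) = s := by cases s <;> rfl

lemma barA_xi (I : Idx n) : bar (AVar.conj n) (xi I) = xib I := by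
  rw [xi, map_add, bar_C, bar_X, xib]
  congr 2
  simp [e0, Pi.single_apply, apply_ite]

lemma barA_xib (I : Idx n) : bar (AVar.conj n) (xib I) = xi I := by
  rw [← barA_xi, bar_bar _ AVar.conj_conj]

lemma bar_sum {τ ι : Type} (s : τ ≃ τ) (t : Finset ι) (f : ι → MvPowerSeries τ ℂ) :
    bar s (∑ i ∈ t, f i) = ∑ i ∈ t, bar s (f i) := map_sum _ _ _

lemma barA_pderiv_eta (I : Idx n) (F : ASeries n) :
    bar (AVar.conj n) (pderiv ℂ (AVar.eta I) F) =
      pderiv ℂ (AVar.etab I) (bar (AVar.conj n) F) :=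
  bar_pderiv (AVar.conj n) (AVar.etab I) F

lemma barA_pderiv_etab (I : Idx n) (F : ASeries n) :
    bar (AVar.conj n) (pderiv ℂ (AVar.etab I) F) =
      pderiv ℂ (AVar.eta I) (bar (AVar.conj n) F) :=
  bar_pderiv (AVar.conj n) (AVar.eta I) F

lemma barA_lapA (F : ASeries n) : bar (AVar.conj n) (lapA F) = lapA (bar (AVar.conj n) F) := by
  simp only [lapA, bar_sum, bar_mul, bar_C, barA_pderiv_eta, barA_pderiv_etab, star_gUp]
  rw [Finset.sum_comm]
  refine Finset.sum_congr rfl fun I _ => Finset.sum_congr rfl fun J _ => ?_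
  rw [gUp_symm, pderiv_comm]

lemma barA_euler (F : ASeries n) :
    bar (AVar.conj n) (euler F) = eulerBar (bar (AVar.conj n) F) := by
  simp only [euler, eulerBar, bar_sum, bar_mul, barA_xi, barA_pderiv_eta]

lemma barA_eulerBar (F : ASeries n) :
    bar (AVar.conj n) (eulerBar F) = euler (bar (AVar.conj n) F) := by
  simp only [euler, eulerBar, bar_sum, bar_mul, barA_xib, barA_pderiv_etab]

lemma barA_Lser : bar (AVar.conj n) (Lser n) = Lser n := by
  simp only [Lser, bar_sum, bar_mul, bar_C, barA_xi, barA_xib, star_gLow]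
  rw [Finset.sum_comm]
  refine Finset.sum_congr rfl fun I _ => Finset.sum_congr rfl fun J _ => ?_
  rw [gLow_symm]; ring

/-! #### Weights -/

/-- The weights of the ambient variables. -/
def wtA (n : ℕ) : AVar n → ℕ
  | .eta I => I.wt
  | .etab I => I.wt

lemma vanish_xi (I : Idx n) : Vanish (wtA n) I.wt (xi I) := by
  rcases I with _ | j | _
  · exact vanish_zero_order _ _
  · have : xi (.mid j : Idx n) = X (AVar.eta (.mid j)) := by simp [xi, e0]
    rw [this]; exact vanish_X (wtA n) (AVar.eta (.mid j))
  · have : xi (.last : Idx n) = X (AVar.eta .last) := by simp [xi, e0]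
    rw [this]; exact vanish_X (wtA n) (AVar.eta .last)

lemma vanish_xib (I : Idx n) : Vanish (wtA n) I.wt (xib I) := by
  rw [← barA_xi]
  exact (vanish_xi I).bar fun s => by cases s <;> rfl

/-- The products in L pair index 0 with n, or a middle index with itself, so each has weight 2.
Multiples of L^n are therefore invisible below weight 2n. -/
lemma vanish_Lser : Vanish (wtA n) 2 (Lser n) := by
  rw [Lser_eq]
  have h : ∀ I J : Idx n, I.wt + J.wt = 2 → Vanish (wtA n) 2 (xi I * xib J) := fun I J hIJ =>
    hIJ ▸ (vanish_xi I).mul (vanish_xib J)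
  exact Vanish.mul_left (((h _ _ rfl).add (h _ _ rfl)).sub (vanish_sum _ fun j _ => h _ _ rfl)) _

lemma vanish_of_Lser_pow_dvd {k : ℕ} {F : ASeries n} (h : Lser n ^ k ∣ F) :
    Vanish (wtA n) (k * 2) F := by
  obtain ⟨H, rfl⟩ := h
  exact (vanish_Lser.pow k).mul_right H

end Ambient

/-! ### Setting a set of variables to zero -/

section Kill

variable {σ τ : Type}

/-- Setting the variables in `S` to zero. -/
noncomputable def kill (S : Set τ) : MvPowerSeries τ ℂ →+* MvPowerSeries τ ℂ :=
  open Classical in rescale (fun s => if s ∈ S then 0 else 1)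

lemma coeff_kill {S : Set τ} {d : τ →₀ ℕ} (hd : ∀ s ∈ S, d s = 0) (F : MvPowerSeries τ ℂ) :
    coeff d (kill S F) = coeff d F := by
  rw [kill, coeff_rescale, Finsupp.prod, Finset.prod_eq_one, one_mul]
  intro s hs
  rw [if_neg, one_pow]
  intro h
  exact (Finsupp.mem_support_iff.mp hs) (hd s h)

lemma kill_eq_subst (S : Set τ) (F : MvPowerSeries τ ℂ) :
    kill S F = subst (fun s => kill S (X s)) F := by
  have h : (fun s => kill S (X s)) =
      (open Classical in (fun s => if s ∈ S then (0 : ℂ) else 1)) •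
        (X : τ → MvPowerSeries τ ℂ) := by
    funext s
    rw [kill, rescale_eq_subst, subst_X (HasSubst.smul_X _)]
  rw [h, kill, rescale_eq_subst]

lemma kill_X_of_mem {S : Set τ} {s : τ} (h : s ∈ S) : kill S (X s) = 0 := by
  rw [kill, rescale_eq_subst, subst_X (HasSubst.smul_X _)]
  simp [h]

lemma kill_X_of_notMem {S : Set τ} {s : τ} (h : s ∉ S) : kill S (X s) = X s := by
  rw [kill, rescale_eq_subst, subst_X (HasSubst.smul_X _)]
  simp [h]

lemma kill_C (S : Set τ) (c : ℂ) : kill S (C c) = C c := by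
  classical
  ext d
  rw [kill, coeff_rescale, coeff_C]
  split_ifs with h
  · simp [h]
  · simp

lemma kill_subst [Finite σ] [Finite τ] (S : Set τ) {a : σ → MvPowerSeries τ ℂ}
    (ha : ∀ s, constantCoeff (a s) = 0) (f : MvPowerSeries σ ℂ) :
    kill S (subst a f) = subst (fun s => kill S (a s)) f := by
  have hk : HasSubst (fun s => kill S (X s) : τ → MvPowerSeries τ ℂ) := by
    refine hasSubst_of_constantCoeff_zero fun s => ?_
    rw [← coeff_zero_eq_constantCoeff_apply, coeff_kill (by simp)]
    simp
  rw [kill_eq_subst, subst_comp_subst_apply (hasSubst_of_constantCoeff_zero ha) hk]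
  congr 1
  funext s
  exact (kill_eq_subst S (a s)).symm

lemma constantCoeff_kill (S : Set τ) (F : MvPowerSeries τ ℂ) :
    constantCoeff (kill S F) = constantCoeff F := by
  rw [← coeff_zero_eq_constantCoeff_apply, coeff_kill (by simp)]; rfl

lemma kill_inv (S : Set τ) (F : MvPowerSeries τ ℂ) (hF : constantCoeff F ≠ 0) :
    kill S F⁻¹ = (kill S F)⁻¹ := by
  rw [MvPowerSeries.eq_inv_iff_mul_eq_one (by rwa [constantCoeff_kill]), ← map_mul,
    MvPowerSeries.inv_mul_cancel _ hF, map_one]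

/-- Used to show that a series annihilated by the derivative in `s` has no monomial containing `s`.
-/
lemma coeff_X_mul_pderiv (s : τ) (d : τ →₀ ℕ) (F : MvPowerSeries τ ℂ) :
    coeff d (X s * pderiv ℂ s F) = d s * coeff d F := by
  classical
  rcases Nat.eq_zero_or_pos (d s) with h | h
  · rw [h, Nat.cast_zero, zero_mul]
    exact X_dvd_iff.mp (Dvd.intro _ rfl) d h
  · obtain ⟨e, rfl⟩ : ∃ e, d = Finsupp.single s 1 + e :=
      ⟨d - Finsupp.single s 1, (add_tsub_cancel_of_le (by
        rw [Finsupp.single_le_iff]; omega)).symm⟩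
    rw [X, coeff_add_monomial_mul, one_mul, coeff_pderiv, add_comm e]
    simp
    ring

end Kill

/-! ### Restriction to the cone and homogeneous extension -/

section Restriction

variable {n : ℕ}

lemma BVar.conj_conj (s : BVar n) : BVar.conj n (BVar.conj n s) = s := by cases s <;> rfl

lemma barB_barB (f : BSeries n) : bar (BVar.conj n) (bar (BVar.conj n) f) = f :=
  bar_bar _ BVar.conj_conj f

lemma barA_barA (f : ASeries n) : bar (AVar.conj n) (bar (AVar.conj n) f) = f :=
  bar_bar _ AVar.conj_conj f

lemma barB_X (s : BVar n) : bar (BVar.conj n) (X s) = X (BVar.conj n s) := by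
  rw [bar_X]; cases s <;> rfl

lemma barB_wSq : bar (BVar.conj n) (wSq n) = wSq n := by
  simp only [wSq, bar_sum, bar_mul, barB_X]
  exact Finset.sum_congr rfl fun j _ => mul_comm _ _

lemma constantCoeff_wSq : constantCoeff (wSq n) = 0 := by simp [wSq]

lemma constantCoeff_conePt (I : Idx n) : constantCoeff (conePt n I) = e0 n I := by
  cases I <;> simp [conePt, e0, constantCoeff_wSq]

lemma star_e0 (I : Idx n) : star (e0 n I) = e0 n I := by
  simp [e0, Pi.single_apply, apply_ite]

lemma constantCoeff_coneSub (s : AVar n) : constantCoeff (coneSub n s) = 0 := by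
  cases s <;> simp [coneSub, constantCoeff_bar, -map_sub, -star_sub] <;>
  simp [constantCoeff_conePt]

lemma hasSubst_coneSub : HasSubst (coneSub n) :=
  hasSubst_of_constantCoeff_zero constantCoeff_coneSub

lemma bar_coneSub (s : AVar n) :
    bar (BVar.conj n) (coneSub n (AVar.conj n s)) = coneSub n s := by
  cases s
  · exact barB_barB _
  · rfl

lemma coneRestrict_bar (F : ASeries n) :
    coneRestrict (bar (AVar.conj n) F) = bar (BVar.conj n) (coneRestrict F) := by
  rw [coneRestrict, coneRestrict, bar_subst _ (AVar.conj n) constantCoeff_coneSub]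
  congr 1
  funext s
  exact (bar_coneSub s).symm

lemma coneRestrict_add (F H : ASeries n) :
    coneRestrict (F + H) = coneRestrict F + coneRestrict H := subst_add hasSubst_coneSub _ _

lemma coneRestrict_sub (F H : ASeries n) :
    coneRestrict (F - H) = coneRestrict F - coneRestrict H := subst_map_sub hasSubst_coneSub _ _

lemma coneRestrict_mul (F H : ASeries n) :
    coneRestrict (F * H) = coneRestrict F * coneRestrict H := subst_mul hasSubst_coneSub _ _

lemma coneRestrict_C (c : ℂ) : coneRestrict (C c : ASeries n) = C c :=
  subst_const hasSubst_coneSub c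

lemma coneRestrict_sum {ι : Type*} (t : Finset ι) (F : ι → ASeries n) :
    coneRestrict (∑ i ∈ t, F i) = ∑ i ∈ t, coneRestrict (F i) := subst_sum hasSubst_coneSub _ _

lemma coneRestrict_xi (I : Idx n) : coneRestrict (xi I) = conePt n I := by
  rw [xi, coneRestrict_add, coneRestrict_C, coneRestrict, subst_X hasSubst_coneSub]
  simp [coneSub]

lemma coneRestrict_xib (I : Idx n) : coneRestrict (xib I) = bar (BVar.conj n) (conePt n I) := by
  rw [← barA_xi, coneRestrict_bar, coneRestrict_xi]

lemma bar_conePt_last : bar (BVar.conj n) (conePt n .last) =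
    C (1 / 2) * wSq n - C Complex.I * X BVar.v := by
  have hv : bar (BVar.conj n) (X BVar.v) = X BVar.v := barB_X _
  simp only [conePt, map_add, bar_mul, bar_C, barB_wSq, hv]
  simp
  ring

lemma coneRestrict_Lser : coneRestrict (Lser n) = 0 := by
  rw [Lser_eq, coneRestrict_mul, coneRestrict_C, coneRestrict_sub, coneRestrict_add,
    coneRestrict_mul, coneRestrict_mul, coneRestrict_sum]
  simp only [coneRestrict_mul, coneRestrict_xi, coneRestrict_xib, bar_conePt_last]
  have h : ∑ j : Fin (n - 1), conePt n (.mid j) * bar (BVar.conj n) (conePt n (.mid j)) =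
      wSq n := by
    simp only [conePt, barB_X, wSq]; rfl
  have h2 : (C (1 / 2) + C (1 / 2) : BSeries n) = 1 := by rw [← map_add]; norm_num
  rw [h]
  simp only [conePt, bar_one]
  linear_combination (C (1 / 2) * wSq n) * h2

lemma constantCoeff_xi_zero : constantCoeff (xi .zero : ASeries n) = 1 := by simp [xi, e0]

lemma constantCoeff_xib_zero : constantCoeff (xib .zero : ASeries n) = 1 := by simp [xib, e0]

lemma xi_zero_mul_inv : (xi .zero : ASeries n) * (xi .zero)⁻¹ = 1 :=
  MvPowerSeries.mul_inv_cancel _ (by simp [constantCoeff_xi_zero])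

lemma xib_zero_mul_inv : (xib .zero : ASeries n) * (xib .zero)⁻¹ = 1 :=
  MvPowerSeries.mul_inv_cancel _ (by simp [constantCoeff_xib_zero])

/-- The affine coordinate `ξ_I / ξ_0`. -/
noncomputable def aff (I : Idx n) : ASeries n := xi I * (xi .zero)⁻¹

/-- The affine coordinate `conj ξ_I / conj ξ_0`. -/
noncomputable def affb (I : Idx n) : ASeries n := xib I * (xib .zero)⁻¹

lemma aff_mul (I : Idx n) : aff I * xi .zero = (xi I : ASeries n) := by
  rw [aff, mul_assoc, mul_comm _ (xi .zero), xi_zero_mul_inv, mul_one]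

lemma barA_aff (I : Idx n) : bar (AVar.conj n) (aff I) = affb I := by
  rw [aff, bar_mul, bar_inv _ _ (by simp [constantCoeff_xi_zero]), barA_xi, barA_xi, affb]

lemma barA_affb (I : Idx n) : bar (AVar.conj n) (affb I) = aff I := by
  rw [← barA_aff, barA_barA]

lemma xi_zero_ne_zero : (xi .zero : ASeries n) ≠ 0 := fun h => by
  have := constantCoeff_xi_zero (n := n)
  simp [h] at this

/-- Applying the Euler fields to (ξ_I/ξ_0)·ξ_0 = ξ_I and cancelling ξ_0 avoids differentiating the
inverse. -/
lemma homog_aff (I : Idx n) : Homog 0 (aff I : ASeries n) := by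
  rw [homog_zero_iff]
  constructor
  · have h := euler_mul (aff I) (xi .zero : ASeries n)
    rw [aff_mul, euler_xi, euler_xi, aff_mul, left_eq_add] at h
    exact (mul_eq_zero.mp h).resolve_left xi_zero_ne_zero
  · have h := eulerBar_mul (aff I) (xi .zero : ASeries n)
    rw [aff_mul, eulerBar_xi, eulerBar_xi, mul_zero, zero_add] at h
    exact (mul_eq_zero.mp h.symm).resolve_left xi_zero_ne_zero

lemma homog_bar {F : ASeries n} (h : Homog 0 F) : Homog 0 (bar (AVar.conj n) F) := by
  rw [homog_zero_iff] at *
  rw [← barA_euler, ← barA_eulerBar, h.1, h.2, map_zero]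
  exact ⟨rfl, rfl⟩

lemma homog_affb (I : Idx n) : Homog 0 (affb I : ASeries n) := by
  rw [← barA_aff]; exact homog_bar (homog_aff I)

lemma pderiv_etab_aff (I J : Idx n) : pderiv ℂ (AVar.etab J) (aff I) = 0 := by
  have h := congrArg (pderiv ℂ (AVar.etab J)) (aff_mul I)
  rw [Derivation.leibniz, pderiv_etab_xi, pderiv_etab_xi, smul_zero, zero_add, smul_eq_mul] at h
  exact (mul_eq_zero.mp h).resolve_left xi_zero_ne_zero

lemma eulerD_vanish (N : ℕ) (f : ASeries n) (h : Vanish 1 (N + 1) f) :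
    Vanish 1 N (eulerD n f) := by
  rw [eulerD_apply, euler]
  exact vanish_sum _ fun I _ => (Vanish.pderiv (w := 1) h).mul_left _

lemma eulerBarD_vanish (N : ℕ) (f : ASeries n) (h : Vanish 1 (N + 1) f) :
    Vanish 1 N (eulerBarD n f) := by
  rw [eulerBarD_apply, eulerBar]
  exact vanish_sum _ fun I _ => (Vanish.pderiv (w := 1) h).mul_left _

lemma homog_subst {σ : Type} [Fintype σ] {a : σ → ASeries n} (ha : ∀ s, constantCoeff (a s) = 0)
    (h : ∀ s, Homog 0 (a s)) (f : MvPowerSeries σ ℂ) : Homog 0 (subst a f) := by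
  simp only [homog_zero_iff] at *
  rw [← eulerD_apply, ← eulerBarD_apply, derivation_subst ha _ eulerD_vanish,
    derivation_subst ha _ eulerBarD_vanish]
  simp [eulerD_apply, eulerBarD_apply, h]

/-- Because ξ_0 = 1 + η_0, the Euler field couples each exponent with the one having one more η_0.
The equation `euler F = 0` is thus a recursion in the exponent of η_0. -/
lemma coeff_euler (F : ASeries n) (d : AVar n →₀ ℕ) :
    coeff d (euler F) = (d (.eta .zero) + 1) * coeff (d + Finsupp.single (.eta .zero) 1) F +
      (∑ I, (d (.eta I) : ℂ)) * coeff d F := by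
  simp only [euler, xi, add_mul, Finset.sum_add_distrib, map_add, map_sum, coeff_X_mul_pderiv,
    coeff_C_mul, Finset.sum_mul]
  congr 1
  rw [Finset.sum_eq_single Idx.zero]
  · simp only [e0, Pi.single_eq_same, one_mul, coeff_pderiv]; ring
  · intro I _ hI; simp [e0, hI]
  · simp

lemma coeff_eulerBar (F : ASeries n) (d : AVar n →₀ ℕ) :
    coeff d (eulerBar F) = (d (.etab .zero) + 1) * coeff (d + Finsupp.single (.etab .zero) 1) F +
      (∑ I, (d (.etab I) : ℂ)) * coeff d F := by
  simp only [eulerBar, xib, add_mul, Finset.sum_add_distrib, map_add, map_sum, coeff_X_mul_pderiv,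
    coeff_C_mul, Finset.sum_mul]
  congr 1
  rw [Finset.sum_eq_single Idx.zero]
  · simp only [e0, Pi.single_eq_same, one_mul, coeff_pderiv]; ring
  · intro I _ hI; simp [e0, hI]
  · simp

/-- The two Euler recursions propagate vanishing from exponent k of η_0, or of its conjugate, to k +
1, starting from the coefficients with neither variable: a function of degree (0, 0) is determined
by its values on ξ_0 = 1. -/
lemma Homog.eq_zero {F : ASeries n} (h : Homog 0 F)
    (h0 : ∀ d : AVar n →₀ ℕ, d (.eta .zero) = 0 → d (.etab .zero) = 0 → coeff d F = 0) :
    F = 0 := by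
  classical
  rw [homog_zero_iff] at h
  have key : ∀ (s : AVar n), (∀ d : AVar n →₀ ℕ, coeff d F = 0 →
      coeff (d + Finsupp.single s 1) F = 0) → ∀ d : AVar n →₀ ℕ,
      coeff (d.erase s) F = 0 → coeff d F = 0 := by
    intro s hs d hd
    have : ∀ k : ℕ, coeff (d.erase s + Finsupp.single s k) F = 0 := by
      intro k
      induction k with
      | zero => simpa using hd
      | succ k ih => rw [Finsupp.single_add, ← add_assoc]; exact hs _ ih
    have h2 := this (d s)
    rwa [Finsupp.erase_add_single] at h2
  ext d
  rw [map_zero]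
  refine key (.eta .zero) (fun e he => ?_) d (key (.etab .zero) (fun e he => ?_) _ ?_)
  · have h1 := coeff_euler F e
    rw [h.1, he, map_zero, mul_zero, add_zero] at h1
    exact (mul_eq_zero.mp h1.symm).resolve_left (Nat.cast_add_one_ne_zero _)
  · have h1 := coeff_eulerBar F e
    rw [h.2, he, map_zero, mul_zero, add_zero] at h1
    exact (mul_eq_zero.mp h1.symm).resolve_left (Nat.cast_add_one_ne_zero _)
  · apply h0
    · simp
    · simp

/-- The substitution `η_I ↦ ξ_I / ξ_0 - (ẽ_0)_I`. -/
noncomputable def affSub (n : ℕ) : AVar n → ASeries n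
  | .eta I => aff I - C (e0 n I)
  | .etab I => affb I - C (e0 n I)

lemma constantCoeff_aff (I : Idx n) : constantCoeff (aff I) = e0 n I := by
  simp [aff, xi, e0]

lemma constantCoeff_affb (I : Idx n) : constantCoeff (affb I) = e0 n I := by
  rw [← barA_aff, constantCoeff_bar, constantCoeff_aff, star_e0]

lemma constantCoeff_affSub (s : AVar n) : constantCoeff (affSub n s) = 0 := by
  cases s <;> simp [affSub, constantCoeff_aff, constantCoeff_affb]

lemma homog_affSub (s : AVar n) : Homog 0 (affSub n s) := by
  cases s
  · exact (homog_aff _).sub (homog_C _)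
  · exact (homog_affb _).sub (homog_C _)

/-- A function that is homogeneous of degree `(0, 0)` depends on `ξ_I / ξ_0` only. -/
lemma Homog.subst_affSub {F : ASeries n} (h : Homog 0 F) : subst (affSub n) F = F := by
  have hG := h.sub (homog_subst constantCoeff_affSub homog_affSub F)
  refine (sub_eq_zero.mp (hG.eq_zero fun d h1 h2 => ?_)).symm
  set S : Set (AVar n) := {.eta .zero, .etab .zero} with hS
  -- On ξ_0 = conj ξ_0 = 1 the affine coordinates are the ξ_I themselves, so the two sides agree
  -- there.
  have hk : kill S (F - subst (affSub n) F) = 0 := by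
    rw [map_sub, kill_subst S constantCoeff_affSub, kill_eq_subst S F, sub_eq_zero]
    congr 1
    have h1 : kill S (xi .zero) = 1 := by
      rw [xi, map_add, kill_C, kill_X_of_mem (by simp [hS])]; simp [e0]
    have h2 : kill S (xib .zero) = 1 := by
      rw [xib, map_add, kill_C, kill_X_of_mem (by simp [hS])]; simp [e0]
    have h3 : (1 : ASeries n)⁻¹ = 1 := by
      rw [MvPowerSeries.inv_eq_iff_mul_eq_one (by simp), mul_one]
    funext s
    rcases s with I | I
    · rw [affSub, aff, map_sub, map_mul, kill_inv _ _ (by simp [constantCoeff_xi_zero]), h1, h3,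
        xi, map_add, kill_C]
      ring
    · rw [affSub, affb, map_sub, map_mul, kill_inv _ _ (by simp [constantCoeff_xib_zero]), h2, h3,
        xib, map_add, kill_C]
      ring
  rw [← coeff_kill (S := S), hk, map_zero]
  rintro s (rfl | rfl)
  · exact h1
  · exact h2

/-- The sphere coordinates as functions on the ambient space that are homogeneous of degree
`(0, 0)`. -/
noncomputable def upSub (n : ℕ) : BVar n → ASeries n
  | .w j => aff (.mid j)
  | .wb j => affb (.mid j)
  | .v => C (1 / (2 * Complex.I)) * (aff .last - affb .last)

/-- The extension of a jet on the sphere that is homogeneous of degree `(0, 0)` and does not depend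
on `L / |ξ_0|²`. -/
noncomputable def up (f : BSeries n) : ASeries n := subst (upSub n) f

lemma constantCoeff_upSub (s : BVar n) : constantCoeff (upSub n s) = 0 := by
  cases s <;> simp [upSub, constantCoeff_aff, constantCoeff_affb, e0]

lemma hasSubst_upSub : HasSubst (upSub n) := hasSubst_of_constantCoeff_zero constantCoeff_upSub

lemma homog_up (f : BSeries n) : Homog 0 (up f) := by
  refine homog_subst constantCoeff_upSub (fun s => ?_) f
  cases s
  · exact homog_aff _
  · exact homog_affb _
  · exact ((homog_aff _).sub (homog_affb _)).C_mul _

lemma bar_upSub (s : BVar n) : bar (AVar.conj n) (upSub n (BVar.conj n s)) = upSub n s := by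
  cases s
  · exact barA_affb _
  · exact barA_aff _
  · simp only [BVar.conj, upSub, Equiv.coe_fn_mk, bar_mul, bar_C, map_sub, barA_aff, barA_affb]
    simp
    ring

lemma bar_up (f : BSeries n) : bar (AVar.conj n) (up f) = up (bar (BVar.conj n) f) := by
  rw [up, up, bar_subst _ (BVar.conj n) constantCoeff_upSub]
  congr 1
  funext s
  exact bar_upSub s

lemma coneRestrict_aff (I : Idx n) : coneRestrict (aff I) = conePt n I := by
  have h := congrArg coneRestrict (aff_mul I)
  rw [coneRestrict_mul, coneRestrict_xi, coneRestrict_xi] at h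
  simpa [conePt] using h

lemma coneRestrict_affb (I : Idx n) :
    coneRestrict (affb I) = bar (BVar.conj n) (conePt n I) := by
  rw [← barA_aff, coneRestrict_bar, coneRestrict_aff]

lemma C_inv_two_I_mul (x : BSeries n) :
    C (1 / (2 * Complex.I)) * (C Complex.I * x + C Complex.I * x) = x := by
  rw [← two_mul, ← mul_assoc, ← mul_assoc, ← map_ofNat (C : ℂ →+* BSeries n) 2, ← map_mul,
    ← map_mul]
  have : 1 / (2 * Complex.I) * 2 * Complex.I = 1 := by
    field_simp
  rw [this, map_one, one_mul]

lemma coneRestrict_up (f : BSeries n) : coneRestrict (up f) = f := by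
  rw [coneRestrict, up, subst_comp_subst_apply hasSubst_upSub hasSubst_coneSub]
  have : (fun s => subst (coneSub n) (upSub n s)) = X := by
    funext s
    change coneRestrict (upSub n s) = X s
    cases s with
    | w j => exact coneRestrict_aff _
    | wb j => rw [upSub, coneRestrict_affb, conePt, barB_X]; rfl
    | v =>
      rw [upSub, coneRestrict_mul, coneRestrict_C, coneRestrict_sub, coneRestrict_aff,
        coneRestrict_affb, bar_conePt_last, conePt]
      have := C_inv_two_I_mul (n := n) (X BVar.v)
      linear_combination this
  rw [this, subst_self]; rfl

lemma up_X (s : BVar n) : up (X s) = upSub n s := subst_X hasSubst_upSub s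

lemma up_conePt_mid (j : Fin (n - 1)) : up (conePt n (.mid j)) = aff (.mid j) := up_X _

lemma Lser_mul_inv : Lser n * ((xi .zero)⁻¹ * (xib .zero)⁻¹) =
    C (1 / 2) * (aff .last + affb .last - ∑ j : Fin (n - 1), aff (.mid j) * affb (.mid j)) := by
  have h : ∑ j : Fin (n - 1), (aff (.mid j) * affb (.mid j) : ASeries n) =
      (∑ j : Fin (n - 1), xi (.mid j) * xib (.mid j)) * ((xi .zero)⁻¹ * (xib .zero)⁻¹) := by
    rw [Finset.sum_mul]
    exact Finset.sum_congr rfl fun j _ => by rw [aff, affb]; ring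
  rw [Lser_eq, h, aff, affb]
  linear_combination (C (1 / 2) * xib .last * (xib .zero)⁻¹) * xi_zero_mul_inv (n := n) +
    (C (1 / 2) * xi .last * (xi .zero)⁻¹) * xib_zero_mul_inv (n := n)

/-- The real part of ξ_n/ξ_0 is |w'|²/2 + L/|ξ_0|², where w' stands for the middle affine
coordinates; so L/|ξ_0|² measures the deviation from the cone and can serve as the coordinate
transverse to it. -/
lemma up_conePt_last : up (conePt n .last) =
    aff .last - Lser n * ((xi .zero)⁻¹ * (xib .zero)⁻¹) := by
  have h : up (wSq n) = ∑ j : Fin (n - 1), aff (.mid j) * affb (.mid j) := by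
    rw [up, wSq, subst_sum hasSubst_upSub]
    refine Finset.sum_congr rfl fun j _ => ?_
    rw [subst_mul hasSubst_upSub, subst_X hasSubst_upSub, subst_X hasSubst_upSub]
    rfl
  have hC : ∀ c : ℂ, up (C c : BSeries n) = C c := fun c => subst_const hasSubst_upSub c
  have e : up (conePt n .last) = C (1 / 2) * up (wSq n) + C Complex.I * up (X BVar.v) := by
    rw [conePt, up, subst_add hasSubst_upSub, subst_mul hasSubst_upSub, subst_mul hasSubst_upSub,
      subst_const hasSubst_upSub, subst_const hasSubst_upSub]
    rfl
  have h3 : (C Complex.I * C (1 / (2 * Complex.I)) : ASeries n) = C (1 / 2) := by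
    rw [← map_mul]; congr 1; field_simp
  have h2 : (C (1 / 2) + C (1 / 2) : ASeries n) = 1 := by rw [← map_add]; norm_num
  rw [e, h, up_X, upSub, ← mul_assoc, h3, Lser_mul_inv]
  linear_combination aff .last * h2

/-- The coordinates `(w', conj w', v, L / |ξ_0|²)`, where `none` stands for `L / |ξ_0|²`. -/
noncomputable def collarSub (n : ℕ) : AVar n → MvPowerSeries (Option (BVar n)) ℂ := fun s =>
  subst (fun b => X (some b)) (coneSub n s) +
    (if s = .eta .last ∨ s = .etab .last then X none else 0)

/-- The functions `w', conj w', v, L / |ξ_0|²` on the ambient space. -/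
noncomputable def collarCoord (n : ℕ) : Option (BVar n) → ASeries n
  | some b => upSub n b
  | none => Lser n * ((xi .zero)⁻¹ * (xib .zero)⁻¹)

lemma constantCoeff_Lser : constantCoeff (Lser n) = 0 := by
  rw [Lser_eq]; simp [xi, xib, e0]

lemma hasSubst_some : HasSubst (fun b => X (some b) : BVar n → MvPowerSeries (Option (BVar n)) ℂ) :=
  hasSubst_of_constantCoeff_zero fun _ => by simp

/-- A function homogeneous of degree `(0, 0)` that vanishes on the cone is divisible by `L`. -/
lemma Lser_dvd_of_coneRestrict_eq_zero {F : ASeries n} (h : Homog 0 F)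
    (h0 : coneRestrict F = 0) : Lser n ∣ F := by
  have hc0 : ∀ s, constantCoeff (collarSub n s) = 0 := fun s => by
    rw [collarSub, map_add, constantCoeff_subst_of_zero (fun _ => by simp), constantCoeff_coneSub]
    split_ifs <;> simp
  have hcs := hasSubst_of_constantCoeff_zero hc0
  have hcc : HasSubst (collarCoord n) := by
    refine hasSubst_of_constantCoeff_zero fun s => ?_
    rcases s with _ | s
    · simp [collarCoord, constantCoeff_Lser]
    · exact constantCoeff_upSub s
  -- Since F depends only on the affine coordinates, it is recovered from its expression in w', conj
  -- w', v and L/|ξ_0|².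
  have h1 : subst (collarCoord n) (subst (collarSub n) F) = F := by
    conv_rhs => rw [← h.subst_affSub]
    rw [subst_comp_subst_apply hcs hcc]
    congr 1
    funext s
    have e : ∀ g : BSeries n, subst (collarCoord n) (subst (fun b => X (some b)) g :
        MvPowerSeries (Option (BVar n)) ℂ) = up g := by
      intro g
      rw [subst_comp_subst_apply hasSubst_some hcc, up]
      congr 1
      funext b
      rw [subst_X hcc]; rfl
    have hup : ∀ I, up (coneSub n (.eta I)) = up (conePt n I) - C (e0 n I) := fun I => by
      rw [coneSub, up, subst_map_sub hasSubst_upSub, subst_const hasSubst_upSub, up]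
    have key : ∀ I, subst (collarCoord n) (collarSub n (.eta I)) = affSub n (.eta I) := by
      intro I
      rw [collarSub, subst_add hcc, e, hup, affSub]
      rcases I with _ | j | _
      · have : up (1 : BSeries n) = 1 := subst_const_one hasSubst_upSub
        simp [subst_zero_right hcc, conePt, this, aff, xi_zero_mul_inv]
      · simp [subst_zero_right hcc, up_conePt_mid]
      · simp only [true_or, if_true]
        rw [up_conePt_last, subst_X hcc, collarCoord]
        ring
    have keyb : ∀ I, subst (collarCoord n) (collarSub n (.etab I)) = affSub n (.etab I) := by
      intro I
      have hb : affSub n (.etab I) = bar (AVar.conj n) (affSub n (.eta I)) := by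
        rw [affSub, affSub, map_sub, barA_aff, bar_C, star_e0]
      have hcb : coneSub n (.etab I) = bar (BVar.conj n) (coneSub n (.eta I)) := rfl
      rw [hb, ← key, collarSub, collarSub, subst_add hcc, subst_add hcc, e, e, map_add, bar_up, hcb]
      congr 1
      by_cases hI : I = .last
      · subst hI
        simp only [or_true, true_or, if_true]
        rw [subst_X hcc, collarCoord, bar_mul, bar_mul, barA_Lser,
          bar_inv _ _ (by simp [constantCoeff_xi_zero]),
          bar_inv _ _ (by simp [constantCoeff_xib_zero]), barA_xi, barA_xib]
        ring
      · simp [hI, subst_zero_right hcc]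
    rcases s with I | I
    · exact key I
    · exact keyb I
  -- Setting the transverse coordinate to zero is restriction to the cone, so the expression of F is
  -- a multiple of that coordinate, which stands for L times a function.
  have h2 : kill {none} (subst (collarSub n) F) = 0 := by
    rw [kill_subst _ hc0]
    have : (fun s => kill {none} (collarSub n s)) =
        fun s => subst (fun b => X (some b)) (coneSub n s) := by
      funext s
      rw [collarSub, map_add, kill_subst _ (fun _ => by simp)]
      have e1 : (fun b : BVar n => kill {none} (X (some b))) = fun b => X (some b) := by
        funext b
        exact kill_X_of_notMem (by simp)
      rw [e1]
      split_ifs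
      · rw [kill_X_of_mem (by simp), add_zero]
      · rw [map_zero, add_zero]
    rw [this, ← subst_comp_subst_apply hasSubst_coneSub hasSubst_some]
    change subst _ (coneRestrict F) = 0
    rw [h0, subst_zero_right hasSubst_some]
  have h3 : (X none : MvPowerSeries (Option (BVar n)) ℂ) ∣ subst (collarSub n) F := by
    rw [X_dvd_iff]
    intro m hm
    rw [← coeff_kill (S := {none}) (by simpa using hm), h2, map_zero]
  obtain ⟨H, hH⟩ := h3
  rw [← h1, hH, subst_mul hcc, subst_X hcc, collarCoord, mul_assoc]
  exact Dvd.intro _ rfl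

/-! ### Existence and uniqueness of ambient extensions -/

lemma wt_add_wt_of_gUp_ne_zero {K M : Idx n} (h : gUp n K M ≠ 0) : K.wt + M.wt = 2 := by
  cases K <;> cases M <;> simp_all [gUp, Idx.wt]

/-- A nonzero entry of g̃^{KL̄} differentiates in two variables of total weight 2, and
multiplication by L restores the loss. -/
lemma Vanish.Lser_mul_lapA {N : ℕ} {F : ASeries n} (h : Vanish (wtA n) N F) :
    Vanish (wtA n) N (Lser n * lapA F) := by
  -- For N < 2 the factor L alone has enough weight; otherwise N - 2 is a genuine difference.
  rcases Nat.lt_or_ge N 2 with hN | hN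
  · exact (vanish_Lser.mul_right _).mono hN.le
  obtain ⟨M, rfl⟩ := Nat.exists_eq_add_of_le hN
  refine vanish_Lser.mul (vanish_sum _ fun I _ => vanish_sum _ fun J _ => ?_)
  by_cases hIJ : gUp n I J = 0
  · rw [hIJ, map_zero, zero_mul]
    exact fun d _ => map_zero _
  · refine Vanish.mul_left (Vanish.pderiv (Vanish.pderiv (h.mono ?_))) _
    have := wt_add_wt_of_gUp_ne_zero hIJ
    change M + I.wt + J.wt ≤ _
    omega

/-- Begin with `up f` and remove the leading term L^k H of ΔF by subtracting c⁻¹ L^{k+1} H, which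
does not change the restriction to the cone. The correction is a multiple of L ΔF, so the order of
vanishing is kept along the way. -/
lemma exists_ambientExtension_vanish (hn : 1 ≤ n) {f : BSeries n} (hf : f ∈ JE n) {N : ℕ}
    (hN : Vanish (wtA n) N (up f)) :
    ∃ F : ASeries n, IsAmbientExtension f F ∧ Vanish (wtA n) N F := by
  have hf' : bar (BVar.conj n) f = f := sub_eq_zero.mp hf
  suffices H : ∀ k, k ≤ n - 1 → ∃ F : ASeries n, bar (AVar.conj n) F = F ∧ Homog 0 F ∧
      coneRestrict F = f ∧ Lser n ^ k ∣ lapA F ∧ Vanish (wtA n) N F by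
    obtain ⟨F, h1, h2, h3, h4, h5⟩ := H (n - 1) le_rfl
    rw [homog_zero_iff] at h2
    exact ⟨F, ⟨h1, h2.1, h2.2, h3, h4⟩, h5⟩
  intro k
  induction k with
  | zero =>
    intro _
    exact ⟨up f, by rw [bar_up, hf'], homog_up f, coneRestrict_up f, by simp, hN⟩
  | succ k ih =>
    intro hk
    obtain ⟨F, h1, h2, h3, ⟨H, h4⟩, hv⟩ := ih (by omega)
    -- ΔF has degree (-1, -1), and L^k accounts for (k, k).
    have hH : Homog (-1 - k) H := by
      refine (homog_Lser_pow k).of_mul (Lser_pow_ne_zero k) ?_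
      rw [← h4]
      convert h2.lapA using 1
      ring
    have hb : bar (AVar.conj n) H = H := by
      apply mul_left_cancel₀ (Lser_pow_ne_zero (n := n) k)
      rw [← h4, ← h1, ← barA_lapA, h4, bar_mul, bar_pow, barA_Lser]
    -- The constant of `lapA_Lser_pow_mul` at a = -1-k. It equals (k+1)(n-1-k), which is real, so
    -- reality is preserved, and nonzero because k + 1 < n.
    set c : ℂ := (k + 1) * (n + k + 1 + 2 * (-1 - k)) with hc
    have hcr : c = (((k + 1) * (n - 1 - k : ℝ) : ℝ) : ℂ) := by
      rw [hc]; push_cast; ring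
    have hc0 : c ≠ 0 := by
      rw [hcr]
      have : (k : ℝ) + 1 < n := by exact_mod_cast (by omega : k + 1 < n)
      have h5 : (0 : ℝ) < (k + 1) * (n - 1 - k) := mul_pos (by positivity) (by linarith)
      exact_mod_cast h5.ne'
    have hcs : star c⁻¹ = c⁻¹ := by
      rw [hcr, star_inv₀]
      simp only [RCLike.star_def, Complex.conj_ofReal]
    have hdeg : Homog 0 (Lser n ^ (k + 1) * H) := by
      have := (homog_Lser_pow (n := n) (k + 1)).mul hH
      have e : ((k + 1 : ℕ) : ℂ) + (-1 - k) = 0 := by push_cast; ring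
      rwa [e] at this
    refine ⟨F - C c⁻¹ * (Lser n ^ (k + 1) * H), ?_, h2.sub (hdeg.C_mul _), ?_, ?_, ?_⟩
    · rw [map_sub, bar_mul, bar_mul, bar_pow, barA_Lser, bar_C, hb, h1, hcs]
    · rw [coneRestrict_sub, h3, pow_succ, coneRestrict_mul, coneRestrict_mul, coneRestrict_mul,
        coneRestrict_Lser]
      ring
    · refine ⟨-(C c⁻¹ * lapA H), ?_⟩
      rw [lapA_sub, lapA_C_mul, lapA_Lser_pow_mul hn hH, h4, ← hc]
      have e : (C c⁻¹ * C c : ASeries n) = 1 := by rw [← map_mul, inv_mul_cancel₀ hc0, map_one]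
      linear_combination (-(Lser n ^ k * H)) * e
    · refine hv.sub (Vanish.mul_left ?_ _)
      -- L^{k+1} H is L ΔF for the extension of the previous stage.
      have := hv.Lser_mul_lapA
      rwa [h4, ← mul_assoc, ← pow_succ'] at this

lemma exists_ambientExtension (hn : 1 ≤ n) {f : BSeries n} (hf : f ∈ JE n) :
    ∃ F : ASeries n, IsAmbientExtension f F := by
  obtain ⟨F, hF, -⟩ := exists_ambientExtension_vanish hn hf (vanish_zero_order _ _)
  exact ⟨F, hF⟩

/-- If F = L^{k+1} H, then ΔF is c L^k H modulo L^{k+1} with c = (k+1)(n-1-k). As long as c ≠ 0,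
divisibility of ΔF by L^{k+1} forces L to divide H; the gain stops at L^n. -/
lemma Lser_pow_dvd_of_coneRestrict_eq_zero (hn : 1 ≤ n) {F : ASeries n} (h : Homog 0 F)
    (h0 : coneRestrict F = 0) (hL : Lser n ^ (n - 1) ∣ lapA F) : Lser n ^ n ∣ F := by
  suffices H : ∀ k, k + 1 ≤ n → Lser n ^ (k + 1) ∣ F by
    have := H (n - 1) (by omega)
    rwa [Nat.sub_add_cancel hn] at this
  intro k
  induction k with
  | zero => intro _; rw [zero_add, pow_one]; exact Lser_dvd_of_coneRestrict_eq_zero h h0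
  | succ k ih =>
    intro hk
    obtain ⟨H, hH⟩ := ih (by omega)
    have hHd : Homog (-1 - k) H := by
      refine (homog_Lser_pow (k + 1)).of_mul (Lser_pow_ne_zero (k + 1)) ?_
      rw [← hH]
      convert h using 1
      push_cast; ring
    have h1 := (pow_dvd_pow (Lser n) (by omega : k + 1 ≤ n - 1)).trans hL
    set c : ℂ := (k + 1) * (n + k + 1 + 2 * (-1 - k)) with hc
    have hc0 : c ≠ 0 := by
      have hcr : c = (((k + 1) * (n - 1 - k : ℝ) : ℝ) : ℂ) := by
        rw [hc]; push_cast; ring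
      rw [hcr]
      have : (k : ℝ) + 1 < n := by exact_mod_cast (by omega : k + 1 < n)
      have h5 : (0 : ℝ) < (k + 1) * (n - 1 - k) := mul_pos (by positivity) (by linarith)
      exact_mod_cast h5.ne'
    rw [hH, lapA_Lser_pow_mul hn hHd, dvd_add_right (Dvd.intro _ rfl), ← hc] at h1
    have e : (C c⁻¹ * C c : ASeries n) = 1 := by rw [← map_mul, inv_mul_cancel₀ hc0, map_one]
    have h2 : Lser n ^ (k + 1) ∣ Lser n ^ k * H := by
      have := h1.mul_left (C c⁻¹)
      rwa [← mul_assoc, e, one_mul] at this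
    rw [pow_succ, mul_dvd_mul_iff_left (Lser_pow_ne_zero k)] at h2
    rw [hH, pow_succ _ (k + 1)]
    exact mul_dvd_mul_left _ h2

end Restriction

section NormalForm

variable {n : ℕ}

/-! ### Pluriharmonic jets -/

/-- The affine coordinates that correspond to the holomorphic variables. -/
noncomputable def affHol (n : ℕ) : HVar n → ASeries n
  | some j => aff (.mid j)
  | none => C 2 * aff .last

lemma constantCoeff_affHol (s : HVar n) : constantCoeff (affHol n s) = 0 := by
  rcases s with _ | j <;> simp [affHol, constantCoeff_aff, e0]

lemma constantCoeff_holSub (s : HVar n) : constantCoeff (holSub n s) = 0 := by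
  rcases s with _ | j <;> simp [holSub, constantCoeff_wSq]

lemma coneRestrict_subst_affHol (φ : MvPowerSeries (HVar n) ℂ) :
    coneRestrict (subst (affHol n) φ) = holRestrict n φ := by
  rw [coneRestrict, subst_comp_subst_apply (hasSubst_of_constantCoeff_zero constantCoeff_affHol)
    hasSubst_coneSub, holRestrict]
  congr 1
  funext s
  change coneRestrict (affHol n s) = _
  rcases s with _ | j
  · have h2 : (C 2 * C (1 / 2) : BSeries n) = 1 := by rw [← map_mul]; norm_num
    rw [affHol, coneRestrict_mul, coneRestrict_C, coneRestrict_aff, conePt, holSub, map_mul]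
    linear_combination wSq n * h2
  · exact coneRestrict_aff _

/-- On the cone with ξ_0 = 1 the function 2ξ_n is |w'|² + 2iv. Substituting ξ_j/ξ_0 and 2ξ_n/ξ_0
into the series that defines the jet gives a holomorphic extension of degree 0. -/
lemma exists_holomorphic_of_mem_JP {p : BSeries n} (hp : p ∈ JP n) :
    ∃ Q : ASeries n, Homog 0 Q ∧ (∀ J, pderiv ℂ (AVar.etab J) Q = 0) ∧
      p = (1 / 2 : ℝ) • (coneRestrict Q + bar (BVar.conj n) (coneRestrict Q)) := by
  obtain ⟨φ, rfl⟩ := hp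
  refine ⟨subst (affHol n) φ, homog_subst constantCoeff_affHol (fun s => ?_) φ, fun J => ?_, ?_⟩
  · rcases s with _ | j
    · exact (homog_aff _).C_mul _
    · exact homog_aff _
  · rw [pderiv_subst constantCoeff_affHol]
    refine Finset.sum_eq_zero fun s _ => ?_
    rcases s with _ | j
    · simp [affHol, Derivation.leibniz, pderiv_etab_aff]
    · simp [affHol, pderiv_etab_aff]
  · rw [coneRestrict_subst_affHol]

/-- The holomorphic part of the restriction to the cone, in the holomorphic variables. -/
noncomputable def holSlice (n : ℕ) : AVar n → MvPowerSeries (HVar n) ℂ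
  | .eta .zero => 0
  | .eta (.mid j) => X (some j)
  | .eta .last => C (1 / 2) * X none
  | .etab _ => 0

/-- A series with no antiholomorphic derivative contains no monomial with an antiholomorphic
variable, so nothing is lost by setting these to zero. -/
lemma kill_eq_self_of_holomorphic {Q : ASeries n} (hQ : ∀ J, pderiv ℂ (AVar.etab J) Q = 0) :
    kill (Set.range AVar.etab) Q = Q := by
  classical
  ext d
  by_cases hd : ∀ s ∈ Set.range AVar.etab, d s = 0
  · rw [coeff_kill hd]
  · push Not at hd
    obtain ⟨_, ⟨J, rfl⟩, hJ⟩ := hd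
    have hz : ∀ F : ASeries n, pderiv ℂ (AVar.etab J) F = 0 → coeff d F = 0 := by
      intro F hF
      have h1 := coeff_X_mul_pderiv (AVar.etab J) d F
      rw [hF, mul_zero, map_zero] at h1
      exact (mul_eq_zero.mp h1.symm).resolve_left (by exact_mod_cast hJ)
    rw [hz Q (hQ J), hz]
    have h0 : ∀ s : AVar n, constantCoeff (kill (Set.range AVar.etab) (X s)) = 0 := fun s => by
      rw [constantCoeff_kill]; simp
    rw [kill_eq_subst, pderiv_subst h0]
    refine Finset.sum_eq_zero fun s _ => ?_
    rcases s with I | I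
    · rw [kill_X_of_notMem (by simp), pderiv_X_of_ne (by simp), mul_zero]
    · rw [kill_X_of_mem (by simp), map_zero, mul_zero]

/-- Sphere points are represented with ξ_0 = 1, so a holomorphic jet restricts to a series in w' and
ξ_n, with ξ_n equal to half of the variable that stands for |w'|² + 2iv. -/
lemma mem_JP_of_holomorphic {Q : ASeries n} (hQ : ∀ J, pderiv ℂ (AVar.etab J) Q = 0) :
    (1 / 2 : ℝ) • (coneRestrict Q + bar (BVar.conj n) (coneRestrict Q)) ∈ JP n := by
  refine ⟨subst (holSlice n) Q, ?_⟩
  have hs : HasSubst (holSlice n) := by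
    refine hasSubst_of_constantCoeff_zero fun s => ?_
    rcases s with (_ | j | _) | I <;> simp [holSlice]
  have h0 : ∀ s : AVar n, constantCoeff (kill (Set.range AVar.etab) (X s)) = 0 := fun s => by
    rw [constantCoeff_kill]; simp
  have : holRestrict n (subst (holSlice n) Q) = coneRestrict Q := by
    conv_rhs => rw [← kill_eq_self_of_holomorphic hQ, kill_eq_subst]
    rw [holRestrict, coneRestrict, subst_comp_subst_apply hs (hasSubst_holSub n),
      subst_comp_subst_apply (hasSubst_of_constantCoeff_zero h0) hasSubst_coneSub]
    congr 1
    funext s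
    rcases s with (_ | j | _) | I
    · rw [kill_X_of_notMem (by simp), subst_X hasSubst_coneSub]
      simp [holSlice, coneSub, conePt, e0, subst_zero_right (hasSubst_holSub n)]
    · rw [kill_X_of_notMem (by simp), subst_X hasSubst_coneSub, holSlice,
        subst_X (hasSubst_holSub n)]
      simp [coneSub, conePt, e0, holSub]
    · rw [kill_X_of_notMem (by simp), subst_X hasSubst_coneSub, holSlice,
        subst_mul (hasSubst_holSub n), subst_X (hasSubst_holSub n), subst_const (hasSubst_holSub n)]
      have h2 : (C (1 / 2) * C (2 * Complex.I) : BSeries n) = C Complex.I := by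
        rw [← map_mul]; congr 1; ring
      simp only [holSub, coneSub, conePt, e0]
      rw [mul_add, ← mul_assoc _ (C _), h2]
      simp
    · rw [kill_X_of_mem (by simp), holSlice, subst_zero_right (hasSubst_holSub n),
        subst_zero_right hasSubst_coneSub]
  rw [this]

/-! ### Coefficients of jets on the sphere -/

/-- The variables as a sum type. -/
def BVar.equivSum (n : ℕ) : BVar n ≃ (Fin (n - 1) ⊕ Fin (n - 1)) ⊕ Unit where
  toFun | .w j => .inl (.inl j) | .wb j => .inl (.inr j) | .v => .inr ()
  invFun | .inl (.inl j) => .w j | .inl (.inr j) => .wb j | .inr _ => .v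
  left_inv x := by cases x <;> rfl
  right_inv x := by rcases x with (_ | _) | _ <;> rfl

lemma BVar.sum_eq {M : Type*} [AddCommMonoid M] (f : BVar n → M) :
    ∑ s, f s = ∑ j, f (.w j) + ∑ j, f (.wb j) + f .v := by
  rw [← (BVar.equivSum n).symm.sum_comp, Fintype.sum_sum_type, Fintype.sum_sum_type]
  simp [BVar.equivSum]

/-- The weights of the variables on the sphere. -/
def wtB (n : ℕ) : BVar n → ℕ
  | .w _ => 1
  | .wb _ => 1
  | .v => 2

/-- The weights of the holomorphic variables. -/
def wtH (n : ℕ) : HVar n → ℕ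
  | some _ => 1
  | none => 2

lemma weight_wtB (d : BVar n →₀ ℕ) : Finsupp.weight (wtB n) d = bwt d := by
  rw [Finsupp.weight_apply, Finsupp.sum_fintype _ _ (by simp), BVar.sum_eq]
  simp [wtB, bwt, degW, degWb, mul_comm]

/-- The embedding of the holomorphic variables that sends `none` to `v`. -/
def holEmb (n : ℕ) : HVar n ↪ BVar n where
  toFun | some j => .w j | none => .v
  inj' := by rintro (_ | i) (_ | j) h <;> simp_all

lemma wtB_holEmb (s : HVar n) : wtB n (holEmb n s) = wtH n s := by
  rcases s with _ | j <;> rfl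

lemma weight_embDomain_holEmb (x : HVar n →₀ ℕ) :
    Finsupp.weight (wtB n) (x.embDomain (holEmb n)) = Finsupp.weight (wtH n) x := by
  rw [Finsupp.embDomain_eq_mapDomain, Finsupp.weight_apply, Finsupp.weight_apply,
    Finsupp.sum_mapDomain_index (by simp) (by intros; simp [add_mul])]
  simp [wtB_holEmb]

lemma exists_embDomain_of_wb_eq_zero {d : BVar n →₀ ℕ} (hd : ∀ j, d (.wb j) = 0) :
    ∃ x : HVar n →₀ ℕ, x.embDomain (holEmb n) = d := by
  refine ⟨d.comapDomain (holEmb n) (holEmb n).injective.injOn, ?_⟩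
  rw [Finsupp.embDomain_comapDomain]
  intro s hs
  rcases s with j | j | _
  · exact ⟨some j, rfl⟩
  · simp [hd] at hs
  · exact ⟨none, rfl⟩

lemma embDomain_holEmb_w (x : HVar n →₀ ℕ) (j : Fin (n - 1)) :
    x.embDomain (holEmb n) (.w j) = x (some j) := Finsupp.embDomain_apply_self (holEmb n) x (some j)

lemma embDomain_holEmb_wb (x : HVar n →₀ ℕ) (j : Fin (n - 1)) :
    x.embDomain (holEmb n) (.wb j) = 0 := by
  refine Finsupp.embDomain_of_notMem_range _ _ _ ?_
  rintro ⟨_ | i, h⟩ <;> simp [holEmb] at h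

lemma kill_wSq_wb : kill (Set.range BVar.wb) (wSq n) = 0 := by
  rw [wSq, map_sum]
  refine Finset.sum_eq_zero fun j _ => ?_
  rw [map_mul, kill_X_of_mem (s := BVar.wb j) (by simp), mul_zero]

lemma kill_wSq_w : kill (Set.range BVar.w) (wSq n) = 0 := by
  rw [wSq, map_sum]
  refine Finset.sum_eq_zero fun j _ => ?_
  rw [map_mul, kill_X_of_mem (s := BVar.w j) (by simp), zero_mul]

@[simp] lemma holEmb_some (j : Fin (n - 1)) : holEmb n (some j) = .w j := rfl

@[simp] lemma holEmb_none : holEmb n none = .v := rfl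

/-- The coefficients of `w'^α v^l` in `∑ A_α^l w'^α (|w'|² + 2 i v)^l`. -/
lemma coeff_holRestrict (φ : MvPowerSeries (HVar n) ℂ) (x : HVar n →₀ ℕ) :
    coeff (x.embDomain (holEmb n)) (holRestrict n φ) =
      (2 * Complex.I) ^ x none * coeff x φ := by
  rw [← coeff_kill (S := Set.range BVar.wb) (by
    rintro _ ⟨j, rfl⟩; exact embDomain_holEmb_wb x j), holRestrict,
    kill_subst _ constantCoeff_holSub]
  have hX : HasSubst (X ∘ holEmb n : HVar n → BSeries n) := HasSubst.X_comp _
  -- After conj w' is set to zero, |w'|² + 2iv becomes 2iv. The substitution is then a rescaling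
  -- followed by a renaming of variables.
  set c : HVar n → ℂ := fun s => s.elim (2 * Complex.I) (fun _ => 1) with hc
  have h1 : (fun s => kill (Set.range BVar.wb) (holSub n s)) =
      fun s => subst (X ∘ holEmb n : HVar n → BSeries n)
        ((c • (X : HVar n → MvPowerSeries (HVar n) ℂ)) s) := by
    funext s
    rw [Pi.smul_apply', subst_smul hX, subst_X hX]
    rcases s with _ | j
    · rw [holSub, map_add, kill_wSq_wb, zero_add, map_mul, kill_C, kill_X_of_notMem (by simp)]
      simp [hc, smul_eq_C_mul]
    · rw [holSub, kill_X_of_notMem (by simp)]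
      simp [hc]
  rw [h1, ← subst_comp_subst_apply (HasSubst.smul_X c) hX, ← rescale_eq_subst,
    ← rename_eq_subst, coeff_embDomain_rename, coeff_rescale,
    Finsupp.prod_fintype _ _ (by simp), Fintype.prod_option]
  simp [hc]

lemma holSub_pderiv_wb (j : Fin (n - 1)) :
    pderiv ℂ (BVar.wb j) (holSub n none) = X (BVar.w j) := by
  classical
  simp only [holSub, wSq, map_add, map_sum, Derivation.leibniz, pderiv_C, smul_eq_mul, mul_zero,
    add_zero]
  rw [Finset.sum_eq_single j]
  · simp [pderiv_X_of_ne (show (BVar.v : BVar n) ≠ BVar.wb j by simp),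
      pderiv_X_of_ne (show (BVar.w j : BVar n) ≠ BVar.wb j by simp)]
  · intro i _ hi
    rw [pderiv_X_of_ne (by simpa using hi), pderiv_X_of_ne (by simp)]
    simp
  · simp

lemma pderiv_wb_holRestrict (φ : MvPowerSeries (HVar n) ℂ) (j : Fin (n - 1)) :
    pderiv ℂ (BVar.wb j) (holRestrict n φ) =
      holRestrict n (pderiv ℂ none φ) * X (BVar.w j) := by
  rw [holRestrict, pderiv_subst constantCoeff_holSub, Fintype.sum_option, holSub_pderiv_wb]
  simp [holSub, pderiv_X_of_ne, holRestrict]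

/-- The exponent of `w_j conj w_j v^l`. -/
noncomputable def traceExp (j : Fin (n - 1)) (l : ℕ) : BVar n →₀ ℕ :=
  Finsupp.single (.w j) 1 + Finsupp.single (.wb j) 1 + Finsupp.single .v l

lemma weight_traceExp (j : Fin (n - 1)) (l : ℕ) :
    Finsupp.weight (wtB n) (traceExp j l) = 2 * (l + 1) := by
  simp only [traceExp, map_add, Finsupp.weight_single, wtB]
  simp; ring

lemma embDomain_single_none (l : ℕ) :
    (Finsupp.single none l).embDomain (holEmb n) = Finsupp.single .v l :=
  Finsupp.embDomain_single _ _ _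

/-- One derivative in conj w_j turns this coefficient into that of w_j v^l. Since the derivative of
|w'|² + 2iv is w_j, only the term with (|w'|² + 2iv)^{l+1} contributes. -/
lemma coeff_traceExp_holRestrict (φ : MvPowerSeries (HVar n) ℂ) (j : Fin (n - 1)) (l : ℕ) :
    coeff (traceExp j l) (holRestrict n φ) =
      (2 * Complex.I) ^ l * (coeff (Finsupp.single none (l + 1)) φ * (l + 1)) := by
  have h1 := coeff_pderiv (i := BVar.wb j) (holRestrict n φ)
    (Finsupp.single (.w j) 1 + Finsupp.single .v l)
  rw [pderiv_wb_holRestrict, mul_comm, X, coeff_add_monomial_mul, one_mul,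
    ← embDomain_single_none, coeff_holRestrict, coeff_pderiv] at h1
  rw [traceExp, add_right_comm, ← embDomain_single_none]
  simpa [← Finsupp.single_add, embDomain_single_none] using h1.symm

lemma mapDomain_conj_traceExp (j : Fin (n - 1)) (l : ℕ) :
    (traceExp j l).mapDomain (BVar.conj n) = traceExp j l := by
  simp only [traceExp, Finsupp.mapDomain_add, Finsupp.mapDomain_single]
  rw [add_comm (Finsupp.single (BVar.w j) 1)]
  rfl

lemma mapDomain_conj_v (l : ℕ) :
    (Finsupp.single .v l : BVar n →₀ ℕ).mapDomain (BVar.conj n) = Finsupp.single .v l :=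
  Finsupp.mapDomain_single

lemma mapDomain_conj_apply (d : BVar n →₀ ℕ) (s : BVar n) :
    d.mapDomain (BVar.conj n) s = d (BVar.conj n s) := by
  conv_lhs => rw [← BVar.conj_conj s]
  exact Finsupp.mapDomain_apply (BVar.conj n).injective _ _

/-- There are no terms `conj w'^β v^l` with `β ≠ 0` in `∑ A_α^l w'^α (|w'|² + 2 i v)^l`. -/
lemma coeff_conj_holRestrict (φ : MvPowerSeries (HVar n) ℂ) {x : HVar n →₀ ℕ} {j : Fin (n - 1)}
    (hj : x (some j) ≠ 0) :
    coeff ((x.embDomain (holEmb n)).mapDomain (BVar.conj n)) (holRestrict n φ) = 0 := by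
  classical
  rw [← coeff_kill (S := Set.range BVar.w) (by
    rintro _ ⟨i, rfl⟩
    rw [mapDomain_conj_apply]; exact embDomain_holEmb_wb x i), holRestrict,
    kill_subst _ constantCoeff_holSub]
  set a : HVar n → BSeries n := fun s => kill (Set.range BVar.w) (holSub n s) with ha
  have h0 : ∀ s, constantCoeff (a s) = 0 := fun s => by
    rw [ha]; simp only; rw [constantCoeff_kill, constantCoeff_holSub]
  have h1 : pderiv ℂ (BVar.wb j) (subst a φ) = 0 := by
    rw [pderiv_subst h0]
    refine Finset.sum_eq_zero fun s _ => ?_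
    rcases s with _ | i
    · simp only [ha]
      rw [holSub, map_add, kill_wSq_w, zero_add, map_mul, kill_C, kill_X_of_notMem (by simp)]
      simp [Derivation.leibniz, pderiv_X_of_ne]
    · simp only [ha]
      rw [holSub, kill_X_of_mem (by simp), map_zero, mul_zero]
  set d := (x.embDomain (holEmb n)).mapDomain (BVar.conj n)
  have h2 := coeff_X_mul_pderiv (BVar.wb j) d (subst a φ)
  rw [h1, mul_zero, map_zero] at h2
  refine (mul_eq_zero.mp h2.symm).resolve_left ?_
  have : d (BVar.wb j) = x (some j) := by
    rw [mapDomain_conj_apply]; exact embDomain_holEmb_w x j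
  rw [this]
  exact_mod_cast hj

/-- The real part of `∑ A_α^l w'^α (|w'|² + 2 i v)^l`. -/
noncomputable def reHol (φ : MvPowerSeries (HVar n) ℂ) : BSeries n :=
  (1 / 2 : ℝ) • (holRestrict n φ + bar (BVar.conj n) (holRestrict n φ))

lemma coeff_reHol (φ : MvPowerSeries (HVar n) ℂ) (d : BVar n →₀ ℕ) :
    coeff d (reHol φ) = (1 / 2 : ℂ) * (coeff d (holRestrict n φ) +
      star (coeff (d.mapDomain (BVar.conj n)) (holRestrict n φ))) := by
  have : ∀ F : BSeries n, coeff d ((1 / 2 : ℝ) • F) = (1 / 2 : ℂ) * coeff d F := fun F => by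
    change (1 / 2 : ℝ) • coeff d F = _
    rw [Complex.real_smul]; norm_num
  rw [reHol, this, map_add, coeff_bar]

lemma half_add_star (z : ℂ) : (1 / 2 : ℂ) * (z + star z) = (z.re : ℂ) := by
  rw [RCLike.star_def, Complex.add_conj]
  push_cast; ring

lemma coeff_reHol_of_ne (φ : MvPowerSeries (HVar n) ℂ) {x : HVar n →₀ ℕ} {j : Fin (n - 1)}
    (hj : x (some j) ≠ 0) :
    coeff (x.embDomain (holEmb n)) (reHol φ) =
      (1 / 2 : ℂ) * ((2 * Complex.I) ^ x none * coeff x φ) := by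
  rw [coeff_reHol, coeff_conj_holRestrict φ hj, coeff_holRestrict, star_zero, add_zero]

lemma coeff_reHol_single (φ : MvPowerSeries (HVar n) ℂ) (l : ℕ) :
    coeff (Finsupp.single .v l) (reHol φ) =
      (((2 * Complex.I) ^ l * coeff (Finsupp.single none l) φ).re : ℂ) := by
  rw [coeff_reHol, mapDomain_conj_v, half_add_star, ← embDomain_single_none, coeff_holRestrict]
  simp

/-- With A the coefficient of the pure power l + 1, the coefficient of v^{l+1} sees the real part of
(2i)^{l+1} A, and this one sees, up to the factor l + 1, that of (2i)^l A. The two numbers differ by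
the factor 2i, so together they determine A. -/
lemma coeff_reHol_traceExp (φ : MvPowerSeries (HVar n) ℂ) (j : Fin (n - 1)) (l : ℕ) :
    coeff (traceExp j l) (reHol φ) =
      (((2 * Complex.I) ^ l * (coeff (Finsupp.single none (l + 1)) φ * (l + 1))).re : ℂ) := by
  rw [coeff_reHol, mapDomain_conj_traceExp, half_add_star, coeff_traceExp_holRestrict]

/-! ### The slice -/

lemma mem_JE_iff {f : BSeries n} : f ∈ JE n ↔ bar (BVar.conj n) f = f := by
  rw [JE, LinearMap.mem_ker, LinearMap.sub_apply, sub_eq_zero]; rfl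

lemma reHol_mem_JE (φ : MvPowerSeries (HVar n) ℂ) : reHol φ ∈ JE n := by
  rw [mem_JE_iff, reHol, map_smul, map_add, barB_barB, add_comm]

lemma JP_le_JE : JP n ≤ JE n := by
  rintro _ ⟨φ, rfl⟩
  exact reHol_mem_JE φ

lemma coeff_bidegPart (p q : ℕ) (f : BSeries n) (d : BVar n →₀ ℕ) :
    coeff d (bidegPart n p q f) = if degW d = p ∧ degWb d = q then coeff d f else 0 := rfl

lemma bidegPart_eq_zero_iff (f : BSeries n) :
    (∀ p q, min p q = 0 → bidegPart n p q f = 0) ↔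
      ∀ d : BVar n →₀ ℕ, degW d = 0 ∨ degWb d = 0 → coeff d f = 0 := by
  constructor
  · intro h d hd
    have h1 := congrArg (coeff d) (h (degW d) (degWb d) (by omega))
    rwa [coeff_bidegPart, if_pos ⟨rfl, rfl⟩, map_zero] at h1
  · intro h p q hpq
    ext d
    rw [coeff_bidegPart, map_zero]
    split_ifs with h1
    · exact h d (by omega)
    · rfl

lemma degW_add (d e : BVar n →₀ ℕ) : degW (d + e) = degW d + degW e := by
  simp [degW, Finset.sum_add_distrib]

lemma degWb_add (d e : BVar n →₀ ℕ) : degWb (d + e) = degWb d + degWb e := by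
  simp [degWb, Finset.sum_add_distrib]

lemma coeff_lapB (f : BSeries n) (d : BVar n →₀ ℕ) :
    coeff d (lapB n f) = ∑ j, coeff (d + Finsupp.single (.w j) 1 + Finsupp.single (.wb j) 1) f *
      (d (.wb j) + 1) * (d (.w j) + 1) := by
  have : lapB n f = ∑ j, pderiv ℂ (BVar.w j) (pderiv ℂ (BVar.wb j) f) := by
    rw [lapB, LinearMap.sum_apply]; rfl
  rw [this, map_sum]
  refine Finset.sum_congr rfl fun j _ => ?_
  rw [coeff_pderiv, coeff_pderiv]
  simp

/-- For a real jet the terms without w' are conjugate to those without conj w', so one family of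
equations suffices. The trace of A_{1,1} is a series in v alone, whose coefficient at v^l is the
displayed sum. -/
lemma mem_N0_iff {f : BSeries n} : f ∈ N0 n ↔ f ∈ JE n ∧
    (∀ x : HVar n →₀ ℕ, coeff (x.embDomain (holEmb n)) f = 0) ∧
    ∀ l, ∑ j, coeff (traceExp j l) f = 0 := by
  have hN : f ∈ N0 n ↔ (f ∈ JE n ∧ ∀ p q, min p q = 0 → bidegPart n p q f = 0) ∧
      lapB n (bidegPart n 1 1 f) = 0 := by
    rw [N0, Submodule.mem_inf, Submodule.mem_inf]
    simp only [Submodule.mem_iInf, LinearMap.mem_ker, LinearMap.comp_apply]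
  rw [hN, bidegPart_eq_zero_iff, and_assoc, and_congr_right_iff]
  intro hJ
  rw [mem_JE_iff] at hJ
  refine and_congr ⟨fun h x => ?_, fun h d hd => ?_⟩ ⟨fun h l => ?_, fun h => ?_⟩
  · exact h _ (Or.inr (by simp [degWb, embDomain_holEmb_wb]))
  · have key : ∀ e : BVar n →₀ ℕ, degWb e = 0 → coeff e f = 0 := by
      intro e he
      obtain ⟨x, rfl⟩ := exists_embDomain_of_wb_eq_zero (d := e) (by simpa [degWb] using he)
      exact h x
    rcases hd with hd | hd
    · rw [← hJ, coeff_bar, key, star_zero]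
      rw [← hd, degW, degWb]
      exact Finset.sum_congr rfl fun j _ => mapDomain_conj_apply _ _
    · exact key d hd
  · have h1 := congrArg (coeff (Finsupp.single .v l)) h
    rw [coeff_lapB, map_zero] at h1
    rw [← h1]
    refine Finset.sum_congr rfl fun j _ => ?_
    rw [coeff_bidegPart, if_pos]
    · rw [traceExp, add_comm _ (Finsupp.single BVar.v l), add_assoc]
      simp
    · simp [degW, degWb, Finsupp.single_apply]
  · ext d
    rw [coeff_lapB, map_zero]
    by_cases hd : degW d = 0 ∧ degWb d = 0
    · have hdw : ∀ j, d (.w j) = 0 := by simpa [degW] using hd.1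
      have hdb : ∀ j, d (.wb j) = 0 := by simpa [degWb] using hd.2
      have hdv : d = Finsupp.single .v (d .v) := by
        ext s
        rcases s with j | j | _ <;> simp [hdw, hdb]
      rw [← h (d .v)]
      refine Finset.sum_congr rfl fun j _ => ?_
      rw [coeff_bidegPart, if_pos, hdw, hdb]
      · rw [traceExp, add_comm _ (Finsupp.single BVar.v _), ← hdv, add_assoc]
        simp
      · simp only [degW_add, degWb_add, hd.1, hd.2]
        simp [degW, degWb, Finsupp.single_apply]
    · refine Finset.sum_eq_zero fun j _ => ?_
      rw [coeff_bidegPart, if_neg, zero_mul, zero_mul]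
      simp only [degW_add, degWb_add]
      simp [degW, degWb, Finsupp.single_apply]
      simpa [degW, degWb] using hd

lemma N0_le_JE : N0 n ≤ JE n := fun _ hf => (mem_N0_iff.mp hf).1

lemma eq_single_none {x : HVar n →₀ ℕ} (hx : ∀ j, x (some j) = 0) :
    x = Finsupp.single none (x none) := by
  ext s
  rcases s with _ | j <;> simp [hx]

lemma exists_ofReal_eq {z : ℂ} (hz : star z = z) : ∃ r : ℝ, z = r :=
  ⟨z.re, (Complex.conj_eq_iff_re.mp hz).symm⟩

/-- The holomorphic coefficients of the pluriharmonic part of a jet. -/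
noncomputable def holPart (f : BSeries n) : MvPowerSeries (HVar n) ℂ := fun x =>
  open Classical in
  if ∃ j, x (some j) ≠ 0 then
    2 * coeff (x.embDomain (holEmb n)) f / (2 * Complex.I) ^ x none
  else (coeff (Finsupp.single .v (x none)) f +
    Complex.I * (2 * (∑ j, coeff (traceExp j (x none - 1)) f) / ((n - 1 : ℕ) * (x none : ℂ)))) /
      (2 * Complex.I) ^ x none

/-- The slice conditions are solved for the holomorphic coefficients. Terms with some w_j fix theirs
directly. For a pure power l ≥ 1, the coefficient of v^l fixes the real part of (2i)^l A^l and the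
trace at v^{l-1} fixes its imaginary part 2·trace/((n-1)l). -/
lemma sub_reHol_holPart_mem {f : BSeries n} (hf : f ∈ JE n) : f - reHol (holPart f) ∈ N0 n := by
  classical
  have hI : (2 * Complex.I) ≠ 0 := by simp
  have hf' := mem_JE_iff.mp hf
  have hreal : ∀ d : BVar n →₀ ℕ, d.mapDomain (BVar.conj n) = d → star (coeff d f) = coeff d f := by
    intro d hd
    conv_rhs => rw [← hf', coeff_bar, hd]
  have hc : ∀ l, star (∑ j, coeff (traceExp j l) f) = ∑ j, coeff (traceExp j l) f := fun l => by
    rw [star_sum]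
    exact Finset.sum_congr rfl fun j _ => hreal _ (mapDomain_conj_traceExp j l)
  have hsingle : ∀ l, (2 * Complex.I) ^ l * coeff (Finsupp.single none l) (holPart f) =
      coeff (Finsupp.single .v l) f +
        Complex.I * (2 * (∑ j, coeff (traceExp j (l - 1)) f) / ((n - 1 : ℕ) * (l : ℂ))) := by
    intro l
    change _ * holPart f (Finsupp.single none l) = _
    rw [holPart, if_neg (by simp)]
    simp only [Finsupp.single_eq_same]
    rw [mul_div_cancel₀ _ (pow_ne_zero _ hI)]
  rw [mem_N0_iff]
  refine ⟨Submodule.sub_mem _ hf (reHol_mem_JE _), fun x => ?_, fun l => ?_⟩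
  · rw [map_sub, sub_eq_zero]
    by_cases hx : ∃ j, x (some j) ≠ 0
    · obtain ⟨j, hj⟩ := hx
      rw [coeff_reHol_of_ne _ hj]
      change _ = 1 / 2 * (_ * holPart f x)
      rw [holPart, if_pos ⟨j, hj⟩, mul_div_cancel₀ _ (pow_ne_zero _ hI)]
      ring
    · push Not at hx
      rw [eq_single_none hx, embDomain_single_none, coeff_reHol_single, hsingle]
      obtain ⟨a, ha⟩ := exists_ofReal_eq (hreal (Finsupp.single .v (x none)) (mapDomain_conj_v _))
      obtain ⟨c, hc'⟩ := exists_ofReal_eq (hc (x none - 1))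
      rw [ha, hc']
      -- This term is real, so i times it has no real part. At exponent zero the quotient is 0 by
      -- the convention for division by zero.
      have h3 : (2 * (c : ℂ) / ((n - 1 : ℕ) * (x none : ℂ))) =
          ((2 * c / ((n - 1 : ℕ) * (x none : ℝ)) : ℝ) : ℂ) := by push_cast; ring
      rw [h3, Complex.add_re, Complex.ofReal_re, mul_comm, Complex.re_ofReal_mul, Complex.I_re,
        mul_zero, add_zero]
  · simp only [map_sub, Finset.sum_sub_distrib, coeff_reHol_traceExp, Finset.sum_const,
      Finset.card_univ, Fintype.card_fin, nsmul_eq_mul]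
    -- For n = 1 there are no w_j and the trace condition is empty; otherwise the division by n - 1
    -- in the definition of `holPart` is legitimate.
    rcases Nat.eq_zero_or_pos (n - 1) with hn | hn
    · have : IsEmpty (Fin (n - 1)) := by rw [hn]; infer_instance
      simp [hn]
    have hn' : ((n - 1 : ℕ) : ℂ) ≠ 0 := by exact_mod_cast hn.ne'
    have hnr : ((n - 1 : ℕ) : ℝ) ≠ 0 := by exact_mod_cast hn.ne'
    have hl : ((l : ℝ) + 1) ≠ 0 := by positivity
    -- Dividing by 2i exchanges the roles of real and imaginary part, so the trace sees the
    -- prescribed imaginary part of (2i)^{l+1} A^{l+1}.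
    have h4 : (2 * Complex.I) ^ l * (coeff (Finsupp.single none (l + 1)) (holPart f) * (l + 1)) =
        ((2 * Complex.I) ^ (l + 1) * coeff (Finsupp.single none (l + 1)) (holPart f)) *
          ((l + 1) / (2 * Complex.I)) := by
      rw [pow_succ]; field_simp
    rw [h4, hsingle, Nat.add_sub_cancel]
    obtain ⟨a, ha⟩ := exists_ofReal_eq (hreal (Finsupp.single .v (l + 1)) (mapDomain_conj_v _))
    obtain ⟨c, hc'⟩ := exists_ofReal_eq (hc l)
    rw [ha, hc']
    have h5 : (a + Complex.I * (2 * c / ((n - 1 : ℕ) * ((l + 1 : ℕ) : ℂ)))) *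
        ((l + 1) / (2 * Complex.I)) =
        ((c / (n - 1 : ℕ) : ℝ) : ℂ) - ((a * (l + 1) / 2 : ℝ) : ℂ) * Complex.I := by
      have hl' : ((l : ℂ) + 1) ≠ 0 := by exact_mod_cast Nat.succ_ne_zero l
      push_cast
      field_simp
      linear_combination ((a : ℂ) * (n - 1 : ℕ) * (l + 1)) * Complex.I_sq
    rw [h5]
    simp only [Complex.sub_re, Complex.ofReal_re, Complex.re_ofReal_mul, Complex.I_re, mul_zero,
      sub_zero]
    push_cast
    field_simp
    ring

/-! ### Transversality of the slice and the pluriharmonic jets in each weight -/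

lemma vanish_holSub (s : HVar n) : Vanish (wtB n) (wtH n s) (holSub n s) := by
  rcases s with _ | j
  · refine (vanish_sum _ fun j _ => ?_).add (Vanish.mul_left (vanish_X (wtB n) .v) _)
    exact Vanish.mul (N := 1) (M := 1) (vanish_X (wtB n) (.w j)) (vanish_X (wtB n) (.wb j))
  · exact vanish_X (wtB n) (.w j)

lemma wtB_conj (s : BVar n) : wtB n (BVar.conj n s) = wtB n s := by cases s <;> rfl

lemma vanish_reHol {N : ℕ} {φ : MvPowerSeries (HVar n) ℂ} (h : Vanish (wtH n) N φ) :
    Vanish (wtB n) N (reHol φ) := by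
  have h1 : Vanish (wtB n) N (holRestrict n φ) := h.subst (hasSubst_holSub n) vanish_holSub
  have h2 := h1.add (h1.bar wtB_conj)
  intro d hd
  change (1 / 2 : ℝ) • coeff d (holRestrict n φ + bar (BVar.conj n) (holRestrict n φ)) = 0
  rw [h2 d hd, smul_zero]

/-- An element of the slice that agrees with a pluriharmonic jet up to weight `N` vanishes up to
weight `N`. -/
lemma vanish_of_mem_N0_of_sub_mem_JP {N : ℕ} {g p : BSeries n} (hg : g ∈ N0 n) (hp : p ∈ JP n)
    (h : Vanish (wtB n) N (g - p)) : Vanish (wtB n) N g := by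
  classical
  obtain ⟨-, hg1, hg2⟩ := mem_N0_iff.mp hg
  obtain ⟨φ, rfl⟩ := hp
  change Vanish _ _ (g - reHol φ) at h
  -- For n = 1 every monomial is a power of v, and the slice is zero.
  rcases Nat.eq_zero_or_pos (n - 1) with hn | hn
  · have : IsEmpty (Fin (n - 1)) := by rw [hn]; infer_instance
    intro d _
    obtain ⟨x, rfl⟩ := exists_embDomain_of_wb_eq_zero (d := d) (fun j => isEmptyElim j)
    exact hg1 x
  have hI : (2 * Complex.I) ≠ 0 := by simp
  have hn' : ((n - 1 : ℕ) : ℂ) ≠ 0 := by exact_mod_cast hn.ne'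
  have ha : ∀ x : HVar n →₀ ℕ, Finsupp.weight (wtH n) x < N →
      coeff (x.embDomain (holEmb n)) (reHol φ) = 0 := by
    intro x hx
    have := h _ (by rwa [weight_embDomain_holEmb])
    rwa [map_sub, hg1, zero_sub, neg_eq_zero] at this
  have hre : ∀ l, 2 * l < N →
      ((2 * Complex.I) ^ l * coeff (Finsupp.single none l) φ).re = 0 := by
    intro l hl
    have := ha (Finsupp.single none l) (by
      rw [Finsupp.weight_single, wtH, smul_eq_mul, mul_comm]; exact hl)
    rw [embDomain_single_none, coeff_reHol_single] at this
    exact_mod_cast this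
  -- All holomorphic coefficients of weight below N vanish except possibly the constant, whose
  -- imaginary part leaves no trace in the real jet.
  have hφ : Vanish (wtH n) N (φ - C (constantCoeff φ)) := by
    intro x hx
    by_cases hx0 : x = 0
    · simp [hx0]
    rw [map_sub, coeff_C, if_neg hx0, sub_zero]
    by_cases hxj : ∃ j, x (some j) ≠ 0
    · obtain ⟨j, hj⟩ := hxj
      have := ha x hx
      rw [coeff_reHol_of_ne _ hj] at this
      simpa [hI] using this
    · push Not at hxj
      have hs := eq_single_none hxj
      obtain ⟨l, hl⟩ : ∃ l, x none = l + 1 := by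
        refine Nat.exists_eq_succ_of_ne_zero fun h0 => hx0 ?_
        rw [hs, h0, Finsupp.single_zero]
      rw [hl] at hs
      have hw : 2 * (l + 1) < N := by
        rw [hs, Finsupp.weight_single, wtH, smul_eq_mul, mul_comm] at hx; exact hx
      have h1 := hre (l + 1) hw
      -- The coefficient of v^{l+1} kills the imaginary part of `y` and the trace at v^l its real
      -- part. The exponents involved all have weight 2(l+1) < N.
      have h2 : ∑ j : Fin (n - 1), coeff (traceExp j l) (reHol φ) = 0 := by
        rw [← hg2 l]
        refine Finset.sum_congr rfl fun j _ => ?_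
        have := h (traceExp j l) (by rwa [weight_traceExp])
        rw [map_sub, sub_eq_zero] at this
        exact this.symm
      simp only [coeff_reHol_traceExp, Finset.sum_const, Finset.card_univ, Fintype.card_fin,
        nsmul_eq_mul, mul_eq_zero, hn', false_or, Complex.ofReal_eq_zero] at h2
      rw [hs]
      set z := coeff (Finsupp.single none (l + 1)) φ with hz
      set y := (2 * Complex.I) ^ l * z with hy
      have h3 : (2 * Complex.I) ^ (l + 1) * z = 2 * (y * Complex.I) := by rw [hy, pow_succ]; ring
      have h4 : (2 * Complex.I) ^ l * (z * (l + 1)) = y * ((l + 1 : ℝ) : ℂ) := by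
        rw [hy]; push_cast; ring
      rw [h3] at h1
      rw [h4, Complex.re_mul_ofReal] at h2
      have hl1 : ((l : ℝ) + 1) ≠ 0 := by positivity
      have h5 : y.re = 0 := (mul_eq_zero.mp h2).resolve_right hl1
      have h6 : y.im = 0 := by simpa using h1
      have h7 : y = 0 := Complex.ext h5 h6
      exact (mul_eq_zero.mp h7).resolve_left (pow_ne_zero _ hI)
  have hp : Vanish (wtB n) N (reHol φ) := by
    rcases Nat.eq_zero_or_pos N with rfl | hN
    · exact vanish_zero_order _ _
    have h0 : (constantCoeff φ).re = 0 := by simpa using hre 0 (by omega)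
    have h1 : reHol φ = reHol (φ - C (constantCoeff φ)) := by
      have e : holRestrict n (φ - C (constantCoeff φ)) =
          holRestrict n φ - C (constantCoeff φ) := by
        rw [holRestrict, subst_map_sub (hasSubst_holSub n), subst_const (hasSubst_holSub n),
          holRestrict]
      have e2 : (C (constantCoeff φ) + C (star (constantCoeff φ)) : BSeries n) = 0 := by
        rw [← map_add, RCLike.star_def, Complex.add_conj, h0]; simp
      rw [reHol, reHol, e, map_sub, bar_C]
      congr 1
      linear_combination e2
    rw [h1]
    exact vanish_reHol hφ
  have h' := h.add hp
  rwa [sub_add_cancel] at h'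

lemma N0_sup_JP : N0 n ⊔ JP n = JE n := by
  refine le_antisymm (sup_le N0_le_JE JP_le_JE) fun f hf => ?_
  rw [← sub_add_cancel f (reHol (holPart f))]
  exact Submodule.add_mem_sup (sub_reHol_holPart_mem hf) ⟨_, rfl⟩

/-- A jet in both spaces differs by zero from a pluriharmonic one, so the weighted statement applies
at every order. -/
lemma disjoint_N0_JP : Disjoint (N0 n) (JP n) := by
  rw [Submodule.disjoint_def]
  intro f hf hp
  ext d
  exact vanish_of_mem_N0_of_sub_mem_JP hf hp (N := Finsupp.weight (wtB n) d + 1)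
    (by rw [sub_self]; intro e _; simp) d (Nat.lt_succ_self _)

end NormalForm

/-! ### Iterated derivatives -/

section Diffs

variable {τ : Type}

lemma diffs_cons (s : τ) (l : List τ) (F : MvPowerSeries τ ℂ) :
    diffs (s :: l) F = pderiv ℂ s (diffs l F) := rfl

lemma diffs_append (l l' : List τ) (F : MvPowerSeries τ ℂ) :
    diffs (l ++ l') F = diffs l (diffs l' F) := List.foldr_append

lemma diffs_pderiv (s : τ) (l : List τ) (F : MvPowerSeries τ ℂ) :
    diffs l (pderiv ℂ s F) = pderiv ℂ s (diffs l F) := by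
  induction l with
  | nil => rfl
  | cons t l ih => rw [diffs_cons, diffs_cons, ih, pderiv_comm]

lemma diffs_perm {l l' : List τ} (h : l.Perm l') (F : MvPowerSeries τ ℂ) :
    diffs l F = diffs l' F := by
  induction h with
  | nil => rfl
  | cons s _ ih => rw [diffs_cons, diffs_cons, ih]
  | swap s t l => rw [diffs_cons, diffs_cons, diffs_cons, diffs_cons, pderiv_comm]
  | trans _ _ h1 h2 => rw [h1, h2]

/-- The iterated derivative as a linear map. -/
noncomputable def diffsL (l : List τ) : MvPowerSeries τ ℂ →ₗ[ℂ] MvPowerSeries τ ℂ :=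
  l.foldr (fun s H => (pderiv ℂ s).toLinearMap ∘ₗ H) LinearMap.id

lemma diffsL_apply (l : List τ) (F : MvPowerSeries τ ℂ) : diffsL l F = diffs l F := by
  induction l with
  | nil => rfl
  | cons s l ih => rw [diffs_cons, ← ih]; rfl

lemma diffs_sub (l : List τ) (F H : MvPowerSeries τ ℂ) :
    diffs l (F - H) = diffs l F - diffs l H := by simp only [← diffsL_apply, map_sub]

lemma diffs_zero (l : List τ) : diffs l (0 : MvPowerSeries τ ℂ) = 0 := by
  simp only [← diffsL_apply, map_zero]

lemma diffs_sum {ι : Type*} (l : List τ) (t : Finset ι) (F : ι → MvPowerSeries τ ℂ) :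
    diffs l (∑ i ∈ t, F i) = ∑ i ∈ t, diffs l (F i) := by simp only [← diffsL_apply, map_sum]

lemma diffs_C_mul (l : List τ) (c : ℂ) (F : MvPowerSeries τ ℂ) :
    diffs l (C c * F) = C c * diffs l F := by
  simp only [← diffsL_apply, ← smul_eq_C_mul, map_smul]

lemma diffs_bar (s : τ ≃ τ) (l : List τ) (F : MvPowerSeries τ ℂ) :
    diffs l (bar s F) = bar s (diffs (l.map s) F) := by
  induction l with
  | nil => rfl
  | cons t l ih => rw [diffs_cons, ih, List.map_cons, diffs_cons, bar_pderiv]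

/-- The multi-index of a list of variables. -/
noncomputable def multiIdx (l : List τ) : τ →₀ ℕ := (l.map (Finsupp.single · 1)).sum

lemma multiIdx_cons (s : τ) (l : List τ) :
    multiIdx (s :: l) = Finsupp.single s 1 + multiIdx l := by simp [multiIdx]

lemma multiIdx_append (l l' : List τ) : multiIdx (l ++ l') = multiIdx l + multiIdx l' := by
  simp [multiIdx]

lemma multiIdx_perm {l l' : List τ} (h : l.Perm l') : multiIdx l = multiIdx l' :=
  (h.map _).sum_eq

lemma multiIdx_apply [DecidableEq τ] (l : List τ) (s : τ) : multiIdx l s = l.count s := by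
  induction l with
  | nil => simp [multiIdx]
  | cons t l ih =>
    rw [multiIdx_cons, Finsupp.add_apply, ih, List.count_cons, Finsupp.single_apply, add_comm]
    simp

lemma perm_of_multiIdx_eq {l l' : List τ} (h : multiIdx l = multiIdx l') : l.Perm l' := by
  classical
  rw [List.perm_iff_count]
  intro s
  rw [← multiIdx_apply, ← multiIdx_apply, h]

lemma exists_multiIdx_eq (d : τ →₀ ℕ) : ∃ l : List τ, multiIdx l = d := by
  classical
  induction d using Finsupp.induction_linear with
  | zero => exact ⟨[], rfl⟩
  | add d e hd he =>
    obtain ⟨l, rfl⟩ := hd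
    obtain ⟨l', rfl⟩ := he
    exact ⟨l ++ l', multiIdx_append l l'⟩
  | single s k =>
    refine ⟨List.replicate k s, ?_⟩
    ext t
    rw [multiIdx_apply, List.count_replicate, Finsupp.single_apply]
    simp

/-- The product of the factorials of the entries of a multi-index. -/
def factorial [Fintype τ] (d : τ →₀ ℕ) : ℕ := ∏ s, (d s).factorial

lemma factorial_ne_zero [Fintype τ] (d : τ →₀ ℕ) : (factorial d : ℂ) ≠ 0 := by
  exact_mod_cast Finset.prod_ne_zero_iff.mpr fun s _ => (d s).factorial_ne_zero

lemma factorial_single_add [Fintype τ] (d : τ →₀ ℕ) (s : τ) :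
    factorial (Finsupp.single s 1 + d) = factorial d * (d s + 1) := by
  classical
  rw [factorial, factorial, ← Finset.mul_prod_erase _ _ (Finset.mem_univ s),
    ← Finset.mul_prod_erase Finset.univ (fun t => (d t).factorial) (Finset.mem_univ s)]
  have : ∏ t ∈ Finset.univ.erase s, ((Finsupp.single s 1 + d : τ →₀ ℕ) t).factorial =
      ∏ t ∈ Finset.univ.erase s, (d t).factorial := by
    refine Finset.prod_congr rfl fun t ht => ?_
    rw [Finsupp.add_apply, Finsupp.single_apply, if_neg (Finset.ne_of_mem_erase ht).symm, zero_add]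
  rw [this, Finsupp.add_apply, Finsupp.single_eq_same, add_comm 1, Nat.factorial_succ]
  ring

/-- Taylor's formula; the factorials are nonzero, so derivatives at the base point and coefficients
determine each other. -/
lemma constantCoeff_diffs [Fintype τ] (l : List τ) (F : MvPowerSeries τ ℂ) :
    constantCoeff (diffs l F) = factorial (multiIdx l) * coeff (multiIdx l) F := by
  induction l generalizing F with
  | nil => simp [diffs, multiIdx, factorial]
  | cons s l ih =>
    rw [diffs_cons, ← diffs_pderiv, ih, coeff_pderiv, multiIdx_cons, factorial_single_add,
      add_comm (multiIdx l)]
    push_cast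
    ring

end Diffs

/-! ### Dictionary between series at `ẽ_0` and families of components -/

section Tensors

variable {n : ℕ}

/-- The variables `η_{I_1}, …, η_{I_p}, conj η_{J_1}, …, conj η_{J_q}`. -/
def varList {p q : ℕ} (I : Fin p → Idx n) (J : Fin q → Idx n) : List (AVar n) :=
  List.ofFn (fun a => AVar.eta (I a)) ++ List.ofFn (fun b => AVar.etab (J b))

lemma weight_multiIdx_ofFn {τ : Type} (w : τ → ℕ) {p : ℕ} (f : Fin p → τ) :
    Finsupp.weight w (multiIdx (List.ofFn f)) = ∑ a, w (f a) := by
  rw [multiIdx, map_list_sum, List.map_map, List.map_ofFn, List.sum_ofFn]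
  simp [Finsupp.weight_single]

lemma weight_varList {p q : ℕ} (I : Fin p → Idx n) (J : Fin q → Idx n) :
    Finsupp.weight (wtA n) (multiIdx (varList I J)) = listWt I J := by
  rw [varList, multiIdx_append, map_add, weight_multiIdx_ofFn, weight_multiIdx_ofFn]
  rfl

/-- The derivatives of a series at `ẽ_0`. -/
noncomputable def jet {p q : ℕ} (F : ASeries n) (I : Fin p → Idx n) (J : Fin q → Idx n) : ℂ :=
  constantCoeff (diffs (varList I J) F)

lemma tensorOf_apply (F : ASeries n) (p q : ℕ) (I : Fin p → Idx n) (J : Fin q → Idx n) :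
    tensorOf F p q I J = if p = 0 ∨ q = 0 then 0 else jet F I J := rfl

lemma jet_eq_coeff {p q : ℕ} (F : ASeries n) (I : Fin p → Idx n) (J : Fin q → Idx n) :
    jet F I J = factorial (multiIdx (varList I J)) * coeff (multiIdx (varList I J)) F :=
  constantCoeff_diffs _ _

lemma jet_eq_zero_of_vanish {N p q : ℕ} {F : ASeries n} (hF : Vanish (wtA n) N F)
    (I : Fin p → Idx n) (J : Fin q → Idx n) (h : listWt I J < N) : jet F I J = 0 := by
  rw [jet_eq_coeff, hF _ (by rwa [weight_varList]), mul_zero]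

lemma jet_sub {p q : ℕ} (F H : ASeries n) (I : Fin p → Idx n) (J : Fin q → Idx n) :
    jet (F - H) I J = jet F I J - jet H I J := by
  rw [jet, diffs_sub, map_sub]; rfl

lemma exists_perm_varList (l : List (AVar n)) :
    ∃ (p q : ℕ) (I : Fin p → Idx n) (J : Fin q → Idx n), (varList I J).Perm l := by
  induction l with
  | nil => exact ⟨0, 0, Fin.elim0, Fin.elim0, by simp [varList]⟩
  | cons s l ih =>
    obtain ⟨p, q, I, J, h⟩ := ih
    rcases s with K | K
    · refine ⟨p + 1, q, Fin.cons K I, J, ?_⟩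
      simpa [varList, List.ofFn_succ] using h
    · refine ⟨p, q + 1, I, Fin.cons K J, ?_⟩
      simp only [varList, List.ofFn_succ, Fin.cons_zero, Fin.cons_succ] at h ⊢
      exact List.perm_middle.trans (h.cons _)

lemma exists_multiIdx_varList (d : AVar n →₀ ℕ) :
    ∃ (p q : ℕ) (I : Fin p → Idx n) (J : Fin q → Idx n), multiIdx (varList I J) = d := by
  obtain ⟨l, rfl⟩ := exists_multiIdx_eq d
  obtain ⟨p, q, I, J, h⟩ := exists_perm_varList l
  exact ⟨p, q, I, J, multiIdx_perm h⟩

/-- A series is determined by its derivatives. -/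
lemma eq_zero_of_jet {F : ASeries n}
    (h : ∀ (p q : ℕ) (I : Fin p → Idx n) (J : Fin q → Idx n), jet F I J = 0) : F = 0 := by
  ext d
  obtain ⟨p, q, I, J, rfl⟩ := exists_multiIdx_varList d
  have := h p q I J
  rw [jet_eq_coeff] at this
  exact (mul_eq_zero.mp this).resolve_left (factorial_ne_zero _)

lemma varList_comp_perm {p q : ℕ} (I : Fin p → Idx n) (J : Fin q → Idx n)
    (σ : Equiv.Perm (Fin p)) (τ : Equiv.Perm (Fin q)) :
    (varList (I ∘ σ) (J ∘ τ)).Perm (varList I J) :=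
  (σ.ofFn_comp_perm (fun a => AVar.eta (I a))).append
    (τ.ofFn_comp_perm (fun b => AVar.etab (J b)))

/-- Over each value the two functions have fibres of the same cardinality, and bijections between
the fibres glue to a permutation. -/
lemma exists_comp_eq_of_perm_ofFn {α : Type} [DecidableEq α] {p : ℕ} {f g : Fin p → α}
    (h : (List.ofFn f).Perm (List.ofFn g)) : ∃ σ : Equiv.Perm (Fin p), g ∘ σ = f := by
  have hcount : ∀ (f : Fin p → α) (c : α), Fintype.card {a // f a = c} = (List.ofFn f).count c := by
    intro f c
    rw [← Multiset.coe_count, ← Fin.univ_val_map, Multiset.count_map, Fintype.card_subtype]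
    simp only [eq_comm (a := c)]
    rfl
  have e : ∀ c, Nonempty ({a // f a = c} ≃ {a // g a = c}) := fun c =>
    Fintype.card_eq.mp (by rw [hcount, hcount, h.count_eq])
  exact ⟨Equiv.ofFiberEquiv fun c => (e c).some, funext fun a => Equiv.ofFiberEquiv_map _ a⟩

/-- The multi-index determines both index lists up to order, since they are recovered by filtering
the holomorphic and antiholomorphic variables; symmetry does the rest. Hence a Taylor coefficient
can be assigned to each multi-index. -/
lemma T0_apply_eq_of_multiIdx_eq {T : TFam n} (hT : T ∈ T0 n) {p q p' q' : ℕ} {I : Fin p → Idx n}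
    {J : Fin q → Idx n} {I' : Fin p' → Idx n} {J' : Fin q' → Idx n}
    (h : multiIdx (varList I J) = multiIdx (varList I' J')) : T p q I J = T p' q' I' J' := by
  have h1 := perm_of_multiIdx_eq h
  have hf : ∀ {p q : ℕ} (I : Fin p → Idx n) (J : Fin q → Idx n), (varList I J).filterMap
      (fun | .eta K => some K | .etab _ => none) = List.ofFn I := by
    intro p q I J
    have e1 : List.ofFn (fun a => AVar.eta (I a)) = (List.ofFn I).map AVar.eta := by
      rw [List.map_ofFn]; rfl
    have e2 : List.ofFn (fun a => AVar.etab (J a)) = (List.ofFn J).map AVar.etab := by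
      rw [List.map_ofFn]; rfl
    rw [varList, List.filterMap_append, e1, e2, List.filterMap_map, List.filterMap_map]
    have e3 : ((fun | .eta K => some K | .etab _ => none : AVar n → Option (Idx n)) ∘ AVar.eta) =
      some := rfl
    have e4 : ((fun | .eta K => some K | .etab _ => none : AVar n → Option (Idx n)) ∘ AVar.etab) =
      fun _ => none := rfl
    rw [e3, e4]
    simp
  have hg : ∀ {p q : ℕ} (I : Fin p → Idx n) (J : Fin q → Idx n), (varList I J).filterMap
      (fun | .eta _ => none | .etab K => some K) = List.ofFn J := by
    intro p q I J
    have e1 : List.ofFn (fun a => AVar.eta (I a)) = (List.ofFn I).map AVar.eta := by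
      rw [List.map_ofFn]; rfl
    have e2 : List.ofFn (fun a => AVar.etab (J a)) = (List.ofFn J).map AVar.etab := by
      rw [List.map_ofFn]; rfl
    rw [varList, List.filterMap_append, e1, e2, List.filterMap_map, List.filterMap_map]
    have e3 : ((fun | .eta _ => none | .etab K => some K : AVar n → Option (Idx n)) ∘ AVar.eta) =
      fun _ => none := rfl
    have e4 : ((fun | .eta _ => none | .etab K => some K : AVar n → Option (Idx n)) ∘ AVar.etab) =
      some := rfl
    rw [e3, e4]
    simp
  have hI := h1.filterMap (fun | .eta K => some K | .etab _ => none)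
  have hJ := h1.filterMap (fun | .eta _ => none | .etab K => some K)
  rw [hf, hf] at hI
  rw [hg, hg] at hJ
  obtain rfl : p = p' := by simpa using hI.length_eq
  obtain rfl : q = q' := by simpa using hJ.length_eq
  obtain ⟨σ, rfl⟩ := exists_comp_eq_of_perm_ofFn hI
  obtain ⟨τ, rfl⟩ := exists_comp_eq_of_perm_ofFn hJ
  exact hT.2 p q I' J' σ τ

/-- The formal power series with given derivatives at `ẽ_0`. -/
lemma exists_jet_eq {T : TFam n} (hT : T ∈ T0 n) :
    ∃ F : ASeries n, ∀ (p q : ℕ) (I : Fin p → Idx n) (J : Fin q → Idx n),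
      jet F I J = T p q I J := by
  choose p q I J h using exists_multiIdx_varList (n := n)
  let F : ASeries n := fun d => T (p d) (q d) (I d) (J d) / factorial d
  have hF : ∀ d, coeff d F = T (p d) (q d) (I d) (J d) / factorial d := fun d => rfl
  refine ⟨F, fun p' q' I' J' => ?_⟩
  rw [jet_eq_coeff, hF, mul_div_cancel₀ _ (factorial_ne_zero _)]
  exact T0_apply_eq_of_multiIdx_eq hT (h _)

lemma jet_snoc_left {p q : ℕ} (F : ASeries n) (I : Fin p → Idx n) (J : Fin q → Idx n) (K : Idx n) :
    jet F (Fin.snoc (α := fun _ => Idx n) I K) J = jet (pderiv ℂ (AVar.eta K) F) I J := by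
  have : (varList (Fin.snoc (α := fun _ => Idx n) I K) J).Perm (AVar.eta K :: varList I J) := by
    rw [varList, List.ofFn_succ']
    simp only [Fin.snoc_castSucc, Fin.snoc_last, List.concat_eq_append, List.append_assoc,
      List.singleton_append]
    exact List.perm_middle
  rw [jet, diffs_perm this, diffs_cons, ← diffs_pderiv]
  rfl

lemma jet_cons_right {p q : ℕ} (F : ASeries n) (I : Fin p → Idx n) (J : Fin q → Idx n)
    (K : Idx n) :
    jet F I (Fin.cons (α := fun _ => Idx n) K J) = jet (pderiv ℂ (AVar.etab K) F) I J := by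
  have : (varList I (Fin.cons (α := fun _ => Idx n) K J)).Perm (AVar.etab K :: varList I J) := by
    simp only [varList, List.ofFn_succ, Fin.cons_zero, Fin.cons_succ]
    exact List.perm_middle
  rw [jet, diffs_perm this, diffs_cons, ← diffs_pderiv]
  rfl

/-- The trace equation of 𝓗_0 says exactly that the derivatives of the Laplacian at ẽ_0 vanish. -/
lemma jet_lapA {p q : ℕ} (F : ASeries n) (I : Fin p → Idx n) (J : Fin q → Idx n) :
    jet (lapA F) I J = ∑ K, ∑ M, gUp n K M *
      jet F (Fin.snoc (α := fun _ => Idx n) I K) (Fin.cons (α := fun _ => Idx n) M J) := by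
  simp only [jet_snoc_left, jet_cons_right]
  simp only [jet, lapA, diffs_sum, diffs_C_mul, map_sum, map_mul, constantCoeff_C]

lemma constantCoeff_euler (F : ASeries n) :
    constantCoeff (euler F) = constantCoeff (pderiv ℂ (AVar.eta .zero) F) := by
  rw [euler, map_sum, Finset.sum_eq_single Idx.zero]
  · rw [map_mul, constantCoeff_xi_zero, one_mul]
  · intro I _ hI
    simp [xi, e0, hI]
  · simp

lemma diffs_etab_euler (l : List (Idx n)) (F : ASeries n) :
    diffs (l.map AVar.etab) (euler F) = euler (diffs (l.map AVar.etab) F) := by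
  induction l with
  | nil => rfl
  | cons K l ih => rw [List.map_cons, diffs_cons, ih, diffs_cons, pderiv_etab_euler]

lemma diffs_eta_euler (l : List (Idx n)) (F : ASeries n) :
    diffs (l.map AVar.eta) (euler F) =
      euler (diffs (l.map AVar.eta) F) + C (l.length : ℂ) * diffs (l.map AVar.eta) F := by
  induction l with
  | nil => simp [diffs]
  | cons K l ih =>
    rw [List.map_cons, diffs_cons, ih, diffs_cons, map_add, pderiv_eta_euler, Derivation.leibniz,
      pderiv_C, smul_zero, smul_eq_mul, List.length_cons]
    push_cast
    rw [map_add, map_one]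
    ring

/-- Each of the p holomorphic derivatives contributes one copy of itself when moved past the Euler
field, which reduces to ∂_0 at ẽ_0. Thus the equation for an index 0 is the homogeneity equation. -/
lemma jet_euler {p q : ℕ} (F : ASeries n) (I : Fin p → Idx n) (J : Fin q → Idx n) :
    jet (euler F) I J = jet F (Fin.snoc (α := fun _ => Idx n) I Idx.zero) J + p * jet F I J := by
  have e1 : List.ofFn (fun a => AVar.eta (I a)) = (List.ofFn I).map AVar.eta := by
    rw [List.map_ofFn]; rfl
  have e2 : List.ofFn (fun a => AVar.etab (J a)) = (List.ofFn J).map AVar.etab := by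
    rw [List.map_ofFn]; rfl
  rw [jet_snoc_left, jet, jet, jet, diffs_pderiv, varList, diffs_append, diffs_append, e1, e2,
    diffs_etab_euler, diffs_eta_euler, map_add, constantCoeff_euler, map_mul, constantCoeff_C,
    List.length_ofFn]

lemma jet_bar {p q : ℕ} (F : ASeries n) (I : Fin p → Idx n) (J : Fin q → Idx n) :
    jet (bar (AVar.conj n) F) I J = star (jet F J I) := by
  have : ((varList I J).map (AVar.conj n)).Perm (varList J I) := by
    rw [varList, List.map_append, List.map_ofFn, List.map_ofFn]
    exact List.perm_append_comm
  rw [jet, diffs_bar, constantCoeff_bar, diffs_perm this]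
  rfl

/-! ### The tensors of ambient extensions -/

/-- The family of derivatives, with the components whose weight is not in `s` set to zero. -/
noncomputable def cutTensor (s : Set ℕ) (F : ASeries n) : TFam n := fun p q I J =>
  s.indicator (fun _ => tensorOf F p q I J) (listWt I J)

lemma cutTensor_of_mem {s : Set ℕ} (F : ASeries n) {p q : ℕ} {I : Fin p → Idx n}
    {J : Fin q → Idx n} (h : listWt I J ∈ s) : cutTensor s F p q I J = tensorOf F p q I J :=
  Set.indicator_of_mem h _

lemma cutTensor_of_notMem {s : Set ℕ} (F : ASeries n) {p q : ℕ} {I : Fin p → Idx n}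
    {J : Fin q → Idx n} (h : listWt I J ∉ s) : cutTensor s F p q I J = 0 :=
  Set.indicator_of_notMem h _

lemma cutTensor_univ (F : ASeries n) : cutTensor Set.univ F = tensorOf F := by
  funext p q I J
  simp [cutTensor]

lemma listWt_comm {p q : ℕ} (I : Fin p → Idx n) (J : Fin q → Idx n) :
    listWt I J = listWt J I := add_comm _ _

lemma listWt_snoc {p q : ℕ} (I : Fin p → Idx n) (J : Fin q → Idx n) (K : Idx n) :
    listWt (Fin.snoc (α := fun _ => Idx n) I K) J = listWt I J + K.wt := by
  simp only [listWt, Fin.sum_univ_castSucc, Fin.snoc_castSucc, Fin.snoc_last]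
  ring

lemma listWt_cons {p q : ℕ} (I : Fin p → Idx n) (J : Fin q → Idx n) (K : Idx n) :
    listWt I (Fin.cons (α := fun _ => Idx n) K J) = listWt I J + K.wt := by
  simp only [listWt, Fin.sum_univ_succ, Fin.cons_zero, Fin.cons_succ]
  ring

/-- The equations respect weights: conjugation and the index 0 preserve the weight, and every
nonzero entry of g̃^{KL̄} adds exactly 2. So either all terms of an equation survive the cut or none
does, and harmonicity is needed only for the traces that survive. -/
lemma cutTensor_mem_H0 {s : Set ℕ} {F : ASeries n} (hr : bar (AVar.conj n) F = F)
    (hZ : euler F = 0) (hΔ : ∀ (p q : ℕ) (I : Fin p → Idx n) (J : Fin q → Idx n),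
      listWt I J + 2 ∈ s → jet (lapA F) I J = 0) : cutTensor s F ∈ H0 n := by
  refine ⟨⟨fun p q I J h => ?_, fun p q I J σ τ => ?_⟩, fun p q I J => ?_, fun p q I J => ?_,
    fun p q I J => ?_⟩
  · simp [cutTensor, tensorOf_apply, h]
  · have h1 : listWt (I ∘ σ) (J ∘ τ) = listWt I J := by
      simp only [listWt, Function.comp]
      rw [Equiv.sum_comp σ (fun a => (I a).wt), Equiv.sum_comp τ (fun a => (J a).wt)]
    have h2 : jet F (I ∘ σ) (J ∘ τ) = jet F I J := by
      rw [jet, diffs_perm (varList_comp_perm I J σ τ)]; rfl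
    simp only [cutTensor, h1, tensorOf_apply, h2]
  · have h1 : star (jet F I J) = jet F J I := by rw [← jet_bar, hr]
    simp only [cutTensor, listWt_comm J I, tensorOf_apply, or_comm (a := q = 0)]
    by_cases hs : listWt I J ∈ s
    · simp only [Set.indicator_of_mem hs]
      split_ifs <;> simp [← h1]
    · simp only [Set.indicator_of_notMem hs, star_zero]
  · by_cases hs : listWt I J + 2 ∈ s
    · rw [← hΔ p q I J hs, jet_lapA]
      refine Finset.sum_congr rfl fun K _ => Finset.sum_congr rfl fun M _ => ?_
      by_cases hg : gUp n K M = 0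
      · rw [hg, zero_mul, zero_mul]
      · rw [cutTensor_of_mem, tensorOf_apply, if_neg (by simp)]
        rwa [listWt_snoc, listWt_cons, add_assoc, add_comm M.wt, wt_add_wt_of_gUp_ne_zero hg]
    · refine Finset.sum_eq_zero fun K _ => Finset.sum_eq_zero fun M _ => ?_
      by_cases hg : gUp n K M = 0
      · rw [hg, zero_mul]
      · rw [cutTensor_of_notMem, mul_zero]
        rwa [listWt_snoc, listWt_cons, add_assoc, add_comm M.wt, wt_add_wt_of_gUp_ne_zero hg]
  · have h1 := jet_euler F I J
    have h2 : jet (euler F) I J = 0 := by rw [hZ, jet, diffs_zero, map_zero]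
    have h3 : jet F (Fin.snoc (α := fun _ => Idx n) I Idx.zero) J = -(p : ℂ) * jet F I J := by
      rw [h2] at h1
      linear_combination -h1
    simp only [cutTensor, listWt_snoc, Idx.wt, add_zero, tensorOf_apply, h3]
    -- For p = 0 the factor p makes the right side zero, so the convention that components with p =
    -- 0 vanish is consistent with the equation.
    rcases Nat.eq_zero_or_pos p with rfl | hp
    · simp
    · simp only [Nat.add_eq_zero_iff, one_ne_zero, and_false, false_or, hp.ne']
      by_cases hs : listWt I J ∈ s
      · simp only [Set.indicator_of_mem hs]
        split_ifs <;> simp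
      · simp only [Set.indicator_of_notMem hs, mul_zero]

lemma tensorOf_mem_H0 {F : ASeries n} (hr : bar (AVar.conj n) F = F) (hZ : euler F = 0)
    (hΔ : lapA F = 0) : tensorOf F ∈ H0 n := by
  rw [← cutTensor_univ]
  exact cutTensor_mem_H0 hr hZ fun p q I J _ => by rw [hΔ, jet, diffs_zero, map_zero]

/-- Every element of `𝓗_0` is the family of derivatives of a harmonic homogeneous jet. -/
lemma exists_tensorOf_eq {T : TFam n} (hT : T ∈ H0 n) : ∃ F : ASeries n,
    bar (AVar.conj n) F = F ∧ euler F = 0 ∧ eulerBar F = 0 ∧ lapA F = 0 ∧ tensorOf F = T := by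
  obtain ⟨h0, h1, h2, h3⟩ := hT
  obtain ⟨F, hF⟩ := exists_jet_eq h0
  have hr : bar (AVar.conj n) F = F := by
    rw [← sub_eq_zero]
    refine eq_zero_of_jet fun p q I J => ?_
    rw [jet_sub, jet_bar, hF, hF, h1, sub_self]
  have hZ : euler F = 0 := by
    refine eq_zero_of_jet fun p q I J => ?_
    rw [jet_euler, hF, hF, h3]
    ring
  refine ⟨F, hr, hZ, ?_, ?_, ?_⟩
  · rw [← hr, ← barA_euler, hZ, map_zero]
  · refine eq_zero_of_jet fun p q I J => ?_
    rw [jet_lapA, ← h2 p q I J]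
    simp only [hF]
  · funext p q I J
    rw [tensorOf_apply, hF]
    split_ifs with h
    · exact (h0.1 p q I J h).symm
    · rfl

lemma IsAmbientExtension.homog_zero {f : BSeries n} {F : ASeries n}
    (h : IsAmbientExtension f F) : Homog 0 F := homog_zero_iff.mpr ⟨h.homog, h.homogBar⟩

/-- The components of weight `< 2n` of the derivatives of an ambient extension. -/
lemma cutTensor_mem_H0_of_isAmbientExtension {f : BSeries n} {F : ASeries n}
    (h : IsAmbientExtension f F) : cutTensor (Set.Iio (2 * n)) F ∈ H0 n := by
  refine cutTensor_mem_H0 h.real h.homog fun p q I J hw => ?_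
  -- ΔF is a multiple of L^{n-1}, hence of weight at least 2n - 2, while the trace of components of
  -- weight w + 2 < 2n involves only derivatives of ΔF of weight w.
  refine jet_eq_zero_of_vanish (vanish_of_Lser_pow_dvd h.harmonic) I J ?_
  rw [Set.mem_Iio] at hw
  omega

lemma truncT_cutTensor (N : ℕ) (F : ASeries n) :
    truncT n N (cutTensor (Set.Iio N) F) = truncT n N (tensorOf F) := by
  funext x
  change cutTensor (Set.Iio N) F _ _ _ _ = tensorOf F _ _ _ _
  exact cutTensor_of_mem F x.2

lemma tensorOf_sub (F H : ASeries n) : tensorOf (F - H) = tensorOf F - tensorOf H := by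
  funext p q I J
  simp only [Pi.sub_apply, tensorOf_apply, jet_sub]
  split_ifs <;> simp

/-- Components with p, q ≥ 1 contain at least one mixed second derivative. -/
lemma tensorOf_eq_zero_of_pluriharmonic {F : ASeries n}
    (h : ∀ I J, pderiv ℂ (AVar.eta I) (pderiv ℂ (AVar.etab J) F) = 0) : tensorOf F = 0 := by
  funext p q I J
  rw [tensorOf_apply]
  split_ifs with hpq
  · rfl
  · obtain ⟨p, rfl⟩ := Nat.exists_eq_succ_of_ne_zero (not_or.mp hpq).1
    obtain ⟨q, rfl⟩ := Nat.exists_eq_succ_of_ne_zero (not_or.mp hpq).2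
    have hI : I = Fin.snoc (α := fun _ => Idx n) (fun a => I a.castSucc) (I (Fin.last p)) :=
      (Fin.snoc_init_self I).symm
    rw [hI, ← Fin.cons_self_tail J, jet_snoc_left, jet_cons_right, pderiv_comm, h, jet, diffs_zero]
    rfl

/-- The real part of a holomorphic ambient jet. -/
noncomputable def realPart (Q : ASeries n) : ASeries n :=
  C (1 / 2) * (Q + bar (AVar.conj n) Q)

lemma homog_realPart {Q : ASeries n} (hQ : Homog 0 Q) : Homog 0 (realPart Q) :=
  (hQ.add (homog_bar hQ)).C_mul _

lemma pluriharmonic_realPart {Q : ASeries n} (hQ : ∀ J, pderiv ℂ (AVar.etab J) Q = 0)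
    (I J : Idx n) : pderiv ℂ (AVar.eta I) (pderiv ℂ (AVar.etab J) (realPart Q)) = 0 := by
  have h1 : pderiv ℂ (AVar.eta I) (bar (AVar.conj n) Q) = 0 := by
    rw [← barA_pderiv_etab, hQ, map_zero]
  simp only [realPart, Derivation.leibniz, pderiv_C, map_add, hQ, smul_eq_mul, mul_zero, add_zero,
    zero_add]
  rw [pderiv_comm, h1, map_zero, mul_zero]

lemma lapA_realPart {Q : ASeries n} (hQ : ∀ J, pderiv ℂ (AVar.etab J) Q = 0) :
    lapA (realPart Q) = 0 := by
  simp [lapA, pluriharmonic_realPart hQ]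

lemma half_smul (F : BSeries n) : (1 / 2 : ℝ) • F = C (1 / 2) * F := by
  ext d
  rw [coeff_C_mul]
  change (1 / 2 : ℝ) • coeff d F = _
  rw [Complex.real_smul]; norm_num

lemma coneRestrict_realPart (Q : ASeries n) : coneRestrict (realPart Q) =
    (1 / 2 : ℝ) • (coneRestrict Q + bar (BVar.conj n) (coneRestrict Q)) := by
  rw [realPart, coneRestrict_mul, coneRestrict_C, coneRestrict_add, coneRestrict_bar, half_smul]

/-- The components of weight `< 2n` depend only on the jet modulo pluriharmonic jets. -/
lemma truncT_tensorOf_eq (hn : 1 ≤ n) {f g : BSeries n} {F H : ASeries n}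
    (hF : IsAmbientExtension f F) (hH : IsAmbientExtension g H) (hfg : f - g ∈ JP n) :
    truncT n (2 * n) (tensorOf F) = truncT n (2 * n) (tensorOf H) := by
  obtain ⟨Q, hQ1, hQ2, hQ3⟩ := exists_holomorphic_of_mem_JP hfg
  -- The extension of a pluriharmonic jet may be taken pluriharmonic, and the remaining difference
  -- restricts to zero on the cone, so uniqueness applies to it.
  have hdvd : Lser n ^ n ∣ F - H - realPart Q := by
    refine Lser_pow_dvd_of_coneRestrict_eq_zero hn
      ((hF.homog_zero.sub hH.homog_zero).sub (homog_realPart hQ1)) ?_ ?_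
    · rw [coneRestrict_sub, coneRestrict_sub, hF.restrict, hH.restrict, coneRestrict_realPart,
        ← hQ3, sub_self]
    · rw [lapA_sub, lapA_sub, lapA_realPart hQ2, sub_zero]
      exact dvd_sub hF.harmonic hH.harmonic
  have hv := vanish_of_Lser_pow_dvd hdvd
  rw [← sub_eq_zero, ← map_sub, ← tensorOf_sub, ← sub_zero (tensorOf (F - H)),
    ← tensorOf_eq_zero_of_pluriharmonic (pluriharmonic_realPart hQ2), ← tensorOf_sub]
  funext x
  change tensorOf _ _ _ _ _ = 0
  rw [tensorOf_apply]
  split_ifs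
  · rfl
  · exact jet_eq_zero_of_vanish hv _ _ (by have := x.2; omega)

/-! ### Series whose mixed derivatives of low weight vanish -/

lemma vanish_conePt (I : Idx n) : Vanish (wtB n) I.wt (conePt n I) := by
  rcases I with _ | j | _
  · exact vanish_zero_order _ _
  · exact vanish_X (wtB n) (.w j)
  · refine Vanish.add (Vanish.mul_left (vanish_sum _ fun j _ => ?_) _)
      (Vanish.mul_left (vanish_X (wtB n) .v) _)
    exact Vanish.mul (N := 1) (M := 1) (vanish_X (wtB n) (.w j)) (vanish_X (wtB n) (.wb j))

lemma vanish_coneSub (s : AVar n) : Vanish (wtB n) (wtA n s) (coneSub n s) := by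
  have h : ∀ I : Idx n, Vanish (wtB n) I.wt (conePt n I - C (e0 n I)) := by
    intro I
    rcases I with _ | j | _
    · exact vanish_zero_order _ _
    · simpa [e0] using vanish_conePt (.mid j)
    · simpa [e0] using vanish_conePt (n := n) .last
  rcases s with I | I
  · exact h I
  · exact (h I).bar wtB_conj

/-- The part of an ambient jet that does not involve the variables `conj η_I`. -/
noncomputable def holomorphicPart (F : ASeries n) : ASeries n := kill (Set.range AVar.etab) F

lemma coeff_kill_of_ne {τ : Type} {S : Set τ} {d : τ →₀ ℕ} {s : τ} (hs : s ∈ S) (hd : d s ≠ 0)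
    (F : MvPowerSeries τ ℂ) : coeff d (kill S F) = 0 := by
  rw [kill, coeff_rescale, Finsupp.prod,
    Finset.prod_eq_zero (Finsupp.mem_support_iff.mpr hd), zero_mul]
  simp [hs, hd]

lemma pderiv_holomorphicPart (F : ASeries n) (J : Idx n) :
    pderiv ℂ (AVar.etab J) (holomorphicPart F) = 0 := by
  ext d
  rw [coeff_pderiv, holomorphicPart, coeff_kill_of_ne (s := AVar.etab J) (by simp) (by simp),
    zero_mul, map_zero]

/-- If the components of weight `< N` of the derivatives of `F` vanish, then `F` is pluriharmonic up
to terms of weight at least `N`. -/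
lemma vanish_sub_realPart {N : ℕ} {F : ASeries n} (hr : bar (AVar.conj n) F = F)
    (h : truncT n N (tensorOf F) = 0) :
    Vanish (wtA n) N (F - realPart (C 2 * holomorphicPart F - C (constantCoeff F))) := by
  have hc : star (constantCoeff F) = constantCoeff F := by rw [← constantCoeff_bar, hr]
  -- Twice the real part of the holomorphic terms counts the constant term twice; this is what
  -- subtracting the constant compensates.
  have e1 : F - realPart (C 2 * holomorphicPart F - C (constantCoeff F)) = F - holomorphicPart F -
      bar (AVar.conj n) (holomorphicPart F) + C (constantCoeff F) := by
    have h2 : (C (1 / 2) * C 2 : ASeries n) = 1 := by rw [← map_mul]; norm_num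
    have h3 : (C (1 / 2) + C (1 / 2) : ASeries n) = 1 := by rw [← map_add]; norm_num
    rw [realPart, map_sub, bar_mul, bar_C, bar_C, hc]
    have : star (2 : ℂ) = 2 := by simp
    rw [this]
    linear_combination (-(holomorphicPart F + bar (AVar.conj n) (holomorphicPart F))) * h2 +
      C (constantCoeff F) * h3
  rw [e1]
  intro d hd
  have hconj : ∀ s, d.mapDomain (AVar.conj n) s = d (AVar.conj n s) := fun s => by
    conv_lhs => rw [← AVar.conj_conj s]
    exact Finsupp.mapDomain_apply (AVar.conj n).injective _ _
  rw [map_add, map_sub, map_sub, coeff_bar]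
  by_cases hb : ∀ s ∈ Set.range AVar.etab, d s = 0
  · rw [holomorphicPart, coeff_kill hb, sub_self, zero_sub]
    by_cases hd0 : d = 0
    · subst hd0
      rw [Finsupp.mapDomain_zero, coeff_kill hb]
      simp only [coeff_zero_eq_constantCoeff_apply, constantCoeff_C, hc, neg_add_cancel]
    · obtain ⟨s, hs⟩ := Finsupp.ne_iff.mp hd0
      rcases s with I | I
      · rw [coeff_kill_of_ne (s := AVar.etab I) (by simp) (by rw [hconj]; exact hs)]
        classical
        rw [coeff_C, if_neg hd0]; simp
      · exact absurd (hb _ ⟨I, rfl⟩) hs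
  · push Not at hb
    obtain ⟨_, ⟨J, rfl⟩, hJ⟩ := hb
    have hd0 : d ≠ 0 := by rintro rfl; simp at hJ
    classical
    rw [holomorphicPart, coeff_kill_of_ne (by simp) hJ, coeff_C, if_neg hd0, sub_zero, add_zero]
    by_cases ha : ∀ s ∈ Set.range AVar.etab, d.mapDomain (AVar.conj n) s = 0
    · rw [coeff_kill ha, ← coeff_bar, hr, sub_self]
    · push Not at ha
      obtain ⟨_, ⟨I, rfl⟩, hI⟩ := ha
      rw [coeff_kill_of_ne (by simp) hI, star_zero, sub_zero]
      rw [hconj] at hI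
      -- The remaining monomials contain variables of both kinds, so their coefficients are
      -- multiples of components with p, q ≥ 1.
      obtain ⟨p, q, A, B, rfl⟩ := exists_multiIdx_varList d
      rw [weight_varList] at hd
      have h1 := congrFun h ⟨⟨p, q, A, B⟩, hd⟩
      change tensorOf F p q A B = 0 at h1
      rw [tensorOf_apply, if_neg, jet_eq_coeff] at h1
      · exact (mul_eq_zero.mp h1).resolve_left (factorial_ne_zero _)
      · rw [multiIdx_apply] at hI hJ
        rintro (rfl | rfl)
        · exact hI (List.count_eq_zero.mpr (by simp [varList, AVar.conj]))
        · exact hJ (List.count_eq_zero.mpr (by simp [varList]))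

/-- If the components of weight `< N` of an ambient extension of an element of the slice vanish,
then so do the coefficients of weight `< N`. -/
lemma truncB_eq_zero {N : ℕ} {g : BSeries n} {F : ASeries n} (hg : g ∈ N0 n)
    (hF : IsAmbientExtension g F) (h : truncT n N (tensorOf F) = 0) : truncB n N g = 0 := by
  have hv := vanish_sub_realPart hF.real h
  have hv' := hv.subst hasSubst_coneSub vanish_coneSub
  change Vanish (wtB n) N (coneRestrict _) at hv'
  rw [coneRestrict_sub, hF.restrict, coneRestrict_realPart] at hv'
  have hQ : ∀ J, pderiv ℂ (AVar.etab J)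
      (C 2 * holomorphicPart F - C (constantCoeff F)) = 0 := fun J => by
    rw [map_sub, Derivation.leibniz, pderiv_holomorphicPart, pderiv_C, pderiv_C]
    simp
  have := vanish_of_mem_N0_of_sub_mem_JP hg (mem_JP_of_holomorphic hQ) hv'
  funext d
  exact this d.1 (by rw [weight_wtB]; exact d.2)

end Tensors

section Group

variable {n : ℕ}

/-! ### Elements of the parabolic subgroup -/

lemma P.mat_mul (h k : P n) : P.mat (h * k) = P.mat h * P.mat k := rfl

lemma P.mat_one : P.mat (1 : P n) = 1 := rfl

lemma P.mat_form (h : P n) : (P.mat h).conjTranspose * gLow n * P.mat h = gLow n := h.2.1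

lemma P.mat_zero (h : P n) (I : Idx n) : P.mat h I .zero = P.eig h * e0 n I := by
  obtain ⟨c, hc⟩ := h.2.2
  have h1 : ∀ I, P.mat h I .zero = c * e0 n I := fun I => by
    have := congrFun hc I
    rwa [e0, Matrix.mulVec_single_one] at this
  rw [h1, P.eig, h1]
  simp [e0]

lemma P.eig_mul (h k : P n) : P.eig (h * k) = P.eig h * P.eig k := by
  rw [P.eig, P.mat_mul, Matrix.mul_apply]
  simp only [P.mat_zero k]
  rw [Finset.sum_eq_single Idx.zero]
  · simp [e0, P.eig]
  · intro I _ hI; simp [e0, hI]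
  · simp

lemma P.eig_one : P.eig (1 : P n) = 1 := by rw [P.eig, P.mat_one, Matrix.one_apply_eq]

lemma P.eig_mul_inv (h : P n) : P.eig h * P.eig h⁻¹ = 1 := by
  rw [← P.eig_mul, mul_inv_cancel, P.eig_one]

lemma P.eig_ne_zero (h : P n) : P.eig h ≠ 0 := left_ne_zero_of_mul_eq_one (P.eig_mul_inv h)

lemma P.mat_form_inv (h : P n) : P.mat h * gUp n * (P.mat h).conjTranspose = gUp n := by
  have h1 : (gUp n * (P.mat h).conjTranspose * gLow n) * P.mat h = 1 := by
    rw [Matrix.mul_assoc, Matrix.mul_assoc, ← Matrix.mul_assoc _ (gLow n), P.mat_form,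
      gUp_mul_gLow]
  have h2 := mul_eq_one_comm.mp h1
  calc P.mat h * gUp n * (P.mat h).conjTranspose
      = P.mat h * (gUp n * (P.mat h).conjTranspose * gLow n) * gUp n := by
        simp only [Matrix.mul_assoc, gLow_mul_gUp, Matrix.mul_one]
    _ = gUp n := by rw [h2, Matrix.one_mul]

/-- `h` preserves the line of ẽ_0, hence also its orthogonal complement, where the last coordinate
vanishes. In matrix form this is the entry (0, j) of the invariance of the form. -/
lemma P.mat_last_mid (h : P n) (j : Fin (n - 1)) : P.mat h .last (.mid j) = 0 := by
  have h1 := congrFun (congrFun (P.mat_form h) .zero) (.mid j)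
  rw [Matrix.mul_assoc, Matrix.mul_apply, Finset.sum_eq_single Idx.zero] at h1
  · rw [Matrix.conjTranspose_apply, ← P.eig, Matrix.mul_apply, Idx.sum_eq] at h1
    simpa [gLow, P.eig_ne_zero] using h1
  · intro I _ hI
    rw [Matrix.conjTranspose_apply, P.mat_zero]
    simp [e0, hI]
  · simp

/-- The elements of `P` are triangular with respect to the weights. -/
lemma P.wt_le_of_mat_ne_zero (h : P n) {K I : Idx n} (hK : P.mat h K I ≠ 0) : K.wt ≤ I.wt := by
  rcases I with _ | j | _
  · rw [P.mat_zero] at hK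
    have : K = .zero := by
      by_contra hne
      simp [e0, hne] at hK
    rw [this]
  · rcases K with _ | i | _
    · simp [Idx.wt]
    · simp [Idx.wt]
    · exact absurd (P.mat_last_mid h j) hK
  · cases K <;> simp [Idx.wt]

/-! ### Linear changes of ambient coordinates -/

/-- `A` fixes `ẽ_0` and is conformal for the hermitian form. -/
structure IsConformal (A : Matrix (Idx n) (Idx n) ℂ) (μ : ℂ) : Prop where
  fix : ∀ I, A I .zero = e0 n I
  low : ∀ K M, ∑ I, ∑ J, A I K * gLow n I J * star (A J M) = μ * gLow n K M
  up : ∀ K M, ∑ I, ∑ J, A K I * gUp n I J * star (A M J) = μ * gUp n K M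

/-- The matrix `λ h⁻¹`, where `h ẽ_0 = λ ẽ_0`. -/
noncomputable def ambMat (h : P n) : Matrix (Idx n) (Idx n) ℂ := P.eig h • P.mat h⁻¹

lemma ambMat_apply (h : P n) (I J : Idx n) : ambMat h I J = P.eig h * P.mat h⁻¹ I J := rfl

/-- The factor λ makes h⁻¹ fix ẽ_0, so that substitution at the base point is possible, and costs
only the factor |λ|² in the form. It does not affect functions of degree (0, 0). -/
lemma ambMat_isConformal (h : P n) :
    IsConformal (ambMat h) (P.eig h * star (P.eig h)) where
  fix I := by rw [ambMat_apply, P.mat_zero, ← mul_assoc, P.eig_mul_inv, one_mul]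
  low K M := by
    have h1 := congrFun (congrFun (P.mat_form h⁻¹) M) K
    rw [gLow_symm K M, ← h1, Matrix.mul_apply, Finset.mul_sum]
    refine Finset.sum_congr rfl fun I _ => ?_
    rw [Matrix.mul_apply, Finset.sum_mul, Finset.mul_sum]
    refine Finset.sum_congr rfl fun J _ => ?_
    rw [Matrix.conjTranspose_apply, ambMat_apply, ambMat_apply, star_mul', gLow_symm I J]
    ring
  up K M := by
    have h1 := congrFun (congrFun (P.mat_form_inv h⁻¹) K) M
    rw [← h1, Matrix.mul_apply, Finset.mul_sum, Finset.sum_comm]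
    refine Finset.sum_congr rfl fun J _ => ?_
    rw [Matrix.mul_apply, Finset.sum_mul, Finset.mul_sum]
    refine Finset.sum_congr rfl fun I _ => ?_
    rw [Matrix.conjTranspose_apply, ambMat_apply, ambMat_apply, star_mul']
    ring

/-- The order is reversed because the inverse reverses products; pullback reverses them again, which
leaves a left action. -/
lemma ambMat_mul (h k : P n) : ambMat (h * k) = ambMat k * ambMat h := by
  rw [ambMat, ambMat, ambMat, mul_inv_rev, P.mat_mul, P.eig_mul, Matrix.smul_mul, Matrix.mul_smul,
    smul_smul, mul_comm (P.eig h)]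

lemma ambMat_one : ambMat (1 : P n) = 1 := by
  rw [ambMat, P.eig_one, inv_one, P.mat_one, one_smul]

/-- The linear substitution `ξ ↦ A ξ`. -/
noncomputable def linSub (A : Matrix (Idx n) (Idx n) ℂ) : AVar n → ASeries n
  | .eta I => ∑ K, C (A I K) * xi K - C (e0 n I)
  | .etab I => ∑ K, C (star (A I K)) * xib K - C (e0 n I)

/-- The composition of an ambient jet with the linear map `A`. -/
noncomputable def pull (A : Matrix (Idx n) (Idx n) ℂ) (F : ASeries n) : ASeries n :=
  subst (linSub A) F

variable {A : Matrix (Idx n) (Idx n) ℂ}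

lemma constantCoeff_linSub (hA : ∀ I, A I .zero = e0 n I) (s : AVar n) :
    constantCoeff (linSub A s) = 0 := by
  rcases s with I | I
  · rw [linSub, map_sub, map_sum, Finset.sum_eq_single Idx.zero]
    · simp [hA, constantCoeff_xi_zero]
    · intro K _ hK; simp [xi, e0, hK]
    · simp
  · rw [linSub, map_sub, map_sum, Finset.sum_eq_single Idx.zero]
    · rw [hA, star_e0]; simp [constantCoeff_xib_zero]
    · intro K _ hK; simp [xib, e0, hK]
    · simp

lemma hasSubst_linSub (hA : ∀ I, A I .zero = e0 n I) : HasSubst (linSub A) :=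
  hasSubst_of_constantCoeff_zero (constantCoeff_linSub hA)

lemma bar_linSub (s : AVar n) : bar (AVar.conj n) (linSub A (AVar.conj n s)) = linSub A s := by
  rcases s with I | I
  · change bar (AVar.conj n) (linSub A (.etab I)) = _
    simp only [linSub, map_sub, bar_sum, bar_mul, bar_C, barA_xib, star_star, star_e0]
  · change bar (AVar.conj n) (linSub A (.eta I)) = _
    simp only [linSub, map_sub, bar_sum, bar_mul, bar_C, barA_xi, star_e0]

lemma bar_pull (hA : ∀ I, A I .zero = e0 n I) (F : ASeries n) :
    bar (AVar.conj n) (pull A F) = pull A (bar (AVar.conj n) F) := by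
  rw [pull, pull, bar_subst _ (AVar.conj n) (constantCoeff_linSub hA)]
  congr 1
  funext s
  exact bar_linSub s

lemma pull_mul (hA : ∀ I, A I .zero = e0 n I) (F H : ASeries n) :
    pull A (F * H) = pull A F * pull A H := subst_mul (hasSubst_linSub hA) _ _

lemma pull_add (hA : ∀ I, A I .zero = e0 n I) (F H : ASeries n) :
    pull A (F + H) = pull A F + pull A H := subst_add (hasSubst_linSub hA) _ _

lemma pull_sub (hA : ∀ I, A I .zero = e0 n I) (F H : ASeries n) :
    pull A (F - H) = pull A F - pull A H := subst_map_sub (hasSubst_linSub hA) _ _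

lemma pull_C (hA : ∀ I, A I .zero = e0 n I) (c : ℂ) : pull A (C c) = C c :=
  subst_const (hasSubst_linSub hA) c

lemma pull_zero (hA : ∀ I, A I .zero = e0 n I) : pull A (0 : ASeries n) = 0 :=
  subst_zero_right (hasSubst_linSub hA)

lemma pull_sum (hA : ∀ I, A I .zero = e0 n I) {ι : Type*} (t : Finset ι) (F : ι → ASeries n) :
    pull A (∑ i ∈ t, F i) = ∑ i ∈ t, pull A (F i) := subst_sum (hasSubst_linSub hA) _ _

lemma pull_pow (hA : ∀ I, A I .zero = e0 n I) (F : ASeries n) (k : ℕ) :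
    pull A (F ^ k) = pull A F ^ k := subst_pow (hasSubst_linSub hA) _ _

lemma pull_xi (hA : ∀ I, A I .zero = e0 n I) (I : Idx n) :
    pull A (xi I) = ∑ K, C (A I K) * xi K := by
  rw [xi, pull_add hA, pull_C hA, pull, subst_X (hasSubst_linSub hA), linSub]
  ring

lemma pull_xib (hA : ∀ I, A I .zero = e0 n I) (I : Idx n) :
    pull A (xib I) = ∑ K, C (star (A I K)) * xib K := by
  rw [xib, pull_add hA, pull_C hA, pull, subst_X (hasSubst_linSub hA), linSub]
  ring

lemma pderiv_eta_pull (hA : ∀ I, A I .zero = e0 n I) (F : ASeries n) (I : Idx n) :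
    pderiv ℂ (AVar.eta I) (pull A F) = ∑ K, C (A K I) * pull A (pderiv ℂ (AVar.eta K) F) := by
  rw [pull, pderiv_subst (constantCoeff_linSub hA), AVar.sum_eq]
  have h1 : ∀ K, pderiv ℂ (AVar.eta I) (linSub A (.eta K)) = C (A K I) := fun K => by
    simp [linSub, Derivation.leibniz, pderiv_eta_xi]
  have h2 : ∀ K, pderiv ℂ (AVar.eta I) (linSub A (.etab K)) = 0 := fun K => by
    simp [linSub, Derivation.leibniz, pderiv_eta_xib]
  simp only [h1, h2, mul_zero, Finset.sum_const_zero, add_zero]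
  exact Finset.sum_congr rfl fun K _ => mul_comm _ _

lemma pderiv_etab_pull (hA : ∀ I, A I .zero = e0 n I) (F : ASeries n) (I : Idx n) :
    pderiv ℂ (AVar.etab I) (pull A F) =
      ∑ K, C (star (A K I)) * pull A (pderiv ℂ (AVar.etab K) F) := by
  rw [pull, pderiv_subst (constantCoeff_linSub hA), AVar.sum_eq]
  have h1 : ∀ K, pderiv ℂ (AVar.etab I) (linSub A (.etab K)) = C (star (A K I)) := fun K => by
    simp [linSub, Derivation.leibniz, pderiv_etab_xib]
  have h2 : ∀ K, pderiv ℂ (AVar.etab I) (linSub A (.eta K)) = 0 := fun K => by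
    simp [linSub, Derivation.leibniz, pderiv_etab_xi]
  simp only [h1, h2, mul_zero, Finset.sum_const_zero, zero_add]
  exact Finset.sum_congr rfl fun K _ => mul_comm _ _

lemma euler_pull (hA : ∀ I, A I .zero = e0 n I) (F : ASeries n) :
    euler (pull A F) = pull A (euler F) := by
  simp only [euler, pderiv_eta_pull hA, pull_sum hA, pull_mul hA, pull_xi hA, Finset.mul_sum,
    Finset.sum_mul]
  rw [Finset.sum_comm]
  exact Finset.sum_congr rfl fun I _ => Finset.sum_congr rfl fun J _ => by ring

lemma eulerBar_pull (hA : ∀ I, A I .zero = e0 n I) (F : ASeries n) :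
    eulerBar (pull A F) = pull A (eulerBar F) := by
  simp only [eulerBar, pderiv_etab_pull hA, pull_sum hA, pull_mul hA, pull_xib hA, Finset.mul_sum,
    Finset.sum_mul]
  rw [Finset.sum_comm]
  exact Finset.sum_congr rfl fun I _ => Finset.sum_congr rfl fun J _ => by ring

lemma sum_comm_pairs {M : Type*} [AddCommMonoid M] (f : Idx n → Idx n → Idx n → Idx n → M) :
    ∑ I, ∑ J, ∑ K, ∑ L, f I J K L = ∑ K, ∑ L, ∑ I, ∑ J, f I J K L := by
  have h (g : Idx n → Idx n → Idx n → M) :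
      ∑ J, ∑ K, ∑ L, g J K L = ∑ K, ∑ L, ∑ J, g J K L := by
    rw [Finset.sum_comm]
    exact Finset.sum_congr rfl fun K _ => Finset.sum_comm
  calc ∑ I, ∑ J, ∑ K, ∑ L, f I J K L = ∑ I, ∑ K, ∑ L, ∑ J, f I J K L :=
        Finset.sum_congr rfl fun I _ => h (f I)
    _ = ∑ K, ∑ L, ∑ I, ∑ J, f I J K L := h fun I K L => ∑ J, f I J K L

lemma lapA_pull {μ : ℂ} (hA : IsConformal A μ) (F : ASeries n) :
    lapA (pull A F) = C μ * pull A (lapA F) := by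
  have h1 : ∀ I J, C (gUp n I J) *
      pderiv ℂ (AVar.eta I) (pderiv ℂ (AVar.etab J) (pull A F)) =
      ∑ K, ∑ M, C (A K I * gUp n I J * star (A M J)) *
        pull A (pderiv ℂ (AVar.eta K) (pderiv ℂ (AVar.etab M) F)) := by
    intro I J
    rw [pderiv_etab_pull hA.fix, map_sum, Finset.mul_sum, Finset.sum_comm]
    refine Finset.sum_congr rfl fun M _ => ?_
    rw [Derivation.leibniz, pderiv_C, smul_zero, add_zero, smul_eq_mul, pderiv_eta_pull hA.fix,
      Finset.mul_sum, Finset.mul_sum]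
    refine Finset.sum_congr rfl fun K _ => ?_
    rw [map_mul, map_mul]
    ring
  simp only [lapA, h1]
  rw [sum_comm_pairs, pull_sum hA.fix, Finset.mul_sum]
  refine Finset.sum_congr rfl fun K _ => ?_
  rw [pull_sum hA.fix, Finset.mul_sum]
  refine Finset.sum_congr rfl fun M _ => ?_
  simp only [← Finset.sum_mul, ← map_sum]
  rw [hA.up, pull_mul hA.fix, pull_C hA.fix, map_mul, mul_assoc]

lemma pull_Lser {μ : ℂ} (hA : IsConformal A μ) : pull A (Lser n) = C μ * Lser n := by
  have h1 : ∀ I J, pull A (C (gLow n I J) * (xi I * xib J)) =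
      ∑ K, ∑ M, C (A I K * gLow n I J * star (A J M)) * (xi K * xib M) := by
    intro I J
    rw [pull_mul hA.fix, pull_mul hA.fix, pull_C hA.fix, pull_xi hA.fix, pull_xib hA.fix,
      Finset.sum_mul_sum, Finset.mul_sum]
    refine Finset.sum_congr rfl fun K _ => ?_
    rw [Finset.mul_sum]
    refine Finset.sum_congr rfl fun M _ => ?_
    rw [map_mul, map_mul]
    ring
  rw [Lser, pull_sum hA.fix]
  simp only [pull_sum hA.fix, h1]
  rw [sum_comm_pairs, Finset.mul_sum]
  refine Finset.sum_congr rfl fun K _ => ?_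
  rw [Finset.mul_sum]
  refine Finset.sum_congr rfl fun M _ => ?_
  simp only [← Finset.sum_mul, ← map_sum]
  rw [hA.low, map_mul, mul_assoc]

lemma pull_pull {B : Matrix (Idx n) (Idx n) ℂ} (hA : ∀ I, A I .zero = e0 n I)
    (hB : ∀ I, B I .zero = e0 n I) (F : ASeries n) :
    pull A (pull B F) = pull (B * A) F := by
  rw [pull, pull, pull, subst_comp_subst_apply (hasSubst_linSub hB) (hasSubst_linSub hA)]
  congr 1
  funext s
  change pull A (linSub B s) = _
  rcases s with I | I
  · simp only [linSub, pull_sub hA, pull_sum hA, pull_mul hA, pull_C hA, pull_xi hA,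
      Matrix.mul_apply, map_sum, map_mul, Finset.mul_sum, Finset.sum_mul]
    rw [Finset.sum_comm]
    simp only [mul_assoc]
  · simp only [linSub, pull_sub hA, pull_sum hA, pull_mul hA, pull_C hA, pull_xib hA,
      Matrix.mul_apply, map_sum, map_mul, Finset.mul_sum, Finset.sum_mul, star_sum, star_mul']
    rw [Finset.sum_comm]
    simp only [mul_assoc]

lemma pull_one (F : ASeries n) : pull 1 F = F := by
  have : linSub (1 : Matrix (Idx n) (Idx n) ℂ) = X := by
    funext s
    rcases s with I | I
    · simp [linSub, Matrix.one_apply, apply_ite, ite_mul, xi]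
    · simp [linSub, Matrix.one_apply, apply_ite, ite_mul, xib]
  rw [pull, this, subst_self]
  rfl

/-! ### Compatibility with the tensors -/

/-- Iterates the chain rule for a linear substitution; the coefficients are constants, so no further
terms arise. Stated abstractly to cover both kinds of variables. -/
lemma diffs_ofFn_subst {τ ι : Type} [Fintype ι] (S : MvPowerSeries τ ℂ → MvPowerSeries τ ℂ)
    (v : ι → τ) (c : ι → ι → ℂ)
    (h : ∀ F i, pderiv ℂ (v i) (S F) = ∑ k, C (c k i) * S (pderiv ℂ (v k) F)) {p : ℕ}
    (I : Fin p → ι) (F : MvPowerSeries τ ℂ) :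
    diffs (List.ofFn (fun a => v (I a))) (S F) = ∑ K : Fin p → ι, C (∏ a, c (K a) (I a)) *
      S (diffs (List.ofFn (fun a => v (K a))) F) := by
  induction p generalizing F with
  | zero => simp [diffs]
  | succ p ih =>
    rw [List.ofFn_succ, diffs_cons, ih, map_sum, ← (Fin.consEquiv fun _ => ι).sum_comp,
      Fintype.sum_prod_type, Finset.sum_comm]
    refine Finset.sum_congr rfl fun K _ => ?_
    rw [Derivation.leibniz, pderiv_C, smul_zero, add_zero, smul_eq_mul, h, Finset.mul_sum]
    refine Finset.sum_congr rfl fun k _ => ?_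
    simp only [Fin.consEquiv_apply, Fin.prod_univ_succ, Fin.cons_zero, Fin.cons_succ,
      List.ofFn_succ, diffs_cons, map_mul]
    ring

lemma jet_pull (hA : ∀ I, A I .zero = e0 n I) (F : ASeries n) {p q : ℕ} (I : Fin p → Idx n)
    (J : Fin q → Idx n) : jet (pull A F) I J = ∑ K : Fin p → Idx n, ∑ M : Fin q → Idx n,
      (∏ a, A (K a) (I a)) * (∏ b, star (A (M b) (J b))) * jet F K M := by
  have hc : ∀ H : ASeries n, constantCoeff (pull A H) = constantCoeff H :=
    constantCoeff_subst_of_zero (constantCoeff_linSub hA)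
  have e1 := diffs_ofFn_subst (pull A) AVar.etab (fun k i => star (A k i)) (pderiv_etab_pull hA) J F
  have e2 := fun F => diffs_ofFn_subst (pull A) AVar.eta A (pderiv_eta_pull hA) I F
  rw [jet, varList, diffs_append, e1, diffs_sum, map_sum, Finset.sum_comm]
  refine Finset.sum_congr rfl fun M _ => ?_
  rw [diffs_C_mul, e2, map_mul, constantCoeff_C, map_sum, Finset.mul_sum]
  refine Finset.sum_congr rfl fun K _ => ?_
  rw [map_mul, constantCoeff_C, hc, jet, varList, diffs_append]
  ring

/-- The factor λ^p conj(λ)^q of the representation σ_{-p,-q} is what p holomorphic and q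
antiholomorphic derivatives produce when h⁻¹ is replaced by λh⁻¹. -/
lemma actT_tensorOf (h : P n) (F : ASeries n) :
    actT h (tensorOf F) = tensorOf (pull (ambMat h) F) := by
  funext p q I J
  rw [tensorOf_apply, actT]
  split_ifs with hpq
  · simp [tensorOf_apply, hpq]
  · rw [jet_pull (ambMat_isConformal h).fix, Finset.mul_sum]
    refine Finset.sum_congr rfl fun K _ => ?_
    rw [Finset.mul_sum]
    refine Finset.sum_congr rfl fun M _ => ?_
    rw [tensorOf_apply, if_neg hpq]
    simp only [ambMat_apply, star_mul', Finset.prod_mul_distrib, Finset.prod_const,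
      Finset.card_univ, Fintype.card_fin]
    ring

/-- Every element comes from a real homogeneous harmonic series, and these properties are preserved
by pullback along a conformal linear map fixing ẽ_0. -/
lemma actT_mem_H0 (h : P n) {T : TFam n} (hT : T ∈ H0 n) : actT h T ∈ H0 n := by
  obtain ⟨F, h1, h2, -, h4, rfl⟩ := exists_tensorOf_eq hT
  have hA := ambMat_isConformal h
  rw [actT_tensorOf]
  refine tensorOf_mem_H0 ?_ ?_ ?_
  · rw [bar_pull hA.fix, h1]
  · rw [euler_pull hA.fix, h2, pull_zero hA.fix]
  · rw [lapA_pull hA, h4, pull_zero hA.fix, mul_zero]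

lemma actT_mul (h k : P n) {T : TFam n} (hT : T ∈ H0 n) :
    actT (h * k) T = actT h (actT k T) := by
  obtain ⟨F, -, -, -, -, rfl⟩ := exists_tensorOf_eq hT
  rw [actT_tensorOf, actT_tensorOf, actT_tensorOf, pull_pull (ambMat_isConformal h).fix
    (ambMat_isConformal k).fix, ambMat_mul]

lemma actT_one {T : TFam n} (hT : T ∈ H0 n) : actT 1 T = T := by
  obtain ⟨F, -, -, -, -, rfl⟩ := exists_tensorOf_eq hT
  rw [actT_tensorOf, ambMat_one, pull_one]

/-- The action on families of components as a linear map. -/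
noncomputable def actTL (h : P n) : TFam n →ₗ[ℝ] TFam n where
  toFun := actT h
  map_add' S T := by
    funext p q I J
    simp only [actT, Pi.add_apply, mul_add, Finset.sum_add_distrib]
  map_smul' r T := by
    funext p q I J
    simp only [actT, Pi.smul_apply, mul_smul_comm, ← Finset.smul_sum, RingHom.id_apply]

/-- By triangularity, a component of the transformed tensor involves only components of the same or
smaller weight. -/
lemma truncT_actT_eq_zero (h : P n) {N : ℕ} {T : TFam n} (hT : truncT n N T = 0) :
    truncT n N (actT h T) = 0 := by
  funext x
  obtain ⟨⟨p, q, I, J⟩, hx⟩ := x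
  change actT h T p q I J = 0
  change listWt I J < N at hx
  rw [actT]
  refine mul_eq_zero_of_right _ (Finset.sum_eq_zero fun K _ => Finset.sum_eq_zero fun M _ => ?_)
  by_cases hK : (∏ a, P.mat h⁻¹ (K a) (I a)) = 0
  · rw [hK, zero_mul, zero_mul]
  by_cases hM : (∏ b, star (P.mat h⁻¹ (M b) (J b))) = 0
  · rw [hM, mul_zero, zero_mul]
  have hw : listWt K M < N := by
    refine lt_of_le_of_lt (add_le_add (Finset.sum_le_sum fun a _ => ?_)
      (Finset.sum_le_sum fun b _ => ?_)) hx
    · exact P.wt_le_of_mat_ne_zero _ (Finset.prod_ne_zero_iff.mp hK a (Finset.mem_univ a))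
    · exact P.wt_le_of_mat_ne_zero _
        (star_ne_zero.mp (Finset.prod_ne_zero_iff.mp hM b (Finset.mem_univ b)))
  have := congrFun hT ⟨⟨p, q, K, M⟩, hw⟩
  change T p q K M = 0 at this
  rw [this, mul_zero]

/-! ### Compatibility with the action on jets -/

lemma coneRestrict_pull_xi (hA : ∀ I, A I .zero = e0 n I) (I : Idx n) :
    coneRestrict (pull A (xi I)) = linPt A I := by
  rw [pull_xi hA, coneRestrict_sum, linPt]
  simp only [coneRestrict_mul, coneRestrict_C, coneRestrict_xi]

lemma constantCoeff_linPt (k : Matrix (Idx n) (Idx n) ℂ) (I : Idx n) :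
    constantCoeff (linPt k I) = k I .zero := by
  rw [linPt, map_sum, Finset.sum_eq_single Idx.zero]
  · simp [constantCoeff_conePt, e0]
  · intro K _ hK; simp [constantCoeff_conePt, e0, hK]
  · simp

/-- The factor λ cancels in the quotient of two coordinates. -/
lemma coneRestrict_pull_aff (h : P n) (I : Idx n) :
    coneRestrict (pull (ambMat h) (aff I)) = projPt (P.mat h⁻¹) I := by
  have hA := (ambMat_isConformal h).fix
  have h1 := congrArg (fun F => coneRestrict (pull (ambMat h) F)) (aff_mul I)
  simp only [pull_mul hA, coneRestrict_mul, coneRestrict_pull_xi hA] at h1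
  have h2 : ∀ I, linPt (ambMat h) I = C (P.eig h) * linPt (P.mat h⁻¹) I := fun I => by
    simp only [linPt, ambMat_apply, map_mul, Finset.mul_sum, mul_assoc]
  rw [projPt, MvPowerSeries.eq_mul_inv_iff_mul_eq]
  · have h3 : (C (P.eig h⁻¹) * C (P.eig h) : BSeries n) = 1 := by
      rw [← map_mul, mul_comm, P.eig_mul_inv, map_one]
    rw [h2, h2] at h1
    linear_combination C (P.eig h⁻¹) * h1 - (coneRestrict (pull (ambMat h) (aff I)) *
      linPt (P.mat h⁻¹) .zero - linPt (P.mat h⁻¹) I) * h3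
  · rw [constantCoeff_linPt]
    exact P.eig_ne_zero h⁻¹

lemma coneRestrict_pull_affb (h : P n) (I : Idx n) :
    coneRestrict (pull (ambMat h) (affb I)) = bar (BVar.conj n) (projPt (P.mat h⁻¹) I) := by
  rw [← barA_aff, ← bar_pull (ambMat_isConformal h).fix, coneRestrict_bar, coneRestrict_pull_aff]

/-- The image point satisfies the equation of the sphere, because the pullback of L is a multiple of
L and so vanishes on the cone. -/
lemma sum_projPt_mul_bar (h : P n) :
    ∑ j : Fin (n - 1), projPt (P.mat h⁻¹) (.mid j) *
      bar (BVar.conj n) (projPt (P.mat h⁻¹) (.mid j)) =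
    projPt (P.mat h⁻¹) .last + bar (BVar.conj n) (projPt (P.mat h⁻¹) .last) := by
  have hA := ambMat_isConformal h
  have h1 := congrArg (fun F => coneRestrict (pull (ambMat h) F)) (Lser_mul_inv (n := n))
  simp only [pull_mul hA.fix, pull_C hA.fix, pull_add hA.fix, pull_sub hA.fix, pull_sum hA.fix,
    coneRestrict_mul, coneRestrict_C, coneRestrict_add, coneRestrict_sub, coneRestrict_sum,
    pull_Lser hA, coneRestrict_Lser, coneRestrict_pull_aff, coneRestrict_pull_affb] at h1
  rw [mul_zero, zero_mul] at h1
  have h2 : (C 2 * C (1 / 2) : BSeries n) = 1 := by rw [← map_mul]; norm_num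
  linear_combination C 2 * h1 + (projPt (P.mat h⁻¹) .last +
    bar (BVar.conj n) (projPt (P.mat h⁻¹) .last) - ∑ j : Fin (n - 1),
      projPt (P.mat h⁻¹) (.mid j) * bar (BVar.conj n) (projPt (P.mat h⁻¹) (.mid j))) * h2

lemma constantCoeff_projPt (h : P n) {I : Idx n} (hI : I ≠ .zero) :
    constantCoeff (projPt (P.mat h) I) = 0 := by
  rw [projPt, map_mul, constantCoeff_linPt, P.mat_zero]
  simp [e0, hI]

lemma constantCoeff_sphereMap (h : P n) (s : BVar n) :
    constantCoeff (sphereMap (P.mat h) s) = 0 := by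
  rcases s with j | j | _
  · exact constantCoeff_projPt h (by simp)
  · rw [sphereMap, constantCoeff_bar, constantCoeff_projPt h (by simp), star_zero]
  · rw [sphereMap, map_mul, map_sub, constantCoeff_bar, constantCoeff_projPt h (by simp)]
    simp

lemma hasSubst_sphereMap (h : P n) : HasSubst (sphereMap (P.mat h)) :=
  hasSubst_of_constantCoeff_zero (constantCoeff_sphereMap h)

lemma bar_sphereMap (k : Matrix (Idx n) (Idx n) ℂ) (s : BVar n) :
    bar (BVar.conj n) (sphereMap k (BVar.conj n s)) = sphereMap k s := by
  rcases s with j | j | _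
  · exact barB_barB _
  · rfl
  · change bar (BVar.conj n) (sphereMap k .v) = _
    rw [sphereMap, bar_mul, bar_C, map_sub, barB_barB]
    simp
    ring

lemma bar_actJ (h : P n) (f : BSeries n) :
    bar (BVar.conj n) (actJ h f) = actJ h (bar (BVar.conj n) f) := by
  rw [actJ, actJ, bar_subst _ (BVar.conj n) (constantCoeff_sphereMap h⁻¹)]
  congr 1
  funext s
  exact bar_sphereMap _ s

lemma actJ_mem_JE (h : P n) {f : BSeries n} (hf : f ∈ JE n) : actJ h f ∈ JE n := by
  rw [mem_JE_iff] at *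
  rw [bar_actJ, hf]

/-- For the last coordinate, v gives only the imaginary part of the image; its real part is |w'|²/2
by the sphere equation of the image point. -/
lemma actJ_conePt (h : P n) (I : Idx n) : actJ h (conePt n I) = projPt (P.mat h⁻¹) I := by
  have hs := hasSubst_sphereMap h⁻¹
  rcases I with _ | j | _
  · rw [actJ, conePt, subst_const_one hs, projPt, MvPowerSeries.mul_inv_cancel]
    rw [constantCoeff_linPt]
    exact P.eig_ne_zero h⁻¹
  · rw [actJ, conePt, subst_X hs]; rfl
  · have h3 : (C Complex.I * C (1 / (2 * Complex.I)) : BSeries n) = C (1 / 2) := by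
      rw [← map_mul]; congr 1; field_simp
    have h2 : (C (1 / 2) + C (1 / 2) : BSeries n) = 1 := by rw [← map_add]; norm_num
    rw [actJ, conePt, subst_add hs, subst_mul hs, subst_mul hs, subst_const hs, subst_const hs,
      subst_X hs, wSq, subst_sum hs]
    simp only [subst_mul hs, subst_X hs, sphereMap]
    rw [sum_projPt_mul_bar, ← mul_assoc, h3]
    linear_combination projPt (P.mat h⁻¹) .last * h2

/-- The restriction of `F ∘ (λ h⁻¹)` to the cone. -/
lemma coneRestrict_pull (h : P n) {F : ASeries n} (hF : Homog 0 F) :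
    coneRestrict (pull (ambMat h) F) = actJ h (coneRestrict F) := by
  have hA := (ambMat_isConformal h).fix
  have hs := hasSubst_sphereMap h⁻¹
  have hc0 : ∀ s, constantCoeff (pull (ambMat h) (affSub n s)) = 0 := fun s => by
    rw [pull, constantCoeff_subst_of_zero (constantCoeff_linSub hA), constantCoeff_affSub]
  -- Homogeneity lets F be written in affine coordinates, and it is enough to compare the two sides
  -- on these.
  conv_lhs => rw [← hF.subst_affSub]
  rw [pull, subst_comp_subst_apply (hasSubst_of_constantCoeff_zero constantCoeff_affSub)
    (hasSubst_linSub hA)]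
  change subst (coneSub n) (subst (fun s => pull (ambMat h) (affSub n s)) F) = _
  rw [subst_comp_subst_apply (hasSubst_of_constantCoeff_zero hc0) hasSubst_coneSub,
    actJ, coneRestrict, subst_comp_subst_apply hasSubst_coneSub hs]
  congr 1
  funext s
  change coneRestrict (pull (ambMat h) (affSub n s)) = actJ h (coneSub n s)
  have hsub : ∀ f g, actJ h (f - g) = actJ h f - actJ h g := fun f g => subst_map_sub hs f g
  have hC : ∀ c, actJ h (C c) = C c := fun c => subst_const hs c
  rcases s with I | I
  · rw [affSub, pull_sub hA, pull_C hA, coneRestrict_sub, coneRestrict_C, coneRestrict_pull_aff,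
      coneSub, hsub, hC, actJ_conePt]
  · rw [affSub, pull_sub hA, pull_C hA, coneRestrict_sub, coneRestrict_C, coneRestrict_pull_affb,
      coneSub, ← bar_actJ, hsub, hC, actJ_conePt, map_sub, bar_C, star_e0]

/-- A complex linear substitution keeps holomorphic series holomorphic and commutes with taking real
parts. -/
lemma actJ_mem_JP (h : P n) {f : BSeries n} (hf : f ∈ JP n) : actJ h f ∈ JP n := by
  have hA := (ambMat_isConformal h).fix
  obtain ⟨Q, hQ1, hQ2, rfl⟩ := exists_holomorphic_of_mem_JP hf
  have hp : pull (ambMat h) (realPart Q) = realPart (pull (ambMat h) Q) := by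
    rw [realPart, pull_mul hA, pull_C hA, pull_add hA, ← bar_pull hA, realPart]
  rw [← coneRestrict_realPart, ← coneRestrict_pull h (homog_realPart hQ1), hp,
    coneRestrict_realPart]
  refine mem_JP_of_holomorphic fun J => ?_
  rw [pderiv_etab_pull hA]
  simp [hQ2, pull_zero hA]

/-- Δ and L are both rescaled by the constant |λ|², so the order of ΔF along the cone is unchanged.
-/
lemma IsAmbientExtension.pull (h : P n) {f : BSeries n} {F : ASeries n}
    (hF : IsAmbientExtension f F) : IsAmbientExtension (actJ h f) (pull (ambMat h) F) := by
  have hA := ambMat_isConformal h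
  refine ⟨?_, ?_, ?_, ?_, ?_⟩
  · rw [bar_pull hA.fix, hF.real]
  · rw [euler_pull hA.fix, hF.homog, pull_zero hA.fix]
  · rw [eulerBar_pull hA.fix, hF.homogBar, pull_zero hA.fix]
  · rw [coneRestrict_pull h hF.homog_zero, hF.restrict]
  · obtain ⟨H, hH⟩ := hF.harmonic
    rw [lapA_pull hA, hH, pull_mul hA.fix, pull_pow hA.fix, pull_Lser hA, mul_pow]
    exact Dvd.intro (C (P.eig h * star (P.eig h)) * C (P.eig h * star (P.eig h)) ^ (n - 1) *
      JetIso.pull (ambMat h) H) (by ring)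

end Group

/-! ### Descent of linear maps to truncations -/

section Descent

variable {M A B : Type*} [AddCommGroup M] [AddCommGroup A] [AddCommGroup B] [Module ℝ M]
  [Module ℝ A] [Module ℝ B]

/-- A linear map that vanishes on the kernel of `α` descends to the image of `α`. -/
lemma exists_linearMap_map (p : Submodule ℝ M) (α : M →ₗ[ℝ] A) (β : p →ₗ[ℝ] B)
    (h : ∀ x : p, α x = 0 → β x = 0) :
    ∃ T : p.map α →ₗ[ℝ] B,
      ∀ x (hx : x ∈ p), T ⟨α x, Submodule.mem_map_of_mem hx⟩ = β ⟨x, hx⟩ := by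
  have hs : ∀ a : p.map α, ∃ x : p, α x = a := fun a => by
    obtain ⟨x, hx, hxa⟩ := a.2
    exact ⟨⟨x, hx⟩, hxa⟩
  -- Preimages are chosen arbitrarily; the kernel condition makes the value independent of the
  -- choice, and linearity follows.
  choose s hs using hs
  have key : ∀ (x : p) (a : p.map α), α x = a → β (s a) = β x := fun x a hx => by
    rw [← sub_eq_zero, ← map_sub]
    exact h _ (by rw [Submodule.coe_sub, map_sub, hs, hx, sub_self])
  refine ⟨{ toFun := fun a => β (s a), map_add' := fun a b => ?_, map_smul' := fun r a => ?_ },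
    fun x hx => key ⟨x, hx⟩ _ rfl⟩
  · rw [← map_add]
    exact key _ _ (by rw [Submodule.coe_add, map_add, hs, hs, Submodule.coe_add])
  · rw [RingHom.id_apply, ← map_smul]
    exact key _ _ (by rw [Submodule.coe_smul, map_smul, hs, Submodule.coe_smul])

end Descent

section Isomorphism

variable {n : ℕ}

/-! ### The action on truncated tensors -/

lemma exists_tensorRepresentation (n N : ℕ) : ∃ ρ : Representation ℝ (P n) (H0Trunc n N),
    ∀ (h : P n) (S : TFam n) (hS : S ∈ H0 n),
      ρ h (H0Trunc.mk N hS) = H0Trunc.mk N (actT_mem_H0 h hS) := by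
  have key : ∀ h : P n, ∃ R : H0Trunc n N →ₗ[ℝ] H0Trunc n N, ∀ (S : TFam n) (hS : S ∈ H0 n),
      R (H0Trunc.mk N hS) = H0Trunc.mk N (actT_mem_H0 h hS) := fun h =>
    exists_linearMap_map (H0 n) (truncT n N)
      ((truncT n N).submoduleMap (H0 n) ∘ₗ (actTL h).restrict fun _ hS => actT_mem_H0 h hS)
      fun S hS => Subtype.ext (truncT_actT_eq_zero h hS)
  choose R hR using key
  refine ⟨{ toFun := R, map_one' := ?_, map_mul' := fun h k => ?_ }, hR⟩
  · refine LinearMap.ext ?_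
    rintro ⟨_, S, hS, rfl⟩
    refine (hR 1 S hS).trans (Subtype.ext ?_)
    change truncT n N (actT 1 S) = truncT n N S
    rw [actT_one hS]
  · refine LinearMap.ext ?_
    rintro ⟨_, S, hS, rfl⟩
    refine (hR (h * k) S hS).trans ?_
    rw [Module.End.mul_apply]
    change _ = R h (R k (H0Trunc.mk N hS))
    rw [hR, hR]
    refine Subtype.ext ?_
    change truncT n N (actT (h * k) S) = truncT n N (actT h (actT k S))
    rw [actT_mul h k hS]

/-! ### The jet isomorphism -/

lemma real_smul_eq (r : ℝ) (F : ASeries n) : r • F = C (r : ℂ) * F := by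
  ext d
  rw [coeff_C_mul]
  exact Complex.real_smul

lemma IsAmbientExtension.add {f g : BSeries n} {F H : ASeries n} (hF : IsAmbientExtension f F)
    (hH : IsAmbientExtension g H) : IsAmbientExtension (f + g) (F + H) where
  real := by rw [map_add, hF.real, hH.real]
  homog := by
    have := map_add (eulerD n) F H
    simpa only [eulerD_apply, hF.homog, hH.homog, add_zero] using this
  homogBar := by
    have := map_add (eulerBarD n) F H
    simpa only [eulerBarD_apply, hF.homogBar, hH.homogBar, add_zero] using this
  restrict := by rw [coneRestrict_add, hF.restrict, hH.restrict]
  harmonic := by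
    rw [lapA_add]
    exact dvd_add hF.harmonic hH.harmonic

lemma IsAmbientExtension.smul (r : ℝ) {f : BSeries n} {F : ASeries n}
    (hF : IsAmbientExtension f F) : IsAmbientExtension (r • f) (r • F) where
  real := by rw [map_smul, hF.real]
  homog := (homog_zero_iff.mp (by rw [real_smul_eq]; exact hF.homog_zero.C_mul _)).1
  homogBar := (homog_zero_iff.mp (by rw [real_smul_eq]; exact hF.homog_zero.C_mul _)).2
  restrict := by
    rw [← hF.restrict]
    exact subst_smul hasSubst_coneSub r F
  harmonic := by
    rw [real_smul_eq, lapA_C_mul]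
    exact hF.harmonic.mul_left _

lemma tensorOf_add (F H : ASeries n) : tensorOf (F + H) = tensorOf F + tensorOf H := by
  have := tensorOf_sub (F + H) H
  rw [add_sub_cancel_right] at this
  rw [this, sub_add_cancel]

lemma tensorOf_smul (r : ℝ) (F : ASeries n) : tensorOf (r • F) = r • tensorOf F := by
  funext p q I J
  simp only [real_smul_eq, Pi.smul_apply, tensorOf, diffs_C_mul, map_mul, constantCoeff_C,
    Complex.real_smul, mul_ite, mul_zero]

lemma vanish_aff (I : Idx n) : Vanish (wtA n) I.wt (aff I) := (vanish_xi I).mul_right _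

lemma vanish_affb (I : Idx n) : Vanish (wtA n) I.wt (affb I) := (vanish_xib I).mul_right _

lemma Vanish.up {N : ℕ} {f : BSeries n} (hf : Vanish (wtB n) N f) : Vanish (wtA n) N (up f) := by
  refine hf.subst hasSubst_upSub fun s => ?_
  rcases s with j | j | _
  · exact vanish_aff (.mid j)
  · exact vanish_affb (.mid j)
  · exact ((vanish_aff .last).sub (vanish_affb .last)).mul_left _

/-- The components of weight `< 2n` of an ambient extension depend only on the coefficients of
weight `< 2n`. -/
lemma truncT_tensorOf_eq_zero (hn : 1 ≤ n) {f : BSeries n} {F : ASeries n} (hf : f ∈ JE n)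
    (hF : IsAmbientExtension f F) (h : truncB n (2 * n) f = 0) :
    truncT n (2 * n) (tensorOf F) = 0 := by
  have hv : Vanish (wtB n) (2 * n) f := fun d hd =>
    congrFun h ⟨d, by rwa [weight_wtB] at hd⟩
  -- One extension vanishes to weight 2n, and by uniqueness every other has the same components
  -- below that weight.
  obtain ⟨H, hH, hvH⟩ := exists_ambientExtension_vanish hn hf hv.up
  rw [truncT_tensorOf_eq hn hF hH (by rw [sub_self]; exact Submodule.zero_mem _)]
  funext x
  change tensorOf _ _ _ _ _ = 0
  rw [tensorOf_apply]
  split_ifs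
  · rfl
  · exact jet_eq_zero_of_vanish hvH _ _ x.2

/-- Extensions are chosen without regard to linearity. Sums and multiples of extensions are again
extensions, and uniqueness below weight 2n makes the map linear. -/
lemma exists_jetIsomorphism (hn : 1 ≤ n) :
    ∃ T : N0Trunc n (2 * n) ≃ₗ[ℝ] H0Trunc n (2 * n),
      ∀ (f g : BSeries n) (F : ASeries n) (hg : g ∈ N0 n), f - g ∈ JP n →
        IsAmbientExtension f F →
          (T (N0Trunc.mk (2 * n) hg) : TIdx n (2 * n) → ℂ) = truncT n (2 * n) (tensorOf F) := by
  have hext : ∀ g : N0 n, ∃ F : ASeries n, IsAmbientExtension (g : BSeries n) F := fun g =>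
    exists_ambientExtension hn (N0_le_JE g.2)
  choose E hE using hext
  have hself : ∀ f : BSeries n, f - f ∈ JP n := fun f => by
    rw [sub_self]; exact Submodule.zero_mem _
  have hmem : ∀ g, truncT n (2 * n) (tensorOf (E g)) ∈ H0Trunc n (2 * n) := fun g =>
    ⟨_, cutTensor_mem_H0_of_isAmbientExtension (hE g), truncT_cutTensor _ _⟩
  let β : N0 n →ₗ[ℝ] H0Trunc n (2 * n) :=
    { toFun := fun g => ⟨truncT n (2 * n) (tensorOf (E g)), hmem g⟩
      map_add' := fun f g => Subtype.ext <| by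
        change truncT n (2 * n) (tensorOf (E (f + g))) =
          truncT n (2 * n) (tensorOf (E f)) + truncT n (2 * n) (tensorOf (E g))
        rw [truncT_tensorOf_eq hn (hE (f + g)) ((hE f).add (hE g)) (hself _), tensorOf_add,
          map_add]
      map_smul' := fun r g => Subtype.ext <| by
        change truncT n (2 * n) (tensorOf (E (r • g))) = r • truncT n (2 * n) (tensorOf (E g))
        rw [truncT_tensorOf_eq hn (hE (r • g)) ((hE g).smul r) (hself _), tensorOf_smul,
          map_smul] }
  obtain ⟨T, hT⟩ := exists_linearMap_map (N0 n) (truncB n (2 * n)) β fun g hg =>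
    Subtype.ext (truncT_tensorOf_eq_zero hn (N0_le_JE g.2) (hE g) hg)
  have hT' : ∀ (f g : BSeries n) (F : ASeries n) (hg : g ∈ N0 n), f - g ∈ JP n →
      IsAmbientExtension f F →
        (T (N0Trunc.mk (2 * n) hg) : TIdx n (2 * n) → ℂ) = truncT n (2 * n) (tensorOf F) := by
    intro f g F hg hfg hF
    rw [truncT_tensorOf_eq hn hF (hE ⟨g, hg⟩) hfg]
    exact congrArg Subtype.val (hT g hg)
  refine ⟨LinearEquiv.ofBijective T ⟨?_, ?_⟩, hT'⟩
  -- Injectivity: an element of the slice whose tensors vanish below weight 2n is zero below that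
  -- weight.
  · rw [← LinearMap.ker_eq_bot, LinearMap.ker_eq_bot']
    rintro ⟨_, g, hg, rfl⟩ h0
    refine Subtype.ext (truncB_eq_zero hg (hE ⟨g, hg⟩) ?_)
    rw [← hT' g g _ hg (hself g) (hE ⟨g, hg⟩)]
    exact congrArg Subtype.val h0
  -- Surjectivity: the tensor is that of an exactly harmonic series, which is an ambient extension
  -- of its own restriction; the slice representative of that restriction is the preimage.
  · rintro ⟨_, S, hS, rfl⟩
    obtain ⟨F, h1, h2, h3, h4, rfl⟩ := exists_tensorOf_eq hS
    have hF : IsAmbientExtension (coneRestrict F) F := ⟨h1, h2, h3, rfl, by rw [h4]; simp⟩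
    have hJ : coneRestrict F ∈ JE n := mem_JE_iff.mpr (by rw [← coneRestrict_bar, h1])
    refine ⟨N0Trunc.mk (2 * n) (sub_reHol_holPart_mem hJ),
      Subtype.ext (hT' _ _ F (sub_reHol_holPart_mem hJ) ?_ hF)⟩
    rw [sub_sub_cancel]
    exact ⟨_, rfl⟩

end Isomorphism

end JetIso

/-! ### The representation on the truncated slice and equivariance -/

theorem theorem5p3 (n : ℕ) (hn : 1 ≤ n) :
    -- `J𝓔 = 𝓝_0 ⊕ J𝓟`, so that `𝓝_0 ≅ J𝓔 / J𝓟`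
    (JetIso.N0 n ⊔ JetIso.JP n = JetIso.JE n ∧ Disjoint (JetIso.N0 n) (JetIso.JP n)) ∧
    -- `P` acts on `J𝓔` and on `J𝓟`, hence on `J𝓔 / J𝓟`
    (∀ (h : JetIso.P n), (∀ f ∈ JetIso.JE n, JetIso.actJ h f ∈ JetIso.JE n) ∧
      ∀ f ∈ JetIso.JP n, JetIso.actJ h f ∈ JetIso.JP n) ∧
    -- every jet has an ambient extension
    (∀ f ∈ JetIso.JE n, ∃ F : JetIso.ASeries n, JetIso.IsAmbientExtension f F) ∧
    ∃ (ρN : Representation ℝ (JetIso.P n) (JetIso.N0Trunc n (2 * n)))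
      (ρH : Representation ℝ (JetIso.P n) (JetIso.H0Trunc n (2 * n)))
      (T : JetIso.N0Trunc n (2 * n) ≃ₗ[ℝ] JetIso.H0Trunc n (2 * n)),
      -- `ρN` is the quotient of the action on `𝓝_0` that comes from `𝓝_0 ≅ J𝓔 / J𝓟`
      (∀ (h : JetIso.P n) (f : JetIso.BSeries n) (hf : f ∈ JetIso.N0 n),
        ∃ (g : JetIso.BSeries n) (hg : g ∈ JetIso.N0 n), JetIso.actJ h f - g ∈ JetIso.JP n ∧
          ρN h (JetIso.N0Trunc.mk (2 * n) hf) = JetIso.N0Trunc.mk (2 * n) hg) ∧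
      -- `𝓗_0` is `P`-invariant, and `ρH` is the quotient of the action on `𝓗_0`
      (∀ (h : JetIso.P n) (S : JetIso.TFam n) (hS : S ∈ JetIso.H0 n),
        ∃ hS' : JetIso.actT h S ∈ JetIso.H0 n,
          ρH h (JetIso.H0Trunc.mk (2 * n) hS) = JetIso.H0Trunc.mk (2 * n) hS') ∧
      -- `T` sends the class of `f` modulo `J𝓟` to the components of weight `< 2n` of `∇̃^{p,q} f̃`
      (∀ (f g : JetIso.BSeries n) (F : JetIso.ASeries n) (hg : g ∈ JetIso.N0 n),
        f ∈ JetIso.JE n → f - g ∈ JetIso.JP n → JetIso.IsAmbientExtension f F →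
          (T (JetIso.N0Trunc.mk (2 * n) hg) : JetIso.TIdx n (2 * n) → ℂ) =
            JetIso.truncT n (2 * n) (JetIso.tensorOf F)) ∧
      -- `T` is `P`-equivariant
      ∀ (h : JetIso.P n) (a : JetIso.N0Trunc n (2 * n)), T (ρN h a) = ρH h (T a) := by
  obtain ⟨ρH, hρH⟩ := JetIso.exists_tensorRepresentation n (2 * n)
  obtain ⟨T, hT⟩ := JetIso.exists_jetIsomorphism hn
  -- Transport through T makes this a representation and T equivariant at once. What has to be
  -- proved is that it is induced by the action on jets.
  let ρN : Representation ℝ (JetIso.P n) (JetIso.N0Trunc n (2 * n)) :=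
    { toFun := fun h => T.symm.toLinearMap ∘ₗ ρH h ∘ₗ T.toLinearMap
      map_one' := LinearMap.ext fun a => by simp
      map_mul' := fun h k => LinearMap.ext fun a => by simp }
  have hρN : ∀ h a, T (ρN h a) = ρH h (T a) := fun h a => T.apply_symm_apply _
  refine ⟨⟨JetIso.N0_sup_JP, JetIso.disjoint_N0_JP⟩,
    fun h => ⟨fun f hf => JetIso.actJ_mem_JE h hf, fun f hf => JetIso.actJ_mem_JP h hf⟩,
    fun f hf => JetIso.exists_ambientExtension hn hf, ρN, ρH, T, ?_,
    fun h S hS => ⟨JetIso.actT_mem_H0 h hS, hρH h S hS⟩,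
    fun f g F hg _ hfg hF => hT f g F hg hfg hF, hρN⟩
  intro h f hf
  have hJ := JetIso.actJ_mem_JE h (JetIso.N0_le_JE hf)
  have hP : JetIso.actJ h f - (JetIso.actJ h f - JetIso.reHol (JetIso.holPart (JetIso.actJ h f))) ∈
      JetIso.JP n := by
    rw [sub_sub_cancel]
    exact ⟨_, rfl⟩
  refine ⟨_, JetIso.sub_reHol_holPart_mem hJ, hP, T.injective (Subtype.ext ?_)⟩
  obtain ⟨F, hF⟩ := JetIso.exists_ambientExtension hn (JetIso.N0_le_JE hf)
  -- `F` is harmonic only to finite order along the cone, so its full tensor need not lie in 𝓗_0;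
  -- the cut one does and represents the same truncated class.
  have hc := JetIso.cutTensor_mem_H0_of_isAmbientExtension hF
  have hTf : T (JetIso.N0Trunc.mk (2 * n) hf) = JetIso.H0Trunc.mk (2 * n) hc :=
    Subtype.ext ((hT f f F hf (by rw [sub_self]; exact Submodule.zero_mem _) hF).trans
      (JetIso.truncT_cutTensor _ _).symm)
  rw [hρN, hTf, hρH, hT _ _ _ _ hP (hF.pull h), ← JetIso.actT_tensorOf]
  refine sub_eq_zero.mp ?_
  -- The cut and the full tensor differ only in weights ≥ 2n, and the triangular action keeps that
  -- difference there.
  change JetIso.truncT n (2 * n) (JetIso.actTL h _) - JetIso.truncT n (2 * n) (JetIso.actTL h _) = 0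
  rw [← map_sub, ← map_sub]
  refine JetIso.truncT_actT_eq_zero h ?_
  rw [map_sub, JetIso.truncT_cutTensor, sub_self]
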